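/- Let $B_4=2.60\pm 0.01$ (that is, let $B_4$ be a real number with $|B_4-2.60|\le 0.01$) and let $L>2\pi/\sqrt{B_4}$. Let $L^2_{\rm per}(0,L)$ be the space of measurable complex-valued functions on $\mathbb R$ of period $L$ that are square integrable on $[0,L]$, with norm $\|u\|^2=\int_0^L|u|^2\,dx$ and real inner product $\langle u,v\rangle=\Re\int_0^L u\bar v\,dx$. For $t\in\mathbb R$ let $T^L_t$ be the operator on $L^2_{\rm per}(0,L)$ that multiplies the $n$-th Fourier coefficient $\frac1L\int_0^L e^{-i(2\pi n/L)x}u(x)\,dx$ by $e^{-i(2\pi n/L)^2t}$ for every $n\in\mathbb Z$. Put $$H_L(u)=-\frac{2\pi}{L}\int_0^1\int_0^L|T^L_tu(x)|^4\,dx\,dt,\qquad P(u)=\frac12\int_0^L|u|^2\,dx ,$$ and for $\lambda>0$ let $S_{L,\lambda}$ be the set of all minimizers of $H_L$ on $\{u\in L^2_{\rm per}(0,L):P(u)=\lambda\}$. Let $\nabla H_L(u)\in L^2_{\rm per}(0,L)$ be the gradient of $H_L$, determined by $\lim_{\epsilon\to0}\frac{H_L(u+\epsilon v)-H_L(u)}{\epsilon}=\langle\nabla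 H_L(u),v\rangle$ for all $v$. Write $d(u,S_{L,\lambda})=\inf_{\phi\in S_{L,\lambda}}\|u-\phi\|$. Then for every $\lambda>0$ the set $S_{L,\lambda}$ is nonempty, and it is stable in the following sense: for every $\epsilon>0$ there is $\delta>0$ such that for every $u_0\in L^2_{\rm per}(0,L)$ with $d(u_0,S_{L,\lambda})<\delta$, the periodic zero-average-dispersion DMNLS equation $$u_t=-i\nabla H_L(u)$$ has a unique strong solution $u:[0,\infty)\to L^2_{\rm per}(0,L)$ (differentiable in the $L^2_{\rm per}(0,L)$ norm) with $u(0)=u_0$, and this solution satisfies $d(u(t),S_{L,\lambda})<\epsilon$ for all $t\ge0$. -/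

import Mathlib

open MeasureTheory Filter Topology
open scoped ENNReal ComplexConjugate

noncomputable section

namespace DMNLS

/-- `L²_per(0,L)`: square integrable complex functions of period `L`, with
`‖u‖² = ∫₀ᴸ |u|² dx` (`volume` on `AddCircle L` has total mass `L`). -/
abbrev PerL2 (L : ℝ) [Fact (0 < L)] : Type :=
  Lp ℂ 2 (volume : Measure (AddCircle L))

/-- The multiplier `exp (-i (2πn/L)² t)` of the free Schrödinger evolution. -/
def schrodingerSymbol (L t : ℝ) (n : ℤ) : ℂ :=
  Complex.exp (((-((2 * Real.pi * n / L) ^ 2 * t) : ℝ) : ℂ) * Complex.I)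

theorem norm_schrodingerSymbol (L t : ℝ) (n : ℤ) : ‖schrodingerSymbol L t n‖ = 1 :=
  Complex.norm_exp_ofReal_mul_I _

/-- The free evolution is well defined: exactly one element of `L²_per(0,L)` has the Fourier
coefficients of `u` multiplied by the symbol. Here `fourierCoeff u n` is
`(1/L) ∫₀ᴸ exp (-i(2πn/L)x) u(x) dx`. -/
theorem existsUnique_schrodinger (L : ℝ) [Fact (0 < L)] (t : ℝ) (u : PerL2 L) :
    ∃! v : PerL2 L,
      ∀ n : ℤ, fourierCoeff v n = schrodingerSymbol L t n * fourierCoeff u n := by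
  have key : ∀ w : PerL2 L, MemLp w 2 (AddCircle.haarAddCircle (T := L)) := fun w =>
    memLp_haarAddCircle_iff.mpr (Lp.memLp w)
  have hcoef : ∀ (w : PerL2 L) (n : ℤ),
      (fourierBasis (T := L)).repr ((key w).toLp w) n = fourierCoeff w n := by
    intro w n
    rw [fourierBasis_repr]
    exact congrFun (fourierCoeff_congr_ae (key w).coeFn_toLp) n
  have hac : (volume : Measure (AddCircle L)) ≪ AddCircle.haarAddCircle := by
    rw [AddCircle.volume_eq_smul_haarAddCircle]
    exact Measure.smul_absolutelyContinuous
  have hca : (AddCircle.haarAddCircle : Measure (AddCircle L)) ≪ volume := by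
    rw [AddCircle.volume_eq_smul_haarAddCircle]
    exact Measure.absolutelyContinuous_smul (by simpa using (Fact.out : 0 < L))
  have hm : Memℓp (fun n : ℤ => schrodingerSymbol L t n * fourierCoeff u n) 2 := by
    refine ((lp.memℓp ((fourierBasis (T := L)).repr ((key u).toLp u))).norm).mono ?_
    intro n
    rw [norm_mul, norm_schrodingerSymbol, one_mul, hcoef]
  set f : Lp ℂ 2 (AddCircle.haarAddCircle (T := L)) :=
    (fourierBasis (T := L)).repr.symm ⟨_, hm⟩ with hf
  have hfv : MemLp f 2 (volume : Measure (AddCircle L)) :=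
    memLp_haarAddCircle_iff.mp (Lp.memLp f)
  have hfc : ∀ n, fourierCoeff (hfv.toLp f) n
      = schrodingerSymbol L t n * fourierCoeff u n := by
    intro n
    have h1 : fourierCoeff (hfv.toLp f) n = fourierCoeff f n :=
      congrFun (fourierCoeff_congr_ae (hca hfv.coeFn_toLp)) n
    rw [h1, ← fourierBasis_repr, hf, LinearIsometryEquiv.apply_symm_apply]
  refine ⟨hfv.toLp f, hfc, fun w hw => ?_⟩
  have h2 : (key w).toLp w = (key (hfv.toLp f)).toLp (hfv.toLp f) := by
    apply (fourierBasis (T := L)).repr.injective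
    ext n
    rw [hcoef, hcoef, hfc, hw]
  rw [MemLp.toLp_eq_toLp_iff] at h2
  exact Lp.ext (hac h2)

/-- `T^L_t`: the solution operator at time `t` of `i v_t + v_xx = 0` with period `L`. -/
def schrodinger (L : ℝ) [Fact (0 < L)] (t : ℝ) (u : PerL2 L) : PerL2 L :=
  (existsUnique_schrodinger L t u).choose

theorem fourierCoeff_schrodinger (L : ℝ) [Fact (0 < L)] (t : ℝ) (u : PerL2 L) (n : ℤ) :
    fourierCoeff (schrodinger L t u) n = schrodingerSymbol L t n * fourierCoeff u n :=
  (existsUnique_schrodinger L t u).choose_spec.1 n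

/-- The Hamiltonian `H_L(u) = -(2π/L) ∫₀¹ ∫₀ᴸ |T^L_t u(x)|⁴ dx dt`. -/
def hamiltonian (L : ℝ) [Fact (0 < L)] (u : PerL2 L) : ℝ :=
  -(2 * Real.pi / L) *
    (∫⁻ t in Set.Icc (0 : ℝ) 1, ∫⁻ x : AddCircle L, ‖schrodinger L t u x‖ₑ ^ 4).toReal

/-- `P(u) = ½ ∫₀ᴸ |u|² dx`. -/
def power (L : ℝ) [Fact (0 < L)] (u : PerL2 L) : ℝ :=
  (1 / 2) * ∫ x : AddCircle L, ‖u x‖ ^ 2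

/-- The real inner product `Re ∫₀ᴸ u(x) conj(v(x)) dx`. -/
def realInner (L : ℝ) [Fact (0 < L)] (u v : PerL2 L) : ℝ :=
  (∫ x : AddCircle L, u x * conj (v x)).re

/-- `g = ∇H_L(u)`: the gradient with respect to `realInner`, through directional derivatives. -/
def IsGradient (L : ℝ) [Fact (0 < L)] (u g : PerL2 L) : Prop :=
  ∀ v : PerL2 L,
    Tendsto (fun ε : ℝ => (hamiltonian L (u + ε • v) - hamiltonian L u) / ε)
      (𝓝[≠] 0) (𝓝 (realInner L g v))

/-- `u` is a strong solution on `[0,∞)` of `u_t = -i ∇H_L(u)` with `u(0) = u₀`; the time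
derivative is taken in the norm of `L²_per(0,L)` (one-sided at `t = 0`). -/
def IsSolution (L : ℝ) [Fact (0 < L)] (u₀ : PerL2 L) (u : ℝ → PerL2 L) : Prop :=
  u 0 = u₀ ∧ ∀ t : ℝ, 0 ≤ t → ∃ g : PerL2 L, IsGradient L (u t) g ∧
    HasDerivWithinAt u (-(Complex.I • g)) (Set.Ici 0) t

/-- `S_{L,λ}`: the minimizers of `H_L` subject to `P = λ`. -/
def groundStates (L : ℝ) [Fact (0 < L)] (lam : ℝ) : Set (PerL2 L) :=
  {φ | power L φ = lam ∧ ∀ ψ : PerL2 L, power L ψ = lam → hamiltonian L φ ≤ hamiltonian L ψ}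

end DMNLS

end

/-! Put `ω = (2π/L)²`, so that `ω < B₄ ≤ 2.61`, and let `a` be the Fourier coefficients of `u`.
Integrating `|T_t u|⁴` over space and time gives `H_L(u) = -2π · quartic (waveWeight ω) a`, where
the weight at frequency differences `(j, k)` is the average of `exp(2iωjkt)` over `[0,1]`
(`hamiltonian_eq`). The resonances `jk = 0` contribute `2‖a‖⁴ - Σ|aₙ|⁴`. Hence `H_L = -2π(2‖a‖⁴ +
Q(a))`, where `Q` is the form with weight `reducedWeight ω`, which decays away from the origin
(`quartic_waveWeight`, `weightDecay_reducedWeight`).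

Existence is concentration compactness in frequency. The forms are invariant under translation of
`a`. Because its weight decays, `Q` splits along weakly convergent sequences
(`tendsto_quartic_add_sub`) and is small when all coefficients are small (`exists_lt_norm_apply`).
Let `K` be the supremum of `2 + Q` on the unit sphere. If `K > 2`, a maximizing sequence cannot
vanish, and dichotomy is excluded by the strict convexity of `x ↦ x²`. So, after translation, it
converges strongly along a subsequence (`exists_shift_tendsto`), and almost maximizers lie near
maximizers (`exists_maximizers`).

It remains to make `Q` positive somewhere for every `ω < 2.61` (`exists_reducedWeight_pos`).
Multiplying a real sequence `α` by `exp(iωn²/2)` centres the time interval at `0` and turns `ω`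
times the full form into `F(ω)`, with `F(θ) = Σ αₙα_qα_pα_{p+q-n} ∫₀^θ cos((p-n)(q-n)s) ds`. The
derivative of `F` is a sum of squares, one of them `M²` with `M = Σαₙ²`. So `F(θ) > M²(ω+θ)` at a
single `θ ≤ ω` already gives `F(ω) > 2M²ω`, that is, `Q > 0`. One integer list therefore serves a
whole interval of `ω`, and a few lists cover the range; at angles with rational sine and cosine the
test is rational arithmetic.

Dynamically, `H_L` is a bounded quartic form on `L²`, so its gradient is Lipschitz on balls.
Invariance under `u ↦ e^{iθ}u` conserves the norm, which makes the flow global, and skewness of `i`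
conserves `H_L` (`exists_hamiltonian_flow`). Data near the minimizers thus stay almost minimizing,
hence near the minimizers (`exists_delta_of_almost_minimizers`). -/

namespace DMNLS

/-! ### Global solutions of autonomous equations with conserved norm -/

section ODE

variable {V : Type*} [NormedAddCommGroup V] [InnerProductSpace ℝ V]

/-- The radial retraction of `V` onto the closed ball of radius `R`. -/
noncomputable def radialRetraction (R : ℝ) (u : V) : V := (R / max R ‖u‖) • u

lemma radialRetraction_eq_self {R : ℝ} (hR : 0 < R) {u : V} (h : ‖u‖ ≤ R) :
    radialRetraction R u = u := by
  rw [radialRetraction, max_eq_left h, div_self hR.ne', one_smul]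

lemma norm_radialRetraction_le {R : ℝ} (hR : 0 < R) (u : V) : ‖radialRetraction R u‖ ≤ R := by
  have hm : 0 < max R ‖u‖ := lt_max_of_lt_left hR
  rw [radialRetraction, norm_smul, Real.norm_of_nonneg (by positivity), div_mul_eq_mul_div,
    div_le_iff₀ hm]
  exact mul_le_mul_of_nonneg_left (le_max_right _ _) hR.le

/-- Split the difference into a change of vector and a change of scalar factor; each costs at most
`‖u - v‖`. The constant is not sharp, but any Lipschitz constant serves. -/
lemma norm_radialRetraction_sub_le {R : ℝ} (hR : 0 < R) (u v : V) :
    ‖radialRetraction R u - radialRetraction R v‖ ≤ 2 * ‖u - v‖ := by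
  have hu : 0 < max R ‖u‖ := lt_max_of_lt_left hR
  have hv : 0 < max R ‖v‖ := lt_max_of_lt_left hR
  have key : radialRetraction R u - radialRetraction R v
      = (R / max R ‖u‖) • (u - v) + (R / max R ‖u‖ - R / max R ‖v‖) • v := by
    simp only [radialRetraction, smul_sub, sub_smul]; abel
  have h1 : R / max R ‖u‖ ≤ 1 := (div_le_one hu).2 (le_max_left _ _)
  have h2 : ‖v‖ / max R ‖v‖ ≤ 1 := (div_le_one hv).2 (le_max_right _ _)
  have h3 : |max R ‖v‖ - max R ‖u‖| ≤ ‖u - v‖ := by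
    refine (abs_max_sub_max_le_max R ‖v‖ R ‖u‖).trans ?_
    rw [sub_self, abs_zero, max_eq_right (abs_nonneg _), norm_sub_rev]
    exact abs_norm_sub_norm_le v u
  have h4 : |R / max R ‖u‖ - R / max R ‖v‖| * ‖v‖ ≤ ‖u - v‖ := by
    have : R / max R ‖u‖ - R / max R ‖v‖
        = (R / max R ‖u‖) * ((max R ‖v‖ - max R ‖u‖) / max R ‖v‖) := by
      field_simp
    rw [this, abs_mul, abs_of_nonneg (by positivity : 0 ≤ R / max R ‖u‖), abs_div, abs_of_pos hv]
    calc R / max R ‖u‖ * (|max R ‖v‖ - max R ‖u‖| / max R ‖v‖) * ‖v‖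
        = (R / max R ‖u‖) * |max R ‖v‖ - max R ‖u‖| * (‖v‖ / max R ‖v‖) := by ring
      _ ≤ 1 * ‖u - v‖ * 1 := by gcongr
      _ = ‖u - v‖ := by ring
  rw [key]
  refine (norm_add_le _ _).trans ?_
  rw [norm_smul, norm_smul, Real.norm_of_nonneg (by positivity), Real.norm_eq_abs]
  have := mul_le_mul_of_nonneg_right h1 (norm_nonneg (u - v))
  linarith

lemma eq_of_hasDerivWithinAt_zero {f : ℝ → ℝ} {s : Set ℝ} (hs : Convex ℝ s)
    (h : ∀ t ∈ s, HasDerivWithinAt f 0 s t) {t t' : ℝ} (ht : t ∈ s) (ht' : t' ∈ s) :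
    f t = f t' := by
  have := hs.norm_image_sub_le_of_norm_hasDerivWithin_le (C := 0) h (by simp) ht' ht
  simpa [sub_eq_zero] using this

lemma norm_eq_of_inner_field_eq_zero {Y : V → V} (hY : ∀ u, inner ℝ u (Y u) = 0) {u : ℝ → V}
    {s : Set ℝ} (hs : Convex ℝ s) (h : ∀ t ∈ s, HasDerivWithinAt u (Y (u t)) s t)
    {t t' : ℝ} (ht : t ∈ s) (ht' : t' ∈ s) : ‖u t‖ = ‖u t'‖ := by
  have : ‖u t‖ ^ 2 = ‖u t'‖ ^ 2 := by
    refine eq_of_hasDerivWithinAt_zero (f := fun t => ‖u t‖ ^ 2) hs (fun τ hτ => ?_) ht ht'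
    simpa [hY] using (h τ hτ).norm_sq
  exact (pow_left_inj₀ (norm_nonneg _) (norm_nonneg _) two_ne_zero).1 this

variable {X : V → V}

/-- Composing `X` with the retraction gives a bounded, globally Lipschitz field, for which
Picard–Lindelöf has no restriction on the time span. The truncated field is still orthogonal to the
position, so its solution keeps its norm and never leaves the ball where the truncation does
nothing. -/
lemma exists_solution_Icc [CompleteSpace V]
    (hlip : ∀ R : ℝ, ∃ K : NNReal, LipschitzOnWith K X (Metric.closedBall 0 R))
    (hX : ∀ u, inner ℝ u (X u) = 0) (u₀ : V) {T : ℝ} (hT : 0 ≤ T) :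
    ∃ u : ℝ → V, u 0 = u₀ ∧ ∀ t ∈ Set.Icc 0 T, HasDerivWithinAt u (X (u t)) (Set.Icc 0 T) t := by
  -- The `1` keeps `R` positive when `u₀ = 0`.
  set R : ℝ := ‖u₀‖ + 1 with hRdef
  have hR : 0 < R := by positivity
  obtain ⟨K, hK⟩ := hlip R
  have hmem : ∀ u : V, radialRetraction R u ∈ Metric.closedBall (0 : V) R := fun u => by
    simpa using norm_radialRetraction_le hR u
  set Y : V → V := fun u => X (radialRetraction R u) with hYdef
  have hY : ∀ u, inner ℝ u (Y u) = 0 := by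
    intro u
    have h := hX (radialRetraction R u)
    have hc : R / max R ‖u‖ ≠ 0 := (div_pos hR (lt_max_of_lt_left hR)).ne'
    -- The retraction is radial: the retracted point is a positive multiple of `u`, so orthogonality
    -- passes back to `u`.
    nth_rw 1 [radialRetraction] at h
    rw [real_inner_smul_left] at h
    exact (mul_eq_zero.1 h).resolve_left hc
  have hYlip : LipschitzWith (K * 2) Y := by
    refine LipschitzWith.of_dist_le_mul fun u v => ?_
    refine (hK.dist_le_mul _ (hmem u) _ (hmem v)).trans ?_
    rw [dist_eq_norm, dist_eq_norm, NNReal.coe_mul, mul_assoc]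
    exact mul_le_mul_of_nonneg_left (norm_radialRetraction_sub_le hR u v) K.2
  set B : NNReal := ‖X 0‖₊ + K * R.toNNReal with hB
  have hYB : ∀ u, ‖Y u‖ ≤ B := by
    intro u
    have h0 : (0 : V) ∈ Metric.closedBall (0 : V) R := by simp [hR.le]
    have h1 := hK.dist_le_mul _ (hmem u) _ h0
    have h2 : ‖Y u‖ ≤ ‖X 0‖ + ‖X (radialRetraction R u) - X 0‖ := by
      simpa [hYdef] using norm_add_le (X 0) (X (radialRetraction R u) - X 0)
    rw [dist_eq_norm, dist_zero_right] at h1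
    have h3 := mul_le_mul_of_nonneg_left (norm_radialRetraction_le hR u) K.2
    simp only [hB, NNReal.coe_add, coe_nnnorm, NNReal.coe_mul, Real.coe_toNNReal _ hR.le]
    exact h2.trans (add_le_add le_rfl (h1.trans h3))
  have hPL : IsPicardLindelof (fun _ => Y) (tmin := 0) (tmax := T) ⟨0, le_rfl, hT⟩ u₀
      (B * T.toNNReal) 0 B (K * 2) :=
    { lipschitzOnWith := fun _ _ => hYlip.lipschitzOnWith
      continuousOn := fun _ _ => continuousOn_const
      norm_le := fun _ _ x _ => hYB x
      mul_max_le := by simp [Real.coe_toNNReal _ hT, max_eq_left hT] }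
  obtain ⟨u, hu0, hu⟩ := hPL.exists_eq_forall_mem_Icc_hasDerivWithinAt₀
  refine ⟨u, hu0, fun t ht => ?_⟩
  have hn : ‖u t‖ = ‖u 0‖ :=
    norm_eq_of_inner_field_eq_zero hY (convex_Icc 0 T) hu ht (Set.left_mem_Icc.2 hT)
  have hle : ‖u t‖ ≤ R := by
    rw [hn]; simp only at hu0; rw [hu0]; linarith
  have := hu t ht
  simpa only [hYdef, radialRetraction_eq_self hR hle] using this

/-- Norm conservation confines both solutions to the ball of radius `‖u 0‖`, so one Lipschitz
constant is enough for Grönwall. -/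
lemma solution_unique_Icc
    (hlip : ∀ R : ℝ, ∃ K : NNReal, LipschitzOnWith K X (Metric.closedBall 0 R))
    (hX : ∀ u, inner ℝ u (X u) = 0) {T : ℝ} {u v : ℝ → V} (h0 : u 0 = v 0)
    (hu : ∀ t ∈ Set.Icc 0 T, HasDerivWithinAt u (X (u t)) (Set.Icc 0 T) t)
    (hv : ∀ t ∈ Set.Icc 0 T, HasDerivWithinAt v (X (v t)) (Set.Icc 0 T) t) :
    Set.EqOn u v (Set.Icc 0 T) := by
  obtain ⟨K, hK⟩ := hlip ‖u 0‖
  have hIci : ∀ {w : ℝ → V}, (∀ t ∈ Set.Icc 0 T, HasDerivWithinAt w (X (w t)) (Set.Icc 0 T) t) →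
      ∀ t ∈ Set.Ico 0 T, HasDerivWithinAt w (X (w t)) (Set.Ici t) t := fun hw t ht =>
    (hw t ⟨ht.1, ht.2.le⟩).mono_of_mem_nhdsWithin
      (Filter.mem_of_superset (Icc_mem_nhdsGE ht.2) (Set.Icc_subset_Icc_left ht.1))
  have hball : ∀ {w : ℝ → V}, w 0 = u 0 →
      (∀ t ∈ Set.Icc 0 T, HasDerivWithinAt w (X (w t)) (Set.Icc 0 T) t) →
      ∀ t ∈ Set.Ico 0 T, w t ∈ Metric.closedBall (0 : V) ‖u 0‖ := fun {w} hw0 hw t ht => by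
    rw [mem_closedBall_zero_iff, norm_eq_of_inner_field_eq_zero hX (convex_Icc 0 T) hw
      ⟨ht.1, ht.2.le⟩ (Set.left_mem_Icc.2 (ht.1.trans ht.2.le)), hw0]
  exact ODE_solution_unique_of_mem_Icc_right (v := fun _ => X)
    (s := fun _ => Metric.closedBall 0 ‖u 0‖) (fun _ _ => hK)
    (fun t ht => (hu t ht).continuousWithinAt) (hIci hu) (hball rfl hu)
    (fun t ht => (hv t ht).continuousWithinAt) (hIci hv) (hball h0.symm hv) h0

/-- Global well-posedness of `u' = X u` for a field that is Lipschitz on balls and orthogonal to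
the position. -/
theorem exists_unique_global_solution [CompleteSpace V]
    (hlip : ∀ R : ℝ, ∃ K : NNReal, LipschitzOnWith K X (Metric.closedBall 0 R))
    (hX : ∀ u, inner ℝ u (X u) = 0) (u₀ : V) :
    ∃ u : ℝ → V, (u 0 = u₀ ∧ ∀ t, 0 ≤ t → HasDerivWithinAt u (X (u t)) (Set.Ici 0) t) ∧
      ∀ v : ℝ → V, v 0 = u₀ → (∀ t, 0 ≤ t → HasDerivWithinAt v (X (v t)) (Set.Ici 0) t) →
        ∀ t, 0 ≤ t → v t = u t := by
  choose α hα0 hα using fun N : ℕ =>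
    exists_solution_Icc hlip hX u₀ (T := (N : ℝ)) N.cast_nonneg
  have hcons : ∀ M N : ℕ, M ≤ N → Set.EqOn (α N) (α M) (Set.Icc 0 (M : ℝ)) := fun M N hMN => by
    have hsub : Set.Icc (0 : ℝ) M ⊆ Set.Icc 0 N :=
      Set.Icc_subset_Icc_right (Nat.cast_le.2 hMN)
    exact solution_unique_Icc hlip hX ((hα0 N).trans (hα0 M).symm)
      (fun t ht => (hα N t (hsub ht)).mono hsub) (hα M)
  set u : ℝ → V := fun t => α ⌈t⌉₊ t with hu
  have huα : ∀ N : ℕ, Set.EqOn u (α N) (Set.Icc 0 (N : ℝ)) := fun N t ht =>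
    (hcons ⌈t⌉₊ N (Nat.ceil_le.2 ht.2) ⟨ht.1, Nat.le_ceil t⟩).symm
  have hsol : ∀ t, 0 ≤ t → HasDerivWithinAt u (X (u t)) (Set.Ici 0) t := fun t ht => by
    -- With `⌈t⌉₊ + 1` rather than `⌈t⌉₊`, the time `t` lies strictly below the right endpoint, so a
    -- derivative within `[0,N]` is a derivative within `[0,∞)`.
    have htN : t < ((⌈t⌉₊ + 1 : ℕ) : ℝ) := by
      push_cast; linarith [Nat.le_ceil t]
    have hmem : t ∈ Set.Icc (0 : ℝ) ((⌈t⌉₊ + 1 : ℕ) : ℝ) := ⟨ht, htN.le⟩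
    have h1 := (hα _ t hmem).congr_of_mem (huα _) hmem
    rw [← huα _ hmem] at h1
    refine h1.mono_of_mem_nhdsWithin ?_
    rw [← Set.Ici_inter_Iic]
    exact Filter.inter_mem self_mem_nhdsWithin (mem_nhdsWithin_of_mem_nhds (Iic_mem_nhds htN))
  refine ⟨u, ⟨by simp [hu, hα0], hsol⟩, fun v hv0 hv t ht => ?_⟩
  have hu0 : u 0 = u₀ := by simp [hu, hα0]
  exact solution_unique_Icc hlip hX (T := t) (hv0.trans hu0.symm)
    (fun s hs => (hv s hs.1).mono Set.Icc_subset_Ici_self)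
    (fun s hs => (hsol s hs.1).mono Set.Icc_subset_Ici_self) ⟨ht, le_rfl⟩

end ODE

/-! ### Derivatives of quartic forms -/

section Quartic

variable {V : Type*} [NormedAddCommGroup V] [InnerProductSpace ℝ V]
  (M : ContinuousMultilinearMap ℝ (fun _ : Fin 4 => V) ℝ)

/-- The derivative at `u` of the quartic form `u ↦ M (u, u, u, u)`. -/
noncomputable def quarticDeriv (u : V) : V →L[ℝ] ℝ :=
  ∑ i : Fin 4, M.toContinuousLinearMap (fun _ => u) i

lemma quarticDeriv_apply (u v : V) :
    quarticDeriv M u v = ∑ i : Fin 4, M (Function.update (fun _ => u) i v) := by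
  simp [quarticDeriv, ContinuousMultilinearMap.toContinuousLinearMap]

lemma hasFDerivAt_quartic (u : V) :
    HasFDerivAt (fun u => M (fun _ => u)) (quarticDeriv M u) u := by
  have h := (M.hasFDerivAt (x := fun _ => u)).comp u
    (hasFDerivAt_pi.2 fun _ : Fin 4 => hasFDerivAt_id (𝕜 := ℝ) u)
  have hd : quarticDeriv M u = (M.linearDeriv fun _ => u) ∘L
      ContinuousLinearMap.pi fun _ => ContinuousLinearMap.id ℝ V := by
    ext v
    simp [quarticDeriv_apply, ContinuousMultilinearMap.linearDeriv_apply]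
  rw [hd]
  exact h

lemma quarticDeriv_lipschitzOn (R : ℝ) :
    ∃ K : NNReal, LipschitzOnWith K (quarticDeriv M) (Metric.closedBall 0 R) := by
  -- `C` bounds all four slots at once: three hold a point of the ball, the fourth a unit vector.
  set C : ℝ := max R 1 with hC
  have hC1 : 1 ≤ C := le_max_right _ _
  refine ⟨(4 * (‖M‖ * 4 * C ^ 3)).toNNReal, LipschitzOnWith.of_dist_le_mul fun u hu v hv => ?_⟩
  rw [mem_closedBall_zero_iff] at hu hv
  rw [Real.coe_toNNReal _ (by positivity), dist_eq_norm, dist_eq_norm]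
  refine ContinuousLinearMap.opNorm_le_of_unit_norm (by positivity) fun w hw => ?_
  have hb : ∀ (i : Fin 4) (u : V), ‖u‖ ≤ R → ‖Function.update (fun _ => u) i w‖ ≤ C := by
    intro i u hu
    refine (pi_norm_le_iff_of_nonneg (by positivity)).2 fun j => ?_
    by_cases h : j = i
    · subst h; simp [hw, hC1]
    · rw [Function.update_of_ne h]; exact hu.trans (le_max_left _ _)
  rw [sub_apply, quarticDeriv_apply, quarticDeriv_apply,
    ← Finset.sum_sub_distrib]
  refine (norm_sum_le _ _).trans ((Finset.sum_le_card_nsmul _ _ (‖M‖ * 4 * C ^ 3 * ‖u - v‖)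
    fun i _ => ?_).trans_eq (by simp; ring))
  refine (M.norm_image_sub_le _ _).trans ?_
  have h1 : ‖Function.update (fun _ => u) i w - Function.update (fun _ => v) i w‖ ≤ ‖u - v‖ := by
    refine (pi_norm_le_iff_of_nonneg (by positivity)).2 fun j => ?_
    by_cases h : j = i
    · subst h; simp
    · simp [h]
  have h2 : max ‖Function.update (fun _ => u) i w‖ ‖Function.update (fun _ => v) i w‖ ≤ C :=
    max_le (hb i u hu) (hb i v hv)
  simp only [Fintype.card_fin, Nat.cast_ofNat, Nat.add_one_sub_one]
  gcongr

end Quartic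

end DMNLS

namespace DMNLS

/-! ### Hamiltonian flow of a phase-invariant quartic form -/

section Flow

variable {V : Type*} [NormedAddCommGroup V] [InnerProductSpace ℝ V]

lemma quartic_lipschitzOn (M : ContinuousMultilinearMap ℝ (fun _ : Fin 4 => V) ℝ) (R : ℝ) :
    ∃ K : NNReal, LipschitzOnWith K (fun u => M fun _ => u) (Metric.closedBall 0 R) := by
  set C : ℝ := max R 1 with hC
  have hC1 : 1 ≤ C := le_max_right _ _
  refine ⟨(‖M‖ * 4 * C ^ 3).toNNReal, LipschitzOnWith.of_dist_le_mul fun u hu v hv => ?_⟩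
  rw [mem_closedBall_zero_iff] at hu hv
  rw [Real.coe_toNNReal _ (by positivity), dist_eq_norm, dist_eq_norm]
  refine (M.norm_image_sub_le _ _).trans ?_
  have h1 : ‖(fun _ : Fin 4 => u) - (fun _ => v)‖ ≤ ‖u - v‖ :=
    (pi_norm_le_iff_of_nonneg (by positivity)).2 fun j => by simp
  have h2 : max ‖(fun _ : Fin 4 => u)‖ ‖(fun _ : Fin 4 => v)‖ ≤ C := by
    refine max_le ?_ ?_ <;> refine (pi_norm_le_iff_of_nonneg (by positivity)).2 fun j => ?_
    · exact hu.trans (le_max_left _ _)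
    · exact hv.trans (le_max_left _ _)
  simp only [Fintype.card_fin, Nat.cast_ofNat, Nat.add_one_sub_one]
  gcongr

/-- Infinitesimal form of the phase invariance: differentiate the constant value of the form along
the orbit `θ ↦ cos θ u + sin θ Ju` at `θ = 0`. -/
lemma quarticDeriv_apply_rotation
    {M : ContinuousMultilinearMap ℝ (fun _ : Fin 4 => V) ℝ} {J : V →L[ℝ] V}
    (hM : ∀ (θ : ℝ) (u : V), (M fun _ => Real.cos θ • u + Real.sin θ • J u) = M fun _ => u)
    (u : V) : quarticDeriv M u (J u) = 0 := by
  have hc : HasDerivAt (fun θ : ℝ => Real.cos θ • u + Real.sin θ • J u) (J u) 0 := by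
    have h := ((Real.hasDerivAt_cos 0).smul_const u).fun_add
      ((Real.hasDerivAt_sin 0).smul_const (J u))
    simpa using h
  have hF : HasFDerivAt (fun u => M fun _ => u) (quarticDeriv M u)
      (Real.cos 0 • u + Real.sin 0 • J u) := by
    simpa using hasFDerivAt_quartic M u
  have h := hF.comp_hasDerivAt (0 : ℝ) hc
  have h' : HasDerivAt (fun _ : ℝ => M fun _ => u) (quarticDeriv M u (J u)) 0 :=
    h.congr_of_eventuallyEq (Filter.Eventually.of_forall fun θ => (hM θ u).symm)
  exact h'.unique (hasDerivAt_const _ _)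

variable [CompleteSpace V] (M : ContinuousMultilinearMap ℝ (fun _ : Fin 4 => V) ℝ)

/-- The gradient at `u` of the quartic form `u ↦ M (u, u, u, u)`. -/
noncomputable def quarticGradient (u : V) : V :=
  (InnerProductSpace.toDual ℝ V).symm (quarticDeriv M u)

lemma inner_quarticGradient (u v : V) : inner ℝ (quarticGradient M u) v = quarticDeriv M u v := by
  rw [quarticGradient, InnerProductSpace.toDual_symm_apply]

lemma quarticGradient_lipschitzOn (R : ℝ) :
    ∃ K : NNReal, LipschitzOnWith K (quarticGradient M) (Metric.closedBall 0 R) := by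
  obtain ⟨K, hK⟩ := quarticDeriv_lipschitzOn M R
  refine ⟨K, LipschitzOnWith.of_dist_le_mul fun u hu v hv => ?_⟩
  have h := hK.dist_le_mul u hu v hv
  rwa [← LinearIsometryEquiv.dist_map (InnerProductSpace.toDual ℝ V).symm] at h

variable {M} {J : V →L[ℝ] V}

/-- Global well-posedness and conservation laws of the Hamiltonian flow of a quartic form. -/
theorem exists_hamiltonian_flow (hJ : ∀ u v, inner ℝ u (J v) = -inner ℝ (J u) v)
    (hM : ∀ (θ : ℝ) (u : V), (M fun _ => Real.cos θ • u + Real.sin θ • J u) = M fun _ => u)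
    (u₀ : V) :
    ∃ u : ℝ → V, (u 0 = u₀ ∧ ∀ t, 0 ≤ t →
        HasDerivWithinAt u (-J (quarticGradient M (u t))) (Set.Ici 0) t) ∧
      (∀ v : ℝ → V, v 0 = u₀ → (∀ t, 0 ≤ t →
        HasDerivWithinAt v (-J (quarticGradient M (v t))) (Set.Ici 0) t) →
          ∀ t, 0 ≤ t → v t = u t) ∧
      ∀ t, 0 ≤ t → ‖u t‖ = ‖u₀‖ ∧ (M fun _ => u t) = M fun _ => u₀ := by
  have hlip : ∀ R : ℝ, ∃ K : NNReal,
      LipschitzOnWith K (fun u => -J (quarticGradient M u)) (Metric.closedBall 0 R) := fun R => by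
    obtain ⟨K, hK⟩ := quarticGradient_lipschitzOn M R
    exact ⟨_, ((-J).lipschitz.comp_lipschitzOnWith hK)⟩
  -- By skewness this inner product is the derivative of the form in the direction `J u`, which
  -- vanishes by phase invariance.
  have hX : ∀ u : V, inner ℝ u (-J (quarticGradient M u)) = 0 := fun u => by
    rw [inner_neg_right, hJ, neg_neg, real_inner_comm, inner_quarticGradient,
      quarticDeriv_apply_rotation hM]
  obtain ⟨u, ⟨hu0, hu⟩, huniq⟩ := exists_unique_global_solution hlip hX u₀
  refine ⟨u, ⟨hu0, hu⟩, huniq, fun t ht => ⟨?_, ?_⟩⟩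
  · rw [norm_eq_of_inner_field_eq_zero hX (convex_Ici 0) hu ht Set.self_mem_Ici, hu0]
  · have h := eq_of_hasDerivWithinAt_zero (f := fun t => M fun _ => u t) (convex_Ici (0 : ℝ))
      (fun τ hτ => ?_) (Set.mem_Ici.2 ht) Set.self_mem_Ici
    · simpa only [hu0] using h
    · have h := (hasFDerivAt_quartic M (u τ)).comp_hasDerivWithinAt τ (hu τ hτ)
      -- Energy conservation: the gradient is orthogonal to its own image under the skew map `J`.
      have h0 : quarticDeriv M (u τ) (-J (quarticGradient M (u τ))) = 0 := by
        have h1 := hJ (quarticGradient M (u τ)) (quarticGradient M (u τ))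
        have h2 := real_inner_comm (J (quarticGradient M (u τ))) (quarticGradient M (u τ))
        rw [← inner_quarticGradient, inner_neg_right]
        linarith
      rwa [h0] at h

end Flow

/-! ### From compactness and conservation laws to stability -/

/-- A set of constrained minimizers near which every almost minimizer lies is stable under
conservation of the norm and of the functional. -/
theorem exists_delta_of_almost_minimizers {V : Type*} [NormedAddCommGroup V] [NormedSpace ℝ V]
    {F : V → ℝ} (hF : ∀ R : ℝ, ∃ K : NNReal, LipschitzOnWith K F (Metric.closedBall 0 R))
    {r E : ℝ} (hr : 0 < r) {S : Set V} (hS : S.Nonempty) (hSE : ∀ φ ∈ S, ‖φ‖ = r ∧ F φ = E)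
    (hcomp : ∀ ε : ℝ, 0 < ε → ∃ η : ℝ, 0 < η ∧
      ∀ u : V, ‖u‖ = r → F u < E + η → Metric.infDist u S < ε)
    {ε : ℝ} (hε : 0 < ε) :
    ∃ δ : ℝ, 0 < δ ∧ ∀ u₀ : V, Metric.infDist u₀ S < δ →
      ∀ u : V, ‖u‖ = ‖u₀‖ → F u = F u₀ → Metric.infDist u S < ε := by
  obtain ⟨η, hη, hcomp⟩ := hcomp (ε / 2) (half_pos hε)
  obtain ⟨K, hK⟩ := hF (2 * r)
  have hKp : (0 : ℝ) < 2 * K + 1 := by positivity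
  -- `r / 2` keeps all points in the ball of radius `2r` and `u` away from `0`; `ε / 2` pays for
  -- rescaling `u` to the sphere; the last bound makes two Lipschitz errors `K d` sum to less than
  -- `η`.
  refine ⟨min (r / 2) (min (ε / 2) (η / (2 * K + 1))), by positivity, fun u₀ hu₀ u hu hFu => ?_⟩
  obtain ⟨φ, hφ, hd⟩ := (Metric.infDist_lt_iff hS).1 hu₀
  obtain ⟨hφr, hφE⟩ := hSE φ hφ
  set d := dist u₀ φ with hd_def
  have hd1 : d < r / 2 := hd.trans_le (min_le_left _ _)
  have hd2 : d < ε / 2 := hd.trans_le ((min_le_right _ _).trans (min_le_left _ _))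
  have hd3 : d < η / (2 * K + 1) := hd.trans_le ((min_le_right _ _).trans (min_le_right _ _))
  rw [lt_div_iff₀ hKp] at hd3
  have hnorm : |‖u‖ - r| ≤ d := by
    rw [hu, ← hφr, hd_def, dist_eq_norm]
    exact abs_norm_sub_norm_le _ _
  obtain ⟨hn1, hn2⟩ := abs_le.1 hnorm
  have hupos : 0 < ‖u‖ := by linarith
  set u' : V := (r / ‖u‖) • u with hu'
  have hu'r : ‖u'‖ = r := by
    rw [hu', norm_smul, Real.norm_of_nonneg (by positivity), div_mul_cancel₀ _ hupos.ne']
  have hdist : dist u' u ≤ d := by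
    have : u' - u = ((r - ‖u‖) / ‖u‖) • u := by
      rw [hu', sub_div, div_self hupos.ne', sub_smul, one_smul]
    rw [dist_eq_norm, this, norm_smul, norm_div, norm_norm, div_mul_cancel₀ _ hupos.ne',
      Real.norm_eq_abs, abs_sub_comm]
    exact hnorm
  have hball : ∀ v : V, ‖v‖ ≤ 2 * r → v ∈ Metric.closedBall (0 : V) (2 * r) := fun v hv => by
    simpa using hv
  have h1 := hK.dist_le_mul u' (hball _ (by linarith)) u (hball _ (by linarith))
  have h2 := hK.dist_le_mul u₀ (hball _ (by linarith)) φ (hball _ (by linarith))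
  rw [Real.dist_eq] at h1 h2
  have h3 := mul_le_mul_of_nonneg_left hdist K.2
  have h4 := (abs_le.1 h1).2
  have h5 := (abs_le.1 h2).2
  have hd0 : 0 ≤ d := dist_nonneg
  have hlt : F u' < E + η := by
    have : F u' - E ≤ K * d + K * d := by
      rw [← hφE]; simp only [← hd_def, NNReal.val_eq_coe] at *; linarith
    linarith
  have := hcomp u' hu'r hlt
  have h6 := Metric.infDist_le_infDist_add_dist (s := S) (x := u) (y := u')
  rw [dist_comm] at h6
  linarith

end DMNLS

/-! ### Quadrilinear forms on square summable sequences and their Schur bound -/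

namespace DMNLS

/-- Square summable sequences of Fourier coefficients. -/
abbrev SeqL2 : Type := lp (fun _ : ℤ => ℂ) 2

lemma tsum_enorm_sq (a : SeqL2) : ∑' n, ‖a n‖ₑ ^ 2 = ENNReal.ofReal (‖a‖ ^ 2) := by
  have h := lp.hasSum_norm (p := 2) (by norm_num) a
  norm_num at h
  rw [← h.tsum_eq, ENNReal.ofReal_tsum_of_nonneg (fun n => by positivity) h.summable]
  refine tsum_congr fun n => ?_
  rw [ENNReal.ofReal_pow (norm_nonneg _), ofReal_norm]

lemma tsum_norm_sq (a : SeqL2) : ∑' n, ‖a n‖ ^ 2 = ‖a‖ ^ 2 := by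
  have h := lp.hasSum_norm (p := 2) (by norm_num) a
  norm_num at h
  exact h.tsum_eq

lemma summable_norm_sq (a : SeqL2) : Summable fun n => ‖a n‖ ^ 2 := by
  have h := lp.hasSum_norm (p := 2) (by norm_num) a
  norm_num at h
  exact h.summable

lemma norm_apply_le (a : SeqL2) (n : ℤ) : ‖a n‖ ≤ ‖a‖ := lp.norm_apply_le_norm (by norm_num) a n

section Schur

variable (g y z : ℤ → ℝ≥0∞)

lemma tsum_int_add_left (n : ℤ) : ∑' k, y (n + k) = ∑' k, y k := (Equiv.addLeft n).tsum_eq y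

lemma tsum_int_add_right (n : ℤ) : ∑' k, y (k + n) = ∑' k, y k := (Equiv.addRight n).tsum_eq y

/-- In this identity and its three variants the three index forms that occur are independent, so the
triple sum factors by Tonelli and translation invariance. -/
lemma tsum_schur_left_parallel :
    ∑' p : ℤ × ℤ × ℤ, g p.2.1 * (y (p.1 + p.2.1) * z (p.1 + p.2.2))
      = (∑' j, g j) * (∑' n, y n) * ∑' n, z n := by
  rw [ENNReal.tsum_prod (f := fun n (q : ℤ × ℤ) => g q.1 * (y (n + q.1) * z (n + q.2)))]
  simp_rw [ENNReal.tsum_prod', ENNReal.tsum_mul_left, tsum_int_add_left]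
  rw [ENNReal.tsum_comm]
  simp_rw [ENNReal.tsum_mul_left, ENNReal.tsum_mul_right, tsum_int_add_right]
  rw [ENNReal.tsum_mul_right, mul_assoc]

lemma tsum_schur_left_diagonal :
    ∑' p : ℤ × ℤ × ℤ, g p.2.1 * (y p.1 * z (p.1 + p.2.1 + p.2.2))
      = (∑' j, g j) * (∑' n, y n) * ∑' n, z n := by
  rw [ENNReal.tsum_prod (f := fun n (q : ℤ × ℤ) => g q.1 * (y n * z (n + q.1 + q.2)))]
  simp_rw [ENNReal.tsum_prod', ENNReal.tsum_mul_left, tsum_int_add_left, ENNReal.tsum_mul_right,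
    ENNReal.tsum_mul_left]
  rw [ENNReal.tsum_mul_right, mul_assoc]

lemma tsum_triple_swap (f : ℤ × ℤ × ℤ → ℝ≥0∞) :
    ∑' p : ℤ × ℤ × ℤ, f p = ∑' p : ℤ × ℤ × ℤ, f (p.1, p.2.2, p.2.1) :=
  (((Equiv.refl ℤ).prodCongr (Equiv.prodComm ℤ ℤ)).tsum_eq f).symm

lemma tsum_schur_right_parallel :
    ∑' p : ℤ × ℤ × ℤ, g p.2.2 * (y (p.1 + p.2.1) * z (p.1 + p.2.2))
      = (∑' j, g j) * (∑' n, y n) * ∑' n, z n := by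
  rw [tsum_triple_swap, mul_right_comm, ← tsum_schur_left_parallel]
  exact tsum_congr fun p => by rw [mul_comm (z _)]

lemma tsum_schur_right_diagonal :
    ∑' p : ℤ × ℤ × ℤ, g p.2.2 * (y p.1 * z (p.1 + p.2.1 + p.2.2))
      = (∑' j, g j) * (∑' n, y n) * ∑' n, z n := by
  rw [tsum_triple_swap, ← tsum_schur_left_diagonal]
  exact tsum_congr fun p => by rw [add_right_comm]

lemma ENNReal.mul_le_sq_add_sq (a b : ℝ≥0∞) : a * b ≤ a ^ 2 + b ^ 2 := by
  rcases le_total a b with h | h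
  · exact (mul_le_mul_left h b).trans (by rw [sq b]; exact le_add_self)
  · exact (mul_le_mul_right h a).trans (by rw [sq a]; exact le_self_add)

/-- A Schur test for the quadrilinear sums of the four wave interaction. -/
lemma tsum_quad_le {W : ℤ → ℤ → ℝ≥0∞} {g : ℤ → ℝ≥0∞} {c : ℝ≥0∞}
    (hW : ∀ j k, W j k ≤ c * (g j + g k)) (x : Fin 4 → ℤ → ℝ≥0∞) :
    ∑' p : ℤ × ℤ × ℤ, W p.2.1 p.2.2 *
      (x 0 (p.1 + p.2.1) * x 1 (p.1 + p.2.2) * x 2 p.1 * x 3 (p.1 + p.2.1 + p.2.2))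
    ≤ 2 * c * (∑' j, g j) * ((∑' n, x 0 n ^ 2) * (∑' n, x 1 n ^ 2)
        + (∑' n, x 2 n ^ 2) * ∑' n, x 3 n ^ 2) := by
  have h : ∀ p : ℤ × ℤ × ℤ, W p.2.1 p.2.2 *
      (x 0 (p.1 + p.2.1) * x 1 (p.1 + p.2.2) * x 2 p.1 * x 3 (p.1 + p.2.1 + p.2.2))
      ≤ c * (g p.2.1 * (x 0 (p.1 + p.2.1) ^ 2 * x 1 (p.1 + p.2.2) ^ 2)
        + g p.2.2 * (x 0 (p.1 + p.2.1) ^ 2 * x 1 (p.1 + p.2.2) ^ 2)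
        + g p.2.1 * (x 2 p.1 ^ 2 * x 3 (p.1 + p.2.1 + p.2.2) ^ 2)
        + g p.2.2 * (x 2 p.1 ^ 2 * x 3 (p.1 + p.2.1 + p.2.2) ^ 2)) := fun p => by
    -- Pairing `x 0` with `x 1` and `x 2` with `x 3` leaves exactly the four sums computed above;
    -- any other pairing has an index difference that is itself `j` or `k`.
    calc _ ≤ (c * (g p.2.1 + g p.2.2)) * ((x 0 (p.1 + p.2.1) * x 1 (p.1 + p.2.2)) ^ 2
          + (x 2 p.1 * x 3 (p.1 + p.2.1 + p.2.2)) ^ 2) := by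
          rw [mul_assoc (x 0 _ * x 1 _)]
          exact mul_le_mul' (hW _ _) (ENNReal.mul_le_sq_add_sq _ _)
      _ = _ := by ring
  refine (ENNReal.tsum_le_tsum h).trans_eq ?_
  rw [ENNReal.tsum_mul_left, ENNReal.tsum_add, ENNReal.tsum_add, ENNReal.tsum_add,
    tsum_schur_left_parallel g (fun n => x 0 n ^ 2) (fun n => x 1 n ^ 2),
    tsum_schur_right_parallel g (fun n => x 0 n ^ 2) (fun n => x 1 n ^ 2),
    tsum_schur_left_diagonal g (fun n => x 2 n ^ 2) (fun n => x 3 n ^ 2),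
    tsum_schur_right_diagonal g (fun n => x 2 n ^ 2) (fun n => x 3 n ^ 2)]
  ring

end Schur

/-- The summable weight of the Schur test. -/
noncomputable def schurWeight (j : ℤ) : ℝ := if j = 0 then 1 else |(j : ℝ)| ^ (-(3 / 2) : ℝ)

lemma schurWeight_nonneg (j : ℤ) : 0 ≤ schurWeight j := by
  unfold schurWeight; split_ifs <;> positivity

lemma summable_schurWeight : Summable schurWeight := by
  have h1 : Summable fun j : ℤ => |(j : ℝ)| ^ (-(3 / 2) : ℝ) :=
    Real.summable_abs_int_rpow (by norm_num)
  have h2 : Summable fun j : ℤ => if j = 0 then (1 : ℝ) else 0 :=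
    (hasSum_ite_eq 0 (1 : ℝ)).summable
  refine (h1.add h2).of_nonneg_of_le schurWeight_nonneg fun j => ?_
  unfold schurWeight
  split_ifs with h
  · simp [h]
  · simp

/-- The total mass of `schurWeight`. -/
noncomputable def schurConst : ℝ := ∑' j, schurWeight j

lemma schurConst_nonneg : 0 ≤ schurConst := tsum_nonneg schurWeight_nonneg

lemma tsum_enorm_schurWeight : ∑' j, ENNReal.ofReal (schurWeight j) = ENNReal.ofReal schurConst :=
  (ENNReal.ofReal_tsum_of_nonneg schurWeight_nonneg summable_schurWeight).symm

/-- The terms of the quadrilinear form with weight `w`. -/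
noncomputable def quadTerm (w : ℤ → ℤ → ℂ) (x : Fin 4 → SeqL2) (p : ℤ × ℤ × ℤ) : ℂ :=
  w p.2.1 p.2.2 * (x 0 (p.1 + p.2.1) * x 1 (p.1 + p.2.2) * conj (x 2 p.1)
    * conj (x 3 (p.1 + p.2.1 + p.2.2)))

/-- `w` is dominated by the Schur weights with constant `c`. -/
def WeightBound (w : ℤ → ℤ → ℂ) (c : ℝ) : Prop :=
  ∀ j k, ‖w j k‖ ≤ c * (schurWeight j + schurWeight k)

section QuadForm

variable {w : ℤ → ℤ → ℂ} {c : ℝ}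

lemma enorm_quadTerm (x : Fin 4 → SeqL2) (p : ℤ × ℤ × ℤ) :
    ‖quadTerm w x p‖ₑ = ‖w p.2.1 p.2.2‖ₑ * (‖x 0 (p.1 + p.2.1)‖ₑ * ‖x 1 (p.1 + p.2.2)‖ₑ
      * ‖x 2 p.1‖ₑ * ‖x 3 (p.1 + p.2.1 + p.2.2)‖ₑ) := by
  simp [quadTerm]

lemma tsum_enorm_quadTerm_le (hc : 0 ≤ c) (hw : WeightBound w c) (x : Fin 4 → SeqL2) :
    ∑' p, ‖quadTerm w x p‖ₑ ≤ ENNReal.ofReal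
      (2 * c * schurConst * (‖x 0‖ ^ 2 * ‖x 1‖ ^ 2 + ‖x 2‖ ^ 2 * ‖x 3‖ ^ 2)) := by
  have hW : ∀ j k, ‖w j k‖ₑ ≤ ENNReal.ofReal c *
      (ENNReal.ofReal (schurWeight j) + ENNReal.ofReal (schurWeight k)) := fun j k => by
    rw [← ENNReal.ofReal_add (schurWeight_nonneg j) (schurWeight_nonneg k),
      ← ENNReal.ofReal_mul hc, ← ofReal_norm]
    exact ENNReal.ofReal_le_ofReal (hw j k)
  simp_rw [enorm_quadTerm]
  refine (tsum_quad_le hW fun i n => ‖x i n‖ₑ).trans_eq ?_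
  simp_rw [tsum_enorm_sq, tsum_enorm_schurWeight]
  have hs := schurConst_nonneg
  rw [ENNReal.ofReal_mul (by positivity), ENNReal.ofReal_mul (by positivity),
    ENNReal.ofReal_mul (by positivity), ENNReal.ofReal_add (by positivity) (by positivity),
    ENNReal.ofReal_mul (by positivity), ENNReal.ofReal_mul (by positivity)]
  norm_num

lemma summable_quadTerm (hc : 0 ≤ c) (hw : WeightBound w c) (x : Fin 4 → SeqL2) :
    Summable (quadTerm w x) := by
  refine .of_enorm ?_
  exact ((tsum_enorm_quadTerm_le hc hw x).trans_lt ENNReal.ofReal_lt_top).ne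

lemma norm_tsum_quadTerm_le (hc : 0 ≤ c) (hw : WeightBound w c) (x : Fin 4 → SeqL2) :
    ‖∑' p, quadTerm w x p‖ ≤
      2 * c * schurConst * (‖x 0‖ ^ 2 * ‖x 1‖ ^ 2 + ‖x 2‖ ^ 2 * ‖x 3‖ ^ 2) := by
  have hs := schurConst_nonneg
  rw [← ENNReal.ofReal_le_ofReal_iff (by positivity), ofReal_norm]
  exact (enorm_tsum_le_tsum_enorm).trans (tsum_enorm_quadTerm_le hc hw x)

lemma quadTerm_update_add (x : Fin 4 → SeqL2) (i : Fin 4) (a b : SeqL2) (p : ℤ × ℤ × ℤ) :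
    quadTerm w (Function.update x i (a + b)) p
      = quadTerm w (Function.update x i a) p + quadTerm w (Function.update x i b) p := by
  fin_cases i <;> simp [quadTerm, Function.update] <;> ring

lemma quadTerm_update_smul (x : Fin 4 → SeqL2) (i : Fin 4) (r : ℝ) (a : SeqL2)
    (p : ℤ × ℤ × ℤ) :
    quadTerm w (Function.update x i (r • a)) p = r • quadTerm w (Function.update x i a) p := by
  fin_cases i <;> simp [quadTerm, Function.update] <;> ring

/-- The quadrilinear form with weight `w`. -/
noncomputable def quadMultilinear (hc : 0 ≤ c) (hw : WeightBound w c) :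
    MultilinearMap ℝ (fun _ : Fin 4 => SeqL2) ℂ where
  toFun x := ∑' p, quadTerm w x p
  map_update_add' {inst} x i a b := by
    obtain rfl := Subsingleton.elim inst (instDecidableEqFin 4)
    exact (tsum_congr (quadTerm_update_add x i a b)).trans
      ((summable_quadTerm hc hw _).tsum_add (summable_quadTerm hc hw _))
  map_update_smul' {inst} x i r a := by
    obtain rfl := Subsingleton.elim inst (instDecidableEqFin 4)
    exact (tsum_congr (quadTerm_update_smul x i r a)).trans
      ((summable_quadTerm hc hw _).tsum_const_smul r)

/-- The Schur bound is a sum of two products and not homogeneous in each slot. Normalizing every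
slot makes each product at most `1`, and multilinearity restores the norms. -/
lemma quadMultilinear_norm_le (hc : 0 ≤ c) (hw : WeightBound w c) (x : Fin 4 → SeqL2) :
    ‖quadMultilinear hc hw x‖ ≤ 4 * c * schurConst * ∏ i, ‖x i‖ := by
  set e : Fin 4 → SeqL2 := fun i => ‖x i‖⁻¹ • x i with he
  have hx : x = fun i => ‖x i‖ • e i := by
    funext i
    rcases eq_or_ne (x i) 0 with h | h
    · simp [h]
    · simp only [he]
      rw [smul_smul, mul_inv_cancel₀ (norm_ne_zero_iff.2 h), one_smul]
  have he1 : ∀ i, ‖e i‖ ^ 2 ≤ 1 := fun i => by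
    refine pow_le_one₀ (norm_nonneg _) ?_
    simp only [he]
    rw [norm_smul, norm_inv, norm_norm]
    exact inv_mul_le_one
  have hs := schurConst_nonneg
  have hb : ‖quadMultilinear hc hw e‖ ≤ 4 * c * schurConst := by
    refine (norm_tsum_quadTerm_le hc hw e).trans ?_
    have h1 : ‖e 0‖ ^ 2 * ‖e 1‖ ^ 2 ≤ 1 := mul_le_one₀ (he1 0) (by positivity) (he1 1)
    have h2 : ‖e 2‖ ^ 2 * ‖e 3‖ ^ 2 ≤ 1 := mul_le_one₀ (he1 2) (by positivity) (he1 3)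
    calc _ ≤ 2 * c * schurConst * (1 + 1) := by gcongr
      _ = _ := by ring
  rw [hx, MultilinearMap.map_smul_univ, norm_smul, ← hx, Real.norm_of_nonneg (by positivity),
    mul_comm]
  exact mul_le_mul_of_nonneg_right hb (by positivity)

/-- The quadrilinear form with weight `w` as a continuous multilinear map. -/
noncomputable def quadForm (hc : 0 ≤ c) (hw : WeightBound w c) :
    ContinuousMultilinearMap ℝ (fun _ : Fin 4 => SeqL2) ℂ :=
  (quadMultilinear hc hw).mkContinuous (4 * c * schurConst) (quadMultilinear_norm_le hc hw)

end QuadForm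

/-- The quartic form with weight `w`. -/
noncomputable def quartic (w : ℤ → ℤ → ℂ) (a : SeqL2) : ℂ := ∑' p, quadTerm w (fun _ => a) p

lemma continuous_quartic {w : ℤ → ℤ → ℂ} {c : ℝ} (hc : 0 ≤ c) (hw : WeightBound w c) :
    Continuous (quartic w) :=
  (quadForm hc hw).cont.comp (continuous_pi fun _ => continuous_id)

lemma norm_quartic_le {w : ℤ → ℤ → ℂ} {c : ℝ} (hc : 0 ≤ c) (hw : WeightBound w c) (a : SeqL2) :
    ‖quartic w a‖ ≤ 4 * c * schurConst * ‖a‖ ^ 4 := by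
  refine (quadMultilinear_norm_le hc hw fun _ => a).trans_eq ?_
  simp

end DMNLS

namespace DMNLS

/-! ### Translation of frequencies -/

section Shift

lemma memℓp_shift (k : ℤ) (a : SeqL2) : Memℓp (fun n : ℤ => a (n + k)) 2 := by
  have h := lp.memℓp a
  rw [memℓp_gen_iff (by norm_num)] at h ⊢
  exact ((Equiv.addRight k).summable_iff (f := fun n : ℤ => ‖a n‖ ^ (2 : ℝ≥0∞).toReal)).2 h

/-- Translation of sequences. -/
noncomputable def shift (k : ℤ) (a : SeqL2) : SeqL2 := ⟨fun n => a (n + k), memℓp_shift k a⟩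

lemma shift_apply (k : ℤ) (a : SeqL2) (n : ℤ) : shift k a n = a (n + k) := rfl

lemma norm_shift (k : ℤ) (a : SeqL2) : ‖shift k a‖ = ‖a‖ := by
  have h : ‖shift k a‖ ^ 2 = ‖a‖ ^ 2 := by
    rw [← tsum_norm_sq, ← tsum_norm_sq]
    exact (Equiv.addRight k).tsum_eq fun n => ‖a n‖ ^ 2
  exact (pow_left_inj₀ (norm_nonneg _) (norm_nonneg _) two_ne_zero).1 h

lemma shift_sub (k : ℤ) (a b : SeqL2) : shift k (a - b) = shift k a - shift k b := rfl

lemma shift_shift (k l : ℤ) (a : SeqL2) : shift k (shift l a) = shift (k + l) a := by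
  ext n
  simp [shift_apply, add_assoc]

lemma shift_zero (a : SeqL2) : shift 0 a = a := by
  ext n
  simp [shift_apply]

/-- The weight sees only frequency differences. This symmetry is the noncompact one that the
compactness argument has to factor out. -/
lemma quartic_shift (w : ℤ → ℤ → ℂ) (k : ℤ) (a : SeqL2) : quartic w (shift k a) = quartic w a := by
  unfold quartic
  rw [← ((Equiv.addRight k).prodCongr (Equiv.refl (ℤ × ℤ))).tsum_eq (quadTerm w fun _ => a)]
  refine tsum_congr fun p => ?_
  simp only [quadTerm, shift_apply, Equiv.prodCongr_apply, Prod.map_fst, Prod.map_snd,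
    Equiv.coe_addRight, Equiv.refl_apply]
  ring_nf

end Shift

/-! ### Weak convergence as bounded coordinatewise convergence -/

section Weak

/-- The sum of the products of the moduli of two sequences, one of them translated. -/
noncomputable def overlap (s : ℤ) (φ r : SeqL2) : ℝ := ∑' n, ‖φ n‖ * ‖r (n + s)‖

lemma summable_overlap (s : ℤ) (φ r : SeqL2) : Summable fun n => ‖φ n‖ * ‖r (n + s)‖ :=
  ((summable_norm_sq φ).add (summable_norm_sq (shift s r))).of_nonneg_of_le
    (fun n => by positivity) fun n => by
      rw [shift_apply]; nlinarith [sq_nonneg (‖φ n‖ - ‖r (n + s)‖), sq_nonneg ‖φ n‖,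
        sq_nonneg ‖r (n + s)‖]

lemma overlap_nonneg (s : ℤ) (φ r : SeqL2) : 0 ≤ overlap s φ r :=
  tsum_nonneg fun n => by positivity

/-- Up to a small tail `φ` lives on a finite set, where `r n` tends to `0`; on the tail use `2xy ≤
η⁻¹x² + ηy²`. -/
lemma tendsto_overlap (s : ℤ) (φ : SeqL2) {r : ℕ → SeqL2} {R : ℝ} (hR : ∀ n, ‖r n‖ ≤ R)
    (hr : ∀ i, Tendsto (fun n => r n i) atTop (𝓝 0)) :
    Tendsto (fun n => overlap s φ (r n)) atTop (𝓝 0) := by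
  have hR0 : 0 ≤ R := (norm_nonneg _).trans (hR 0)
  rw [Metric.tendsto_atTop]
  intro ε hε
  -- The tail is at most `η + ηR² = ε/2 - η`, strictly below `ε/2`.
  set η : ℝ := ε / (2 * (2 + R ^ 2)) with hη
  have hηp : 0 < η := by positivity
  obtain ⟨S, hS⟩ := ((tendsto_order.1 (tendsto_tsum_compl_atTop_zero
    fun n => ‖φ n‖ ^ 2)).2 (η ^ 2) (by positivity)).exists
  have hfin : Tendsto (fun n => ∑ i ∈ S, ‖φ i‖ * ‖r n (i + s)‖) atTop (𝓝 0) := by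
    have : Tendsto (fun n => ∑ i ∈ S, ‖φ i‖ * ‖r n (i + s)‖) atTop (𝓝 (∑ i ∈ S, ‖φ i‖ * 0)) :=
      tendsto_finsetSum _ fun i _ => (tendsto_norm_zero.comp (hr (i + s))).const_mul _
    simpa using this
  obtain ⟨N, hN⟩ := Metric.tendsto_atTop.1 hfin (ε / 2) (half_pos hε)
  refine ⟨N, fun n hn => ?_⟩
  have h1 := hN n hn
  rw [Real.dist_eq, sub_zero] at h1 ⊢
  rw [abs_of_nonneg (overlap_nonneg _ _ _), overlap,
    ← (summable_overlap s φ (r n)).sum_add_tsum_compl (s := S)]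
  have h2 : ∑' i : ↑((S : Set ℤ)ᶜ), ‖φ i‖ * ‖r n (i + s)‖ ≤ η + η * R ^ 2 := by
    have hsφ : Summable fun i : ↑((S : Set ℤ)ᶜ) => η⁻¹ * ‖φ i‖ ^ 2 :=
      ((summable_norm_sq φ).subtype _).mul_left _
    have hsr : Summable fun i : ↑((S : Set ℤ)ᶜ) => η * ‖shift s (r n) i‖ ^ 2 :=
      ((summable_norm_sq (shift s (r n))).subtype _).mul_left _
    calc ∑' i : ↑((S : Set ℤ)ᶜ), ‖φ i‖ * ‖r n (i + s)‖
        ≤ ∑' i : ↑((S : Set ℤ)ᶜ), (η⁻¹ * ‖φ i‖ ^ 2 + η * ‖shift s (r n) i‖ ^ 2) := by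
          refine ((summable_overlap s φ (r n)).subtype _).tsum_le_tsum (fun i => ?_)
            (hsφ.add hsr)
          rw [shift_apply]
          have : 0 ≤ η⁻¹ * (‖φ i‖ - η * ‖r n (i + s)‖) ^ 2 := by positivity
          have h3 : η⁻¹ * (‖φ i‖ - η * ‖r n (i + s)‖) ^ 2 = η⁻¹ * ‖φ i‖ ^ 2
              + η * ‖r n (i + s)‖ ^ 2 - 2 * (‖φ i‖ * ‖r n (i + s)‖) := by
            field_simp; ring
          have h4 : 0 ≤ ‖φ i‖ * ‖r n (i + s)‖ := by positivity
          linarith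
      _ = η⁻¹ * ∑' i : ↑((S : Set ℤ)ᶜ), ‖φ i‖ ^ 2
          + η * ∑' i : ↑((S : Set ℤ)ᶜ), ‖shift s (r n) i‖ ^ 2 := by
          rw [hsφ.tsum_add hsr, tsum_mul_left, tsum_mul_left]
      _ ≤ η⁻¹ * η ^ 2 + η * R ^ 2 := by
          have h5 : ∑' i : ↑((S : Set ℤ)ᶜ), ‖shift s (r n) i‖ ^ 2 ≤ R ^ 2 := by
            refine (Summable.tsum_subtype_le (fun i => ‖shift s (r n) i‖ ^ 2) _
              (fun i => by positivity) (summable_norm_sq _)).trans ?_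
            rw [tsum_norm_sq, norm_shift]
            exact pow_le_pow_left₀ (norm_nonneg _) (hR n) 2
          have h6 : ∑' i : ↑((S : Set ℤ)ᶜ), ‖φ i‖ ^ 2 ≤ η ^ 2 := hS.le
          gcongr
      _ = η + η * R ^ 2 := by field_simp
  have h7 : η + η * R ^ 2 < ε / 2 := by
    have : η * (2 * (2 + R ^ 2)) = ε := by rw [hη]; field_simp
    nlinarith
  have h8 := (abs_lt.1 h1).2
  simp only at *
  linarith

/-- The coordinates lie in a product of countably many closed discs, which is compact; norm bounds
survive coordinatewise limits, so the limit is in `ℓ²`. -/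
lemma exists_subseq_tendsto_apply {b : ℕ → SeqL2} {R : ℝ} (hb : ∀ n, ‖b n‖ ≤ R) :
    ∃ (φ : SeqL2) (ψ : ℕ → ℕ), StrictMono ψ ∧
      ∀ i, Tendsto (fun n => b (ψ n) i) atTop (𝓝 (φ i)) := by
  have hK : IsCompact (Set.pi Set.univ fun _ : ℤ => Metric.closedBall (0 : ℂ) R) :=
    isCompact_univ_pi fun _ => isCompact_closedBall _ _
  obtain ⟨f, -, ψ, hψ, hf⟩ := hK.tendsto_subseq (x := fun n => (b n : ℤ → ℂ)) fun n i _ => by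
    simpa using (norm_apply_le (b n) i).trans (hb n)
  have hbd : Bornology.IsBounded (Set.range (b ∘ ψ)) :=
    (Metric.isBounded_closedBall (x := (0 : SeqL2)) (r := R)).subset (by
      rintro _ ⟨n, rfl⟩; simpa using hb (ψ n))
  refine ⟨⟨f, lp.memℓp_of_tendsto hbd hf⟩, ψ, hψ, fun i => ?_⟩
  exact (continuous_apply i).continuousAt.tendsto.comp hf

end Weak

/-! ### Interaction at fixed frequency differences -/

section Diagonal

/-- The terms of the four wave interaction with fixed frequency differences. -/
noncomputable def diagTerm (j k : ℤ) (a : SeqL2) (n : ℤ) : ℂ :=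
  a (n + j) * a (n + k) * conj (a n) * conj (a (n + j + k))

/-- The four wave interaction with fixed frequency differences. -/
noncomputable def diagSum (j k : ℤ) (a : SeqL2) : ℂ := ∑' n, diagTerm j k a n

/-- Two factors go into the sup norm, the other two remain summable. This is how small coefficients
force a small interaction. -/
lemma norm_diagTerm_le (j k : ℤ) {a : SeqL2} {δ : ℝ} (ha : ∀ n, ‖a n‖ ≤ δ) (n : ℤ) :
    ‖diagTerm j k a n‖ ≤ δ ^ 2 * (‖a n‖ * ‖a (n + j)‖) := by
  have hδ : 0 ≤ δ := (norm_nonneg _).trans (ha 0)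
  simp only [diagTerm, norm_mul, RCLike.norm_conj]
  calc _ = (‖a (n + k)‖ * ‖a (n + j + k)‖) * (‖a n‖ * ‖a (n + j)‖) := by ring
    _ ≤ (δ * δ) * (‖a n‖ * ‖a (n + j)‖) := by
      gcongr
      · exact ha _
      · exact ha _
    _ = _ := by ring

lemma summable_diagTerm (j k : ℤ) (a : SeqL2) : Summable (diagTerm j k a) :=
  .of_norm_bounded ((summable_overlap j a a).mul_left (‖a‖ ^ 2))
    (norm_diagTerm_le j k (norm_apply_le a))

lemma overlap_le (s : ℤ) (φ r : SeqL2) : overlap s φ r ≤ ‖φ‖ ^ 2 + ‖r‖ ^ 2 := by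
  rw [← norm_shift s r, ← tsum_norm_sq, ← tsum_norm_sq,
    ← (summable_norm_sq _).tsum_add (summable_norm_sq _)]
  refine (summable_overlap s φ r).tsum_le_tsum (fun n => ?_)
    ((summable_norm_sq _).add (summable_norm_sq _))
  rw [shift_apply]
  nlinarith [sq_nonneg (‖φ n‖ - ‖r (n + s)‖), sq_nonneg ‖φ n‖, sq_nonneg ‖r (n + s)‖]

lemma norm_diagSum_le (j k : ℤ) {a : SeqL2} {δ : ℝ} (ha : ∀ n, ‖a n‖ ≤ δ) :
    ‖diagSum j k a‖ ≤ δ ^ 2 * (2 * ‖a‖ ^ 2) := by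
  refine (tsum_of_norm_bounded ((summable_overlap j a a).mul_left (δ ^ 2)).hasSum
    (norm_diagTerm_le j k ha)).trans ?_
  rw [tsum_mul_left]
  have := overlap_le j a a
  gcongr
  unfold overlap at this
  linarith

/-- Expanding leaves `14 = 2⁴ - 2` mixed monomials, each with a factor `x i * y l` and two more
factors bounded by `R`. -/
lemma norm_prod_four_add_sub_le {x y : Fin 4 → ℂ} {R : ℝ} (hx : ∀ i, ‖x i‖ ≤ R)
    (hy : ∀ i, ‖y i‖ ≤ R) :
    ‖(x 0 + y 0) * (x 1 + y 1) * (x 2 + y 2) * (x 3 + y 3) - x 0 * x 1 * x 2 * x 3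
      - y 0 * y 1 * y 2 * y 3‖ ≤ 14 * R ^ 2 * ∑ i, ∑ l, ‖x i‖ * ‖y l‖ := by
  have hR : 0 ≤ R := (norm_nonneg _).trans (hx 0)
  set D := ∑ i, ∑ l, ‖x i‖ * ‖y l‖ with hD
  have hle : ∀ i l, ‖x i‖ * ‖y l‖ ≤ D := fun i l =>
    (Finset.single_le_sum (f := fun l => ‖x i‖ * ‖y l‖) (fun l _ => by positivity)
      (Finset.mem_univ l)).trans
    (Finset.single_le_sum (f := fun i => ∑ l, ‖x i‖ * ‖y l‖) (fun i _ => by positivity)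
      (Finset.mem_univ i))
  have hD0 : 0 ≤ D := by positivity
  have key : (x 0 + y 0) * (x 1 + y 1) * (x 2 + y 2) * (x 3 + y 3) - x 0 * x 1 * x 2 * x 3
      - y 0 * y 1 * y 2 * y 3 = (x 0 * y 2) * (x 1 * y 3) + (x 2 * y 0) * (x 3 * y 1)
      + ((x 0 * y 1) + (x 1 * y 0)) * ((x 2 + y 2) * (x 3 + y 3))
      + ((x 2 * y 3) + (x 3 * y 2)) * (x 0 * x 1 + y 0 * y 1) := by ring
  have hxy : ∀ i l, ‖x i * y l‖ ≤ D := fun i l => (norm_mul_le _ _).trans (hle i l)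
  have hxyR : ∀ i l, ‖x i * y l‖ ≤ R ^ 2 := fun i l => by
    rw [norm_mul, sq]; exact mul_le_mul (hx i) (hy l) (norm_nonneg _) hR
  have h1 : ‖(x 0 * y 2) * (x 1 * y 3)‖ ≤ D * R ^ 2 := by
    rw [norm_mul]; exact mul_le_mul (hxy 0 2) (hxyR 1 3) (norm_nonneg _) hD0
  have h2 : ‖(x 2 * y 0) * (x 3 * y 1)‖ ≤ D * R ^ 2 := by
    rw [norm_mul]; exact mul_le_mul (hxy 2 0) (hxyR 3 1) (norm_nonneg _) hD0
  have h3 : ‖((x 0 * y 1) + (x 1 * y 0)) * ((x 2 + y 2) * (x 3 + y 3))‖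
      ≤ (D + D) * ((R + R) * (R + R)) := by
    rw [norm_mul, norm_mul]
    have e1 : ‖x 0 * y 1 + x 1 * y 0‖ ≤ D + D :=
      (norm_add_le _ _).trans (add_le_add (hxy 0 1) (hxy 1 0))
    have e2 : ∀ i, ‖x i + y i‖ ≤ R + R := fun i =>
      (norm_add_le _ _).trans (add_le_add (hx i) (hy i))
    gcongr
    · exact e2 2
    · exact e2 3
  have h4 : ‖((x 2 * y 3) + (x 3 * y 2)) * (x 0 * x 1 + y 0 * y 1)‖
      ≤ (D + D) * (R * R + R * R) := by
    rw [norm_mul]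
    have e1 : ‖x 2 * y 3 + x 3 * y 2‖ ≤ D + D :=
      (norm_add_le _ _).trans (add_le_add (hxy 2 3) (hxy 3 2))
    have e2 : ‖x 0 * x 1 + y 0 * y 1‖ ≤ R * R + R * R := by
      refine (norm_add_le _ _).trans (add_le_add ?_ ?_) <;> rw [norm_mul]
      · exact mul_le_mul (hx 0) (hx 1) (norm_nonneg _) hR
      · exact mul_le_mul (hy 0) (hy 1) (norm_nonneg _) hR
    gcongr
  rw [key]
  refine ((norm_add_le _ _).trans (add_le_add ((norm_add_le _ _).trans (add_le_add
    ((norm_add_le _ _).trans (add_le_add h1 h2)) h3)) h4)).trans_eq ?_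
  ring

lemma hasSum_shifted_mul (φ r : SeqL2) (α β : ℤ) :
    HasSum (fun n => ‖φ (n + α)‖ * ‖r (n + β)‖) (overlap (β - α) φ r) := by
  have h := (Equiv.addRight α).hasSum_iff.2 (summable_overlap (β - α) φ r).hasSum
  have e : (fun n => ‖φ (n + α)‖ * ‖r (n + β)‖)
      = (fun n => ‖φ n‖ * ‖r (n + (β - α))‖) ∘ Equiv.addRight α := by
    funext n
    simp only [Function.comp_apply, Equiv.coe_addRight]
    rw [show n + α + (β - α) = n + β by ring]
  rw [e]
  exact h

lemma norm_diagSum_add_sub_le (j k : ℤ) {φ r : SeqL2} {R : ℝ} (hφ : ‖φ‖ ≤ R) (hr : ‖r‖ ≤ R) :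
    ‖diagSum j k (φ + r) - diagSum j k φ - diagSum j k r‖
      ≤ 14 * R ^ 2 * ∑ i : Fin 4, ∑ l : Fin 4,
        overlap (![j, k, 0, j + k] l - ![j, k, 0, j + k] i) φ r := by
  unfold diagSum
  rw [← (summable_diagTerm j k _).tsum_sub (summable_diagTerm j k _),
    ← ((summable_diagTerm j k _).sub (summable_diagTerm j k _)).tsum_sub (summable_diagTerm j k _)]
  refine tsum_of_norm_bounded ((hasSum_sum fun i _ => hasSum_sum fun l _ =>
    hasSum_shifted_mul φ r (![j, k, 0, j + k] i) (![j, k, 0, j + k] l)).mul_left _) fun n => ?_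
  have h := norm_prod_four_add_sub_le (R := R)
    (x := ![φ (n + j), φ (n + k), conj (φ n), conj (φ (n + j + k))])
    (y := ![r (n + j), r (n + k), conj (r n), conj (r (n + j + k))])
    (fun i => by fin_cases i <;> simpa using (norm_apply_le φ _).trans hφ)
    (fun i => by fin_cases i <;> simpa using (norm_apply_le r _).trans hr)
  simp only [Fin.sum_univ_four, Matrix.cons_val, RCLike.norm_conj, diagTerm, lp.coeFn_add,
    Pi.add_apply, map_add, add_assoc, add_zero] at h ⊢
  exact h

/-- A Brezis–Lieb splitting: every mixed term contains an overlap of `φ` with a translate of the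
weakly null `r n`. -/
lemma tendsto_diagSum_add_sub (j k : ℤ) (φ : SeqL2) {r : ℕ → SeqL2} {R : ℝ}
    (hφ : ‖φ‖ ≤ R) (hR : ∀ n, ‖r n‖ ≤ R) (hr : ∀ i, Tendsto (fun n => r n i) atTop (𝓝 0)) :
    Tendsto (fun n => diagSum j k (φ + r n) - diagSum j k φ - diagSum j k (r n)) atTop (𝓝 0) := by
  refine squeeze_zero_norm (fun n => norm_diagSum_add_sub_le j k hφ (hR n)) ?_
  have : Tendsto (fun n => 14 * R ^ 2 * ∑ i : Fin 4, ∑ l : Fin 4,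
      overlap (![j, k, 0, j + k] l - ![j, k, 0, j + k] i) φ (r n)) atTop
      (𝓝 (14 * R ^ 2 * ∑ i : Fin 4, ∑ l : Fin 4, 0)) :=
    (tendsto_finsetSum _ fun i _ => tendsto_finsetSum _ fun l _ =>
      tendsto_overlap _ φ hR hr).const_mul _
  simpa using this

end Diagonal

/-! ### Reduction to finitely many frequency differences -/

section Truncation

/-- The weight `w` restricted to frequency differences in a finite box. -/
noncomputable def boxWeight (J : ℕ) (w : ℤ → ℤ → ℂ) (j k : ℤ) : ℂ :=
  if |j| ≤ J ∧ |k| ≤ J then w j k else 0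

/-- The weight `w` outside a finite box. -/
noncomputable def tailWeight (J : ℕ) (w : ℤ → ℤ → ℂ) (j k : ℤ) : ℂ :=
  if |j| ≤ J ∧ |k| ≤ J then 0 else w j k

variable {w : ℤ → ℤ → ℂ} {c : ℝ}

lemma WeightBound.box (hc : 0 ≤ c) (hw : WeightBound w c) (J : ℕ) :
    WeightBound (boxWeight J w) c := fun j k => by
  unfold boxWeight
  split_ifs
  · exact hw j k
  · rw [norm_zero]
    exact mul_nonneg hc (add_nonneg (schurWeight_nonneg j) (schurWeight_nonneg k))

lemma WeightBound.tail (hc : 0 ≤ c) (hw : WeightBound w c) (J : ℕ) :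
    WeightBound (tailWeight J w) c := fun j k => by
  unfold tailWeight
  split_ifs
  · rw [norm_zero]
    exact mul_nonneg hc (add_nonneg (schurWeight_nonneg j) (schurWeight_nonneg k))
  · exact hw j k

lemma quartic_eq_box_add_tail (hc : 0 ≤ c) (hw : WeightBound w c) (J : ℕ) (a : SeqL2) :
    quartic w a = quartic (boxWeight J w) a + quartic (tailWeight J w) a := by
  unfold quartic
  rw [← (summable_quadTerm hc (hw.box hc J) _).tsum_add (summable_quadTerm hc (hw.tail hc J) _)]
  refine tsum_congr fun p => ?_
  unfold quadTerm boxWeight tailWeight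
  split_ifs <;> ring

lemma quartic_boxWeight (hc : 0 ≤ c) (hw : WeightBound w c) (J : ℕ) (a : SeqL2) :
    quartic (boxWeight J w) a = ∑ q ∈ Finset.Icc (-J : ℤ) J ×ˢ Finset.Icc (-J : ℤ) J,
      w q.1 q.2 * diagSum q.1 q.2 a := by
  have hs := summable_quadTerm hc (hw.box hc J) (fun _ => a)
  unfold quartic
  rw [← (Equiv.prodComm (ℤ × ℤ) ℤ).tsum_eq]
  refine ((Equiv.prodComm (ℤ × ℤ) ℤ).summable_iff.2 hs).tsum_prod.trans ?_
  rw [tsum_eq_sum (s := Finset.Icc (-J : ℤ) J ×ˢ Finset.Icc (-J : ℤ) J)]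
  · refine Finset.sum_congr rfl fun q hq => ?_
    rw [Finset.mem_product, Finset.mem_Icc, Finset.mem_Icc, ← abs_le, ← abs_le] at hq
    rw [diagSum, ← tsum_mul_left]
    refine tsum_congr fun n => ?_
    simp [quadTerm, diagTerm, boxWeight, hq]
  · intro q hq
    rw [Finset.mem_product, Finset.mem_Icc, Finset.mem_Icc, ← abs_le, ← abs_le] at hq
    simp [quadTerm, boxWeight, hq]

/-- `w` is small compared with the Schur weights at large frequency differences. -/
def WeightDecay (w : ℤ → ℤ → ℂ) : Prop :=
  ∀ ε : ℝ, 0 < ε → ∃ J : ℕ, WeightBound (tailWeight J w) ε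

/-- The tail weight satisfies the Schur bound with a small constant, so its quartic form is small
uniformly on balls. -/
lemma exists_box_approx (hc : 0 ≤ c) (hw : WeightBound w c) (hd : WeightDecay w) {ε : ℝ}
    (hε : 0 < ε) (R : ℝ) :
    ∃ J : ℕ, ∀ a : SeqL2, ‖a‖ ≤ R → ‖quartic w a - quartic (boxWeight J w) a‖ ≤ ε := by
  have hs := schurConst_nonneg
  set η : ℝ := ε / (4 * schurConst * R ^ 4 + 1) with hη
  have hηp : 0 < η := by positivity
  obtain ⟨J, hJ⟩ := hd η hηp
  refine ⟨J, fun a ha => ?_⟩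
  rw [quartic_eq_box_add_tail hc hw J, add_sub_cancel_left]
  refine (norm_quartic_le hηp.le hJ a).trans ?_
  have h1 : ‖a‖ ^ 4 ≤ R ^ 4 := pow_le_pow_left₀ (norm_nonneg _) ha 4
  calc 4 * η * schurConst * ‖a‖ ^ 4 ≤ 4 * η * schurConst * R ^ 4 := by gcongr
    _ = η * (4 * schurConst * R ^ 4) := by ring
    _ ≤ η * (4 * schurConst * R ^ 4 + 1) := by gcongr; linarith
    _ = ε := by rw [hη]; field_simp

/-- Asymptotic splitting of the quartic form along weakly convergent sequences. -/
lemma tendsto_quartic_add_sub (hc : 0 ≤ c) (hw : WeightBound w c) (hd : WeightDecay w)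
    (φ : SeqL2) {r : ℕ → SeqL2} {R : ℝ} (hφ : ‖φ‖ ≤ R) (hR : ∀ n, ‖r n‖ ≤ R)
    (hr : ∀ i, Tendsto (fun n => r n i) atTop (𝓝 0)) :
    Tendsto (fun n => quartic w (φ + r n) - quartic w φ - quartic w (r n)) atTop (𝓝 0) := by
  rw [Metric.tendsto_atTop]
  intro ε hε
  obtain ⟨J, hJ⟩ := exists_box_approx hc hw hd (ε := ε / 4) (by positivity) (R + R)
  have hR0 : 0 ≤ R := (norm_nonneg _).trans hφ
  have hbox : Tendsto (fun n => quartic (boxWeight J w) (φ + r n) - quartic (boxWeight J w) φ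
      - quartic (boxWeight J w) (r n)) atTop (𝓝 0) := by
    simp_rw [quartic_boxWeight hc hw J, ← Finset.sum_sub_distrib, ← mul_sub]
    have : Tendsto (fun n => ∑ q ∈ Finset.Icc (-J : ℤ) J ×ˢ Finset.Icc (-J : ℤ) J,
        w q.1 q.2 * (diagSum q.1 q.2 (φ + r n) - diagSum q.1 q.2 φ - diagSum q.1 q.2 (r n)))
        atTop (𝓝 (∑ q ∈ Finset.Icc (-J : ℤ) J ×ˢ Finset.Icc (-J : ℤ) J, w q.1 q.2 * 0)) :=
      tendsto_finsetSum _ fun q _ => (tendsto_diagSum_add_sub q.1 q.2 φ hφ hR hr).const_mul _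
    simpa using this
  obtain ⟨N, hN⟩ := Metric.tendsto_atTop.1 hbox (ε / 4) (by positivity)
  refine ⟨N, fun n hn => ?_⟩
  have h0 := hN n hn
  rw [dist_zero_right] at h0 ⊢
  have h1 := hJ (φ + r n) ((norm_add_le _ _).trans (add_le_add hφ (hR n)))
  have h2 := hJ φ (by linarith)
  have h3 := hJ (r n) (by linarith [hR n])
  have key : quartic w (φ + r n) - quartic w φ - quartic w (r n)
      = (quartic (boxWeight J w) (φ + r n) - quartic (boxWeight J w) φ
        - quartic (boxWeight J w) (r n))
      + (quartic w (φ + r n) - quartic (boxWeight J w) (φ + r n))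
      - (quartic w φ - quartic (boxWeight J w) φ)
      - (quartic w (r n) - quartic (boxWeight J w) (r n)) := by ring
  rw [key]
  refine (norm_sub_le _ _).trans_lt ?_
  have h4 := norm_sub_le ((quartic (boxWeight J w) (φ + r n) - quartic (boxWeight J w) φ
        - quartic (boxWeight J w) (r n))
      + (quartic w (φ + r n) - quartic (boxWeight J w) (φ + r n)))
      (quartic w φ - quartic (boxWeight J w) φ)
  have h5 := norm_add_le (quartic (boxWeight J w) (φ + r n) - quartic (boxWeight J w) φ
        - quartic (boxWeight J w) (r n))
      (quartic w (φ + r n) - quartic (boxWeight J w) (φ + r n))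
  linarith

/-- A quartic form that is not small forces a coefficient that is not small. -/
lemma exists_lt_norm_apply (hc : 0 ≤ c) (hw : WeightBound w c) (hd : WeightDecay w) {ε : ℝ}
    (hε : 0 < ε) :
    ∃ δ : ℝ, 0 < δ ∧ ∀ a : SeqL2, ‖a‖ ≤ 1 → ε < ‖quartic w a‖ → ∃ p, δ < ‖a p‖ := by
  obtain ⟨J, hJ⟩ := exists_box_approx hc hw hd (ε := ε / 2) (by positivity) 1
  set B : ℝ := ∑ q ∈ Finset.Icc (-J : ℤ) J ×ˢ Finset.Icc (-J : ℤ) J, ‖w q.1 q.2‖ with hB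
  have hB0 : 0 ≤ B := by positivity
  -- If all coefficients were at most `δ`, the box part would be at most `2Bδ² ≤ ε/2` and the tail
  -- at most `ε/2`; the `1` gives `δ² ≤ δ`.
  refine ⟨min 1 (ε / (4 * (B + 1))), by positivity, fun a ha hq => ?_⟩
  by_contra! hcon
  set δ := min 1 (ε / (4 * (B + 1))) with hδ
  have hδ0 : 0 < δ := by positivity
  have hδ1 : δ ^ 2 ≤ ε / (4 * (B + 1)) := by
    have h1 : δ ≤ 1 := min_le_left _ _
    have h2 : δ ≤ ε / (4 * (B + 1)) := min_le_right _ _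
    nlinarith
  have h1 : ‖quartic (boxWeight J w) a‖ ≤ B * (δ ^ 2 * 2) := by
    rw [quartic_boxWeight hc hw, hB, Finset.sum_mul]
    refine (norm_sum_le _ _).trans (Finset.sum_le_sum fun q _ => ?_)
    rw [norm_mul]
    refine mul_le_mul_of_nonneg_left ((norm_diagSum_le _ _ hcon).trans ?_) (norm_nonneg _)
    have : ‖a‖ ^ 2 ≤ 1 := pow_le_one₀ (norm_nonneg _) ha
    nlinarith [sq_nonneg δ]
  have h2 : B * (δ ^ 2 * 2) ≤ ε / 2 := by
    rw [le_div_iff₀ (by positivity)] at hδ1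
    nlinarith [sq_nonneg δ]
  have h3 := hJ a ha
  have h4 := norm_add_le (quartic w a - quartic (boxWeight J w) a) (quartic (boxWeight J w) a)
  rw [sub_add_cancel] at h4
  linarith

end Truncation

end DMNLS

namespace DMNLS

/-! ### Concentration compactness for maximizing sequences -/

section Compactness

variable {w : ℤ → ℤ → ℂ} {c K : ℝ}

lemma abs_inner_le_overlap (φ r : SeqL2) : |(inner ℂ φ r : ℂ).re| ≤ overlap 0 φ r := by
  refine (Complex.abs_re_le_norm _).trans ?_
  rw [lp.inner_eq_tsum]
  refine tsum_of_norm_bounded (summable_overlap 0 φ r).hasSum fun n => ?_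
  simpa using norm_inner_le_norm (𝕜 := ℂ) (φ n) (r n)

/-- Strict superadditivity: a weakly convergent maximizing sequence with nonzero weak limit
converges strongly. -/
lemma tendsto_of_maximizing (hc : 0 ≤ c) (hw : WeightBound w c) (hd : WeightDecay w)
    (hK : 2 < K) (hQ : ∀ a : SeqL2, 2 * ‖a‖ ^ 4 + (quartic w a).re ≤ K * ‖a‖ ^ 4)
    {b : ℕ → SeqL2} (hb : ∀ n, ‖b n‖ = 1)
    (hlim : Tendsto (fun n => 2 + (quartic w (b n)).re) atTop (𝓝 K)) {φ : SeqL2} (hφ : φ ≠ 0)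
    (hφb : ∀ i, Tendsto (fun n => b n i) atTop (𝓝 (φ i))) :
    Tendsto b atTop (𝓝 φ) := by
  set r : ℕ → SeqL2 := fun n => b n - φ with hr
  set R : ℝ := 1 + ‖φ‖ with hR
  have hrR : ∀ n, ‖r n‖ ≤ R := fun n => (norm_sub_le _ _).trans (by rw [hb])
  have hφR : ‖φ‖ ≤ R := by simp [hR]
  have hr0 : ∀ i, Tendsto (fun n => r n i) atTop (𝓝 0) := fun i => by
    simpa [hr] using (hφb i).sub_const (φ i)
  have hbr : ∀ n, φ + r n = b n := fun n => by simp [hr]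
  have hin : Tendsto (fun n => (inner ℂ φ (r n) : ℂ).re) atTop (𝓝 0) :=
    squeeze_zero_norm (fun n => abs_inner_le_overlap φ (r n)) (tendsto_overlap 0 φ hrR hr0)
  have hnorm : Tendsto (fun n => ‖r n‖ ^ 2) atTop (𝓝 (1 - ‖φ‖ ^ 2)) := by
    have h : ∀ n, ‖r n‖ ^ 2 = 1 - ‖φ‖ ^ 2 - 2 * (inner ℂ φ (r n) : ℂ).re := fun n => by
      have h1 := norm_add_sq (𝕜 := ℂ) φ (r n)
      rw [hbr, hb] at h1
      simp only [RCLike.re_to_complex] at h1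
      linarith
    simp_rw [h]
    simpa using (hin.const_mul 2).const_sub (1 - ‖φ‖ ^ 2)
  set α : ℝ := ‖φ‖ ^ 2 with hα
  have hαpos : 0 < α := by have := norm_pos_iff.2 hφ; positivity
  have hα1 : 0 ≤ 1 - α := ge_of_tendsto' hnorm fun n => by positivity
  have hsplit := (Complex.continuous_re.tendsto _).comp
    (tendsto_quartic_add_sub hc hw hd φ hφR hrR hr0)
  -- Split `Q(b n)` into `Q(φ) + Q(r n)` plus the splitting error, and bound each form by `(K -
  -- 2)‖·‖⁴`.
  have hup : ∀ n, 2 + (quartic w (b n)).re ≤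
      (quartic w (φ + r n) - quartic w φ - quartic w (r n)).re
        + 2 + (K * α ^ 2 - 2 * α ^ 2) + (K - 2) * (‖r n‖ ^ 2) ^ 2 := fun n => by
    have h1 := hQ φ
    have h2 := hQ (r n)
    rw [hbr, Complex.sub_re, Complex.sub_re, hα]
    have e1 : ‖φ‖ ^ 4 = (‖φ‖ ^ 2) ^ 2 := by ring
    have e2 : ‖r n‖ ^ 4 = (‖r n‖ ^ 2) ^ 2 := by ring
    rw [e1] at h1
    rw [e2] at h2
    linarith
  have hlim2 := le_of_tendsto_of_tendsto' hlim (((hsplit.add_const 2).add_const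
    (K * α ^ 2 - 2 * α ^ 2)).add ((hnorm.pow 2).const_mul (K - 2))) hup
  simp only [Complex.zero_re] at hlim2
  -- In the limit `K - 2 ≤ (K - 2)(α² + (1 - α)²)`, so `α(1 - α) ≤ 0`. Since `0 < α ≤ 1`, no mass is
  -- lost: `α = 1`.
  have hα2 : 1 - α = 0 := by
    have h3 : α * (1 - α) * (K - 2) ≤ 0 := by nlinarith
    have h4 : α * (1 - α) ≤ 0 := by
      by_contra! h
      nlinarith
    nlinarith
  rw [hα2] at hnorm
  rw [tendsto_iff_norm_sub_tendsto_zero]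
  have h5 := (Real.continuous_sqrt.tendsto _).comp hnorm
  simpa [Function.comp_def, Real.sqrt_sq] using h5

/-- Maximizing sequences of `2‖a‖⁴ + Re (quartic w a)` on the unit sphere are relatively compact
up to translations, provided the supremum exceeds `2`. -/
theorem exists_shift_tendsto (hc : 0 ≤ c) (hw : WeightBound w c) (hd : WeightDecay w)
    (hK : 2 < K) (hQ : ∀ a : SeqL2, 2 * ‖a‖ ^ 4 + (quartic w a).re ≤ K * ‖a‖ ^ 4)
    {a : ℕ → SeqL2} (ha : ∀ n, ‖a n‖ = 1)
    (hlim : Tendsto (fun n => 2 + (quartic w (a n)).re) atTop (𝓝 K)) :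
    ∃ (φ : SeqL2) (ψ : ℕ → ℕ) (p : ℕ → ℤ), StrictMono ψ ∧
      Tendsto (fun n => shift (p n) (a (ψ n))) atTop (𝓝 φ) := by
  -- The real part of the form tends to `K - 2 > 0` and eventually exceeds half of it. So some
  -- coefficient, at an index `p n`, exceeds a fixed `δ`; translating it to index `0` makes the weak
  -- limit nonzero.
  obtain ⟨δ, hδ, hnv⟩ := exists_lt_norm_apply hc hw hd (ε := (K - 2) / 2) (by linarith)
  have hex : ∀ n, ∃ p, (K - 2) / 2 < ‖quartic w (a n)‖ → δ < ‖a n p‖ := fun n => by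
    by_cases h : (K - 2) / 2 < ‖quartic w (a n)‖
    · obtain ⟨p, hp⟩ := hnv (a n) (ha n).le h
      exact ⟨p, fun _ => hp⟩
    · exact ⟨0, fun h' => absurd h' h⟩
  choose p hp using hex
  obtain ⟨φ, ψ, hψ, hφ⟩ := exists_subseq_tendsto_apply (b := fun n => shift (p n) (a n)) (R := 1)
    fun n => by rw [norm_shift, ha]
  refine ⟨φ, ψ, fun n => p (ψ n), hψ, ?_⟩
  have hlim' := hlim.comp hψ.tendsto_atTop
  refine tendsto_of_maximizing hc hw hd hK hQ (fun n => by rw [norm_shift, ha])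
    (by simpa only [quartic_shift, Function.comp_def] using hlim') ?_ hφ
  have hev : ∀ᶠ n in atTop, δ ≤ ‖shift (p (ψ n)) (a (ψ n)) 0‖ := by
    filter_upwards [(tendsto_order.1 hlim').1 (2 + (K - 2) / 2) (by linarith)] with n hn
    rw [shift_apply, zero_add]
    refine (hp (ψ n) ?_).le
    have h1 := Complex.re_le_norm (quartic w (a (ψ n)))
    simp only [Function.comp_apply] at hn
    linarith
  have h0 : δ ≤ ‖φ 0‖ := ge_of_tendsto (hφ 0).norm hev
  rintro rfl
  simp at h0
  linarith

lemma quartic_smul (r : ℝ) (a : SeqL2) : quartic w (r • a) = r ^ 4 * quartic w a := by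
  unfold quartic
  rw [← tsum_mul_left]
  refine tsum_congr fun p => ?_
  simp only [quadTerm, lp.coeFn_smul, Pi.smul_apply, Complex.real_smul, map_mul,
    Complex.conj_ofReal]
  ring

/-- Existence of maximizers and closeness of almost maximizers to maximizers. -/
theorem exists_maximizers (hc : 0 ≤ c) (hw : WeightBound w c) (hd : WeightDecay w)
    (hpos : ∃ a : SeqL2, 0 < (quartic w a).re) :
    ∃ K : ℝ, (∀ a : SeqL2, 2 * ‖a‖ ^ 4 + (quartic w a).re ≤ K * ‖a‖ ^ 4) ∧
      (∃ φ : SeqL2, ‖φ‖ = 1 ∧ 2 + (quartic w φ).re = K) ∧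
      ∀ ε : ℝ, 0 < ε → ∃ η : ℝ, 0 < η ∧ ∀ a : SeqL2, ‖a‖ = 1 → K - η < 2 + (quartic w a).re →
        ∃ φ : SeqL2, ‖φ‖ = 1 ∧ 2 + (quartic w φ).re = K ∧ ‖a - φ‖ < ε := by
  set T : Set ℝ := (fun a : SeqL2 => 2 + (quartic w a).re) '' Metric.sphere 0 1 with hT
  have hbd : BddAbove T := by
    refine ⟨2 + 4 * c * schurConst, ?_⟩
    rintro _ ⟨a, ha, rfl⟩
    have h1 := (Complex.re_le_norm _).trans (norm_quartic_le hc hw a)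
    rw [mem_sphere_zero_iff_norm] at ha
    rw [ha] at h1
    simp only
    linarith
  have hnormalize : ∀ a : SeqL2, a ≠ 0 → ∃ e : SeqL2, ‖e‖ = 1 ∧
      (quartic w a).re = ‖a‖ ^ 4 * (quartic w e).re := fun a ha => by
    have ha' : ‖a‖ ≠ 0 := norm_ne_zero_iff.2 ha
    refine ⟨‖a‖⁻¹ • a, by rw [norm_smul, norm_inv, norm_norm, inv_mul_cancel₀ ha'], ?_⟩
    conv_lhs => rw [← one_smul ℝ a, ← mul_inv_cancel₀ ha', ← smul_smul, quartic_smul]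
    rw [← Complex.ofReal_pow, Complex.re_ofReal_mul]
  set K := sSup T with hKdef
  have hle : ∀ e : SeqL2, ‖e‖ = 1 → 2 + (quartic w e).re ≤ K := fun e he =>
    le_csSup hbd ⟨e, by simpa using he, rfl⟩
  have hQ : ∀ a : SeqL2, 2 * ‖a‖ ^ 4 + (quartic w a).re ≤ K * ‖a‖ ^ 4 := fun a => by
    rcases eq_or_ne a 0 with rfl | ha
    · have h0 := quartic_smul (w := w) 0 0
      simp only [zero_smul] at h0
      rw [h0]
      simp
    · obtain ⟨e, he, hae⟩ := hnormalize a ha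
      rw [hae]
      nlinarith [hle e he, pow_nonneg (norm_nonneg a) 4]
  obtain ⟨a₀, ha₀⟩ := hpos
  have ha₀ne : a₀ ≠ 0 := by
    rintro rfl
    have h0 := quartic_smul (w := w) 0 0
    simp only [zero_smul] at h0
    rw [h0] at ha₀
    simp at ha₀
  obtain ⟨e₀, he₀, hae₀⟩ := hnormalize a₀ ha₀ne
  -- The only use of the positivity hypothesis; it is what rules out vanishing.
  have hK : 2 < K := by
    have h1 : 0 < (quartic w e₀).re := by
      rw [hae₀] at ha₀
      exact pos_of_mul_pos_right ha₀ (by positivity)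
    linarith [hle e₀ he₀]
  have hlimit : ∀ (a : ℕ → SeqL2), (∀ n, ‖a n‖ = 1) →
      Tendsto (fun n => 2 + (quartic w (a n)).re) atTop (𝓝 K) →
      ∃ (φ : SeqL2) (ψ : ℕ → ℕ) (p : ℕ → ℤ), StrictMono ψ ∧ ‖φ‖ = 1 ∧
        2 + (quartic w φ).re = K ∧ Tendsto (fun n => shift (p n) (a (ψ n))) atTop (𝓝 φ) := by
    intro a ha hlim
    obtain ⟨φ, ψ, p, hψ, hφ⟩ := exists_shift_tendsto hc hw hd hK hQ ha hlim
    refine ⟨φ, ψ, p, hψ, ?_, ?_, hφ⟩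
    · refine tendsto_nhds_unique hφ.norm ?_
      simp [norm_shift, ha]
    · have h1 := (((Complex.continuous_re.comp (continuous_quartic hc hw)).tendsto φ).comp
        hφ).const_add 2
      simp only [Function.comp_def, quartic_shift] at h1
      exact tendsto_nhds_unique h1 (hlim.comp hψ.tendsto_atTop)
  refine ⟨K, hQ, ?_, ?_⟩
  · have hne : T.Nonempty := ⟨_, e₀, by simpa using he₀, rfl⟩
    obtain ⟨y, -, hy, hyT⟩ := exists_seq_tendsto_sSup hne hbd
    choose a ha hay using hyT
    obtain ⟨φ, -, -, -, h1, h2, -⟩ := hlimit a (fun n => by simpa using ha n)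
      (by simp only [hay]; exact hy)
    exact ⟨φ, h1, h2⟩
  · intro ε hε
    by_contra! hcon
    choose a ha hKa hfar using fun n : ℕ => hcon (1 / ((n : ℝ) + 1)) (by positivity)
    have hlim : Tendsto (fun n => 2 + (quartic w (a n)).re) atTop (𝓝 K) := by
      refine tendsto_of_tendsto_of_tendsto_of_le_of_le ?_ tendsto_const_nhds
        (fun n => (hKa n).le) (fun n => hle _ (ha n))
      simpa using (tendsto_one_div_add_atTop_nhds_zero_nat (𝕜 := ℝ)).const_sub K
    obtain ⟨φ, ψ, p, -, h1, h2, h3⟩ := hlimit a ha hlim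
    obtain ⟨n, hn⟩ := ((tendsto_order.1 (tendsto_iff_norm_sub_tendsto_zero.1 h3)).2 ε hε).exists
    -- The limit is close to a translate of `a (ψ n)`; translating the limit back gives a maximizer
    -- close to `a (ψ n)` itself.
    refine absurd (hfar (ψ n) (shift (-p n) φ) (by rwa [norm_shift]) (by rwa [quartic_shift])) ?_
    rw [not_le, ← norm_shift (p n), shift_sub, shift_shift, add_neg_cancel, shift_zero]
    exact hn

end Compactness

end DMNLS

/-! ### The four wave weight: oscillation, decay and trivial resonances -/

namespace DMNLS

/-- The time average over `[0,1]` of the phase `exp (2 i ω p t)`. -/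
noncomputable def phaseAverage (ω : ℝ) (p : ℤ) : ℂ :=
  ∫ t in (0 : ℝ)..1, Complex.exp (((2 * ω * p * t : ℝ) : ℂ) * Complex.I)

lemma phaseAverage_zero (ω : ℝ) : phaseAverage ω 0 = 1 := by simp [phaseAverage]

lemma norm_phaseAverage_le_one (ω : ℝ) (p : ℤ) : ‖phaseAverage ω p‖ ≤ 1 := by
  refine (intervalIntegral.norm_integral_le_of_norm_le_const (C := 1) fun t _ => ?_).trans_eq
    (by simp)
  rw [Complex.norm_exp_ofReal_mul_I]

lemma norm_phaseAverage_le {ω : ℝ} (hω : 0 < ω) {p : ℤ} (hp : p ≠ 0) :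
    ‖phaseAverage ω p‖ ≤ 1 / (ω * |(p : ℝ)|) := by
  have hp' : (p : ℝ) ≠ 0 := Int.cast_ne_zero.2 hp
  set z : ℂ := ((2 * ω * p : ℝ) : ℂ) * Complex.I with hz
  have hz0 : z ≠ 0 := mul_ne_zero (Complex.ofReal_ne_zero.2 (by positivity)) Complex.I_ne_zero
  have h : phaseAverage ω p = (Complex.exp (z * (1 : ℝ)) - Complex.exp (z * (0 : ℝ))) / z := by
    rw [← integral_exp_mul_complex hz0, phaseAverage]
    refine intervalIntegral.integral_congr fun t _ => ?_
    simp only [hz]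
    push_cast
    ring_nf
  have hzn : ‖z‖ = 2 * (ω * |(p : ℝ)|) := by
    rw [hz, norm_mul, Complex.norm_I, mul_one, Complex.norm_real, Real.norm_eq_abs, abs_mul,
      abs_mul, abs_two, abs_of_pos hω, mul_assoc]
  rw [h, norm_div, hzn, div_le_div_iff₀ (by positivity) (by positivity)]
  have h1 : ‖Complex.exp (z * (1 : ℝ)) - Complex.exp (z * (0 : ℝ))‖ ≤ 1 + 1 := by
    refine (norm_sub_le _ _).trans (add_le_add ?_ ?_)
    · simp only [hz, Complex.ofReal_one, mul_one]
      rw [Complex.norm_exp_ofReal_mul_I]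
    · simp
  have h2 : 0 < ω * |(p : ℝ)| := by positivity
  nlinarith

/-- The weight of the four wave interaction. -/
noncomputable def waveWeight (ω : ℝ) (j k : ℤ) : ℂ := phaseAverage ω (j * k)

/-- The weight of the four wave interaction without the trivial resonances. -/
noncomputable def reducedWeight (ω : ℝ) (j k : ℤ) : ℂ :=
  if j = 0 then (if k = 0 then -1 else 0) else if k = 0 then 0 else phaseAverage ω (j * k)

/-- `xy ≤ x² + y²`. The exponent `3/4` is a compromise: its double `3/2` exceeds `1`, so the Schur
weight is summable, and of the decay `|jk|⁻¹` a factor `|jk|^(-1/4)` remains for the tail. -/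
lemma rpow_quarter_mul_le_schurWeight {j k : ℤ} (hj : j ≠ 0) (hk : k ≠ 0) :
    |(j : ℝ)| ^ (-(3 / 4) : ℝ) * |(k : ℝ)| ^ (-(3 / 4) : ℝ) ≤ schurWeight j + schurWeight k := by
  simp only [schurWeight, if_neg hj, if_neg hk]
  have h : ∀ x : ℝ, |x| ^ (-(3 / 2) : ℝ) = (|x| ^ (-(3 / 4) : ℝ)) ^ 2 := fun x => by
    rw [← Real.rpow_natCast, ← Real.rpow_mul (abs_nonneg x)]
    norm_num
  rw [h, h]
  set u := |(j : ℝ)| ^ (-(3 / 4) : ℝ)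
  set v := |(k : ℝ)| ^ (-(3 / 4) : ℝ)
  nlinarith [sq_nonneg (u - v), sq_nonneg u, sq_nonneg v]

lemma one_le_schurWeight_zero : 1 ≤ schurWeight 0 := by simp [schurWeight]

lemma inv_mul_abs_eq {j k : ℤ} (hj : j ≠ 0) (hk : k ≠ 0) :
    (|((j * k : ℤ) : ℝ)|)⁻¹ = |((j * k : ℤ) : ℝ)| ^ (-(1 / 4) : ℝ) *
      (|(j : ℝ)| ^ (-(3 / 4) : ℝ) * |(k : ℝ)| ^ (-(3 / 4) : ℝ)) := by
  have hj' : 0 < |(j : ℝ)| := abs_pos.2 (Int.cast_ne_zero.2 hj)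
  have hk' : 0 < |(k : ℝ)| := abs_pos.2 (Int.cast_ne_zero.2 hk)
  rw [Int.cast_mul, abs_mul, ← Real.mul_rpow hj'.le hk'.le, ← Real.rpow_add (by positivity),
    ← Real.rpow_neg_one]
  norm_num

lemma norm_phaseAverage_mul_le {ω : ℝ} (hω : 0 < ω) {j k : ℤ} (hj : j ≠ 0) (hk : k ≠ 0) :
    ‖phaseAverage ω (j * k)‖ ≤ ω⁻¹ * |((j * k : ℤ) : ℝ)| ^ (-(1 / 4) : ℝ) *
      (schurWeight j + schurWeight k) := by
  refine (norm_phaseAverage_le hω (mul_ne_zero hj hk)).trans ?_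
  rw [one_div, mul_inv, inv_mul_abs_eq hj hk, ← mul_assoc]
  exact mul_le_mul_of_nonneg_left (rpow_quarter_mul_le_schurWeight hj hk) (by positivity)

lemma one_le_abs_mul {j k : ℤ} (hj : j ≠ 0) (hk : k ≠ 0) : (1 : ℝ) ≤ |((j * k : ℤ) : ℝ)| := by
  rw [← Int.cast_abs]
  exact_mod_cast Int.one_le_abs (mul_ne_zero hj hk)

lemma weightBound_aux {ω : ℝ} (hω : 0 < ω) {w : ℤ → ℤ → ℂ}
    (h0 : ∀ j k, j = 0 ∨ k = 0 → ‖w j k‖ ≤ 1)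
    (h1 : ∀ j k, j ≠ 0 → k ≠ 0 → w j k = phaseAverage ω (j * k)) :
    WeightBound w (1 + ω⁻¹) := fun j k => by
  have hsj := schurWeight_nonneg j
  have hsk := schurWeight_nonneg k
  have hω' : 0 < ω⁻¹ := inv_pos.2 hω
  by_cases h : j = 0 ∨ k = 0
  · refine (h0 j k h).trans ?_
    have : 1 ≤ schurWeight j + schurWeight k := by
      rcases h with rfl | rfl <;> linarith [one_le_schurWeight_zero]
    nlinarith
  · push Not at h
    rw [h1 j k h.1 h.2]
    refine (norm_phaseAverage_mul_le hω h.1 h.2).trans ?_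
    have : |((j * k : ℤ) : ℝ)| ^ (-(1 / 4) : ℝ) ≤ 1 :=
      Real.rpow_le_one_of_one_le_of_nonpos (one_le_abs_mul h.1 h.2) (by norm_num)
    refine mul_le_mul_of_nonneg_right ?_ (add_nonneg hsj hsk)
    nlinarith

lemma weightBound_waveWeight {ω : ℝ} (hω : 0 < ω) : WeightBound (waveWeight ω) (1 + ω⁻¹) :=
  weightBound_aux hω (fun _ _ _ => norm_phaseAverage_le_one _ _) fun _ _ _ _ => rfl

lemma weightBound_reducedWeight {ω : ℝ} (hω : 0 < ω) :
    WeightBound (reducedWeight ω) (1 + ω⁻¹) :=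
  weightBound_aux hω (fun j k h => by unfold reducedWeight; split_ifs <;> simp_all)
    fun j k hj hk => by simp [reducedWeight, hj, hk]

/-- Off the axes and outside the box `|jk| ≥ J`, so the spare factor `|jk|^(-1/4)` is small. On the
axes, where `waveWeight` equals `1` and does not decay, the reduced weight is `0` except at the
origin. -/
lemma weightDecay_reducedWeight {ω : ℝ} (hω : 0 < ω) : WeightDecay (reducedWeight ω) := by
  intro ε hε
  have hlim : Tendsto (fun J : ℕ => ω⁻¹ * (J : ℝ) ^ (-(1 / 4) : ℝ)) atTop (𝓝 (ω⁻¹ * 0)) :=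
    ((tendsto_rpow_neg_atTop (by norm_num)).comp tendsto_natCast_atTop_atTop).const_mul _
  rw [mul_zero] at hlim
  obtain ⟨J, hJε, hJ1⟩ := (((tendsto_order.1 hlim).2 ε hε).and (eventually_ge_atTop 1)).exists
  refine ⟨J, fun j k => ?_⟩
  have hsj := schurWeight_nonneg j
  have hsk := schurWeight_nonneg k
  have hnn : 0 ≤ ε * (schurWeight j + schurWeight k) := by positivity
  unfold tailWeight
  split_ifs with h
  · rwa [norm_zero]
  · have hJ1' : (1 : ℤ) ≤ J := by exact_mod_cast hJ1
    by_cases hz : j = 0 ∨ k = 0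
    · have : reducedWeight ω j k = 0 := by
        unfold reducedWeight
        rcases hz with rfl | rfl
        · have : k ≠ 0 := by rintro rfl; simp at h
          simp [this]
        · have : j ≠ 0 := by rintro rfl; simp at h
          simp [this]
      rw [this, norm_zero]
      exact hnn
    · push Not at hz
      have hJle : (J : ℝ) ≤ |((j * k : ℤ) : ℝ)| := by
        rw [← Int.cast_abs, abs_mul]
        have hj := Int.one_le_abs hz.1
        have hk := Int.one_le_abs hz.2
        have : (J : ℤ) ≤ |j| * |k| := by
          rcases not_and_or.1 h with h | h <;> nlinarith
        exact_mod_cast this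
      simp only [reducedWeight, if_neg hz.1, if_neg hz.2]
      refine (norm_phaseAverage_mul_le hω hz.1 hz.2).trans ?_
      refine mul_le_mul_of_nonneg_right ?_ (by positivity)
      refine le_trans (mul_le_mul_of_nonneg_left ?_ (by positivity)) hJε.le
      exact Real.rpow_le_rpow_of_nonpos (by exact_mod_cast hJ1) hJle (by norm_num)

/-- The weight of the trivial resonances with first frequency difference zero. -/
noncomputable def leftWeight (j _k : ℤ) : ℂ := if j = 0 then 1 else 0

/-- The weight of the trivial resonances with second frequency difference zero. -/
noncomputable def rightWeight (_j k : ℤ) : ℂ := if k = 0 then 1 else 0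

lemma weightBound_leftWeight : WeightBound leftWeight 1 := fun j k => by
  have hsk := schurWeight_nonneg k
  have hsj := schurWeight_nonneg j
  unfold leftWeight
  split_ifs with h
  · subst h; rw [norm_one]; linarith [one_le_schurWeight_zero]
  · rw [norm_zero]; positivity

lemma weightBound_rightWeight : WeightBound rightWeight 1 := fun j k => by
  rw [add_comm]; exact weightBound_leftWeight k j

lemma tsum_int_shift_norm_sq (a : SeqL2) (n : ℤ) :
    ∑' k, ‖a (n + k)‖ ^ 2 = ∑' k, ‖a k‖ ^ 2 := (Equiv.addLeft n).tsum_eq fun k => ‖a k‖ ^ 2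

lemma quartic_leftWeight (a : SeqL2) : quartic leftWeight a = ‖a‖ ^ 4 := by
  have hs := summable_quadTerm zero_le_one weightBound_leftWeight (fun _ => a)
  have h1 : Summable fun n : ℤ => ((‖a n‖ ^ 2 : ℝ) : ℂ) :=
    Complex.ofRealCLM.summable (summable_norm_sq a)
  have hconj : ∀ z : ℂ, z * conj z = ((‖z‖ ^ 2 : ℝ) : ℂ) := fun z => by
    rw [Complex.mul_conj, Complex.normSq_eq_norm_sq]
  unfold quartic
  rw [hs.tsum_prod]
  have h2 : ∀ n : ℤ, ∑' q : ℤ × ℤ, quadTerm leftWeight (fun _ => a) (n, q)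
      = ((‖a n‖ ^ 2 : ℝ) : ℂ) * ((‖a‖ ^ 2 : ℝ) : ℂ) := fun n => by
    rw [(hs.prod_factor n).tsum_prod, tsum_eq_single 0]
    · rw [← tsum_norm_sq a, ← tsum_int_shift_norm_sq a n, Complex.ofReal_tsum, ← tsum_mul_left]
      refine tsum_congr fun k => ?_
      simp only [quadTerm, leftWeight, add_zero, if_true, one_mul]
      rw [← hconj, ← hconj]
      ring
    · intro j hj
      simp [quadTerm, leftWeight, hj]
  simp_rw [h2]
  rw [tsum_mul_right, ← Complex.ofReal_tsum, tsum_norm_sq]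
  push_cast
  ring

lemma quartic_rightWeight (a : SeqL2) : quartic rightWeight a = ‖a‖ ^ 4 := by
  rw [← quartic_leftWeight]
  unfold quartic
  rw [← ((Equiv.refl ℤ).prodCongr (Equiv.prodComm ℤ ℤ)).tsum_eq]
  refine tsum_congr fun p => ?_
  simp only [quadTerm, leftWeight, rightWeight, Equiv.prodCongr_apply, Prod.map_fst, Prod.map_snd,
    Equiv.refl_apply, Equiv.prodComm_apply, Prod.fst_swap, Prod.snd_swap]
  rw [add_right_comm p.1]
  ring

/-- Each axis `j = 0`, `k = 0` contributes `‖a‖⁴`; the origin is then counted twice, which the value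
`-1` of `reducedWeight` there corrects. -/
lemma quartic_waveWeight {ω : ℝ} (hω : 0 < ω) (a : SeqL2) :
    quartic (waveWeight ω) a = 2 * ‖a‖ ^ 4 + quartic (reducedWeight ω) a := by
  have hc : 0 ≤ 1 + ω⁻¹ := by positivity
  have h1 := summable_quadTerm zero_le_one weightBound_leftWeight (fun _ => a)
  have h2 := summable_quadTerm zero_le_one weightBound_rightWeight (fun _ => a)
  have h3 := summable_quadTerm hc (weightBound_reducedWeight hω) (fun _ => a)
  rw [two_mul]
  nth_rw 1 [← quartic_leftWeight]
  rw [← quartic_rightWeight]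
  unfold quartic
  rw [← h1.tsum_add h2, ← (h1.add h2).tsum_add h3]
  refine tsum_congr fun p => ?_
  simp only [quadTerm, leftWeight, rightWeight, waveWeight, reducedWeight]
  split_ifs with hj hk hk
  · rw [hj, zero_mul, phaseAverage_zero]; ring
  · rw [hj, zero_mul, phaseAverage_zero]; ring
  · rw [hk, mul_zero, phaseAverage_zero]; ring
  · ring

end DMNLS

namespace DMNLS

/-! ### Fourier coefficients and the free evolution -/

section Coefficients

lemma continuous_schrodingerSymbol (L : ℝ) (n : ℤ) : Continuous fun t => schrodingerSymbol L t n := by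
  unfold schrodingerSymbol
  fun_prop

variable {L : ℝ} [Fact (0 < L)]

lemma length_pos : 0 < L := Fact.out

lemma volume_absolutelyContinuous_haar :
    (volume : Measure (AddCircle L)) ≪ AddCircle.haarAddCircle := by
  rw [AddCircle.volume_eq_smul_haarAddCircle]
  exact Measure.smul_absolutelyContinuous

lemma haar_absolutelyContinuous_volume :
    (AddCircle.haarAddCircle : Measure (AddCircle L)) ≪ volume := by
  rw [AddCircle.volume_eq_smul_haarAddCircle]
  exact Measure.absolutelyContinuous_smul (by simpa using (Fact.out : 0 < L))

lemma memLp_haar (u : PerL2 L) : MemLp u 2 (AddCircle.haarAddCircle (T := L)) :=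
  memLp_haarAddCircle_iff.mpr (Lp.memLp u)

lemma norm_sq_eq_integral (u : PerL2 L) : ‖u‖ ^ 2 = ∫ x : AddCircle L, ‖u x‖ ^ 2 := by
  have h : RCLike.re (inner ℂ u u) = ‖u‖ ^ 2 := inner_self_eq_norm_sq (𝕜 := ℂ) u
  have h3 : ∀ x : AddCircle L, (inner ℂ (u x) (u x) : ℂ) = ((‖u x‖ ^ 2 : ℝ) : ℂ) := fun x => by
    rw [inner_self_eq_norm_sq_to_K]; norm_cast
  rw [← h, L2.inner_def]
  simp_rw [h3]
  rw [show ∫ x : AddCircle L, ((‖u x‖ ^ 2 : ℝ) : ℂ) = ((∫ x : AddCircle L, ‖u x‖ ^ 2 : ℝ) : ℂ) from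
    integral_ofReal]
  exact Complex.ofReal_re _

/-- The element of `L²` for the Haar probability measure given by `u`. -/
noncomputable def toHaar (u : PerL2 L) : Lp ℂ 2 (AddCircle.haarAddCircle (T := L)) :=
  (memLp_haar u).toLp u

lemma coeFn_toHaar (u : PerL2 L) : toHaar u =ᵐ[volume] u :=
  volume_absolutelyContinuous_haar (memLp_haar u).coeFn_toLp

lemma toHaar_add (u v : PerL2 L) : toHaar (u + v) = toHaar u + toHaar v := by
  unfold toHaar
  rw [← MemLp.toLp_add]
  exact MemLp.toLp_congr _ _ (haar_absolutelyContinuous_volume (Lp.coeFn_add u v))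

lemma toHaar_smul (c : ℂ) (u : PerL2 L) : toHaar (c • u) = c • toHaar u := by
  unfold toHaar
  rw [← MemLp.toLp_const_smul]
  exact MemLp.toLp_congr _ _ (haar_absolutelyContinuous_volume (Lp.coeFn_smul c u))

lemma norm_toHaar_sq (u : PerL2 L) : ‖toHaar u‖ ^ 2 = ‖u‖ ^ 2 / L := by
  have h : ∑' n, ‖fourierCoeff (toHaar u) n‖ ^ 2 = ‖toHaar u‖ ^ 2 := by
    rw [← LinearIsometryEquiv.norm_map (fourierBasis (T := L)).repr, ← tsum_norm_sq]
    simp_rw [fourierBasis_repr]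
  rw [← h, tsum_sq_fourierCoeff, AddCircle.integral_haarAddCircle, norm_sq_eq_integral,
    smul_eq_mul, div_eq_inv_mul]
  congr 1
  refine integral_congr_ae ?_
  filter_upwards [coeFn_toHaar u] with x hx
  rw [hx]

/-- The sequence of Fourier coefficients, as a continuous linear map. -/
noncomputable def coeff : PerL2 L →L[ℂ] SeqL2 :=
  LinearMap.mkContinuous
    { toFun := fun u => (fourierBasis (T := L)).repr (toHaar u)
      map_add' := fun u v => by rw [toHaar_add, map_add]
      map_smul' := fun c u => by rw [toHaar_smul, map_smul, RingHom.id_apply] }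
    (Real.sqrt L)⁻¹ fun u => by
      have hL : 0 < L := length_pos
      refine (pow_le_pow_iff_left₀ (norm_nonneg _) (by positivity) two_ne_zero).1 ?_
      simp only [LinearMap.coe_mk, AddHom.coe_mk, LinearIsometryEquiv.norm_map]
      rw [norm_toHaar_sq, mul_pow, inv_pow, Real.sq_sqrt hL.le, div_eq_inv_mul]

lemma coeff_def (u : PerL2 L) : coeff u = (fourierBasis (T := L)).repr (toHaar u) := rfl

lemma coeff_apply (u : PerL2 L) (n : ℤ) : coeff u n = fourierCoeff u n := by
  rw [coeff_def, fourierBasis_repr]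
  exact congrFun (fourierCoeff_congr_ae (memLp_haar u).coeFn_toLp) n

lemma norm_coeff_sq (u : PerL2 L) : ‖coeff u‖ ^ 2 = ‖u‖ ^ 2 / L := by
  rw [coeff_def, LinearIsometryEquiv.norm_map, norm_toHaar_sq]

lemma norm_coeff (u : PerL2 L) : ‖coeff u‖ = ‖u‖ / Real.sqrt L := by
  have hL : 0 < L := length_pos
  refine (pow_left_inj₀ (norm_nonneg _) (by positivity) two_ne_zero).1 ?_
  rw [norm_coeff_sq, div_pow, Real.sq_sqrt hL.le]

lemma coeff_injective : Function.Injective (coeff (L := L)) := by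
  have hL : 0 < L := length_pos
  refine (injective_iff_map_eq_zero _).2 fun u hu => ?_
  have h := norm_coeff u
  rw [hu, norm_zero, eq_comm, div_eq_zero_iff] at h
  exact norm_eq_zero.1 (h.resolve_right (by positivity))

lemma coeff_surjective : Function.Surjective (coeff (L := L)) := fun a => by
  set f := (fourierBasis (T := L)).repr.symm a with hf
  have hfv : MemLp f 2 (volume : Measure (AddCircle L)) :=
    memLp_haarAddCircle_iff.mp (Lp.memLp f)
  refine ⟨hfv.toLp f, ?_⟩
  have h : toHaar (hfv.toLp f) = f := by
    refine Lp.ext ?_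
    exact ((memLp_haar _).coeFn_toLp).trans (haar_absolutelyContinuous_volume hfv.coeFn_toLp)
  rw [coeff_def, h, hf, LinearIsometryEquiv.apply_symm_apply]

lemma coeff_schrodinger (t : ℝ) (u : PerL2 L) (n : ℤ) :
    coeff (schrodinger L t u) n = schrodingerSymbol L t n * coeff u n := by
  rw [coeff_apply, coeff_apply, fourierCoeff_schrodinger]

lemma schrodinger_sub (t : ℝ) (u v : PerL2 L) :
    schrodinger L t (u - v) = schrodinger L t u - schrodinger L t v := by
  refine coeff_injective (lp.ext (funext fun n => ?_))
  simp only [map_sub, lp.coeFn_sub, Pi.sub_apply, coeff_schrodinger, mul_sub]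

lemma norm_schrodinger (t : ℝ) (u : PerL2 L) : ‖schrodinger L t u‖ = ‖u‖ := by
  have hL : 0 < L := length_pos
  have h : ‖coeff (schrodinger L t u)‖ ^ 2 = ‖coeff u‖ ^ 2 := by
    rw [← tsum_norm_sq, ← tsum_norm_sq]
    refine tsum_congr fun n => ?_
    rw [coeff_schrodinger, norm_mul, norm_schrodingerSymbol, one_mul]
  rw [norm_coeff_sq, norm_coeff_sq, div_left_inj' hL.ne'] at h
  exact (pow_left_inj₀ (norm_nonneg _) (norm_nonneg _) two_ne_zero).1 h

/-- Strong continuity only: by Parseval the distance is a sum over frequencies, to which dominated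
convergence applies. -/
lemma continuous_schrodinger (u : PerL2 L) : Continuous fun t => schrodinger L t u := by
  have hL : 0 < L := length_pos
  rw [continuous_iff_continuousAt]
  intro s
  rw [ContinuousAt, tendsto_iff_norm_sub_tendsto_zero]
  have hsq : ∀ t, ‖schrodinger L t u - schrodinger L s u‖ ^ 2 =
      L * ∑' n, ‖(schrodingerSymbol L t n - schrodingerSymbol L s n) * coeff u n‖ ^ 2 := fun t => by
    have h := norm_coeff_sq (schrodinger L t u - schrodinger L s u)
    rw [eq_div_iff hL.ne', mul_comm, ← tsum_norm_sq] at h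
    rw [← h]
    congr 1
    refine tsum_congr fun n => ?_
    rw [map_sub, lp.coeFn_sub, Pi.sub_apply, coeff_schrodinger, coeff_schrodinger, sub_mul]
  have hlim : Tendsto (fun t => ‖schrodinger L t u - schrodinger L s u‖ ^ 2) (𝓝 s) (𝓝 0) := by
    simp_rw [hsq]
    have h0 : Tendsto (fun t => ∑' n, ‖(schrodingerSymbol L t n - schrodingerSymbol L s n)
        * coeff u n‖ ^ 2) (𝓝 s) (𝓝 (∑' n : ℤ, 0)) := by
      refine tendsto_tsum_of_dominated_convergence (bound := fun n => 4 * ‖coeff u n‖ ^ 2)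
        ((summable_norm_sq _).mul_left 4) (fun n => ?_) (Eventually.of_forall fun t n => ?_)
      · have h1 : Continuous fun t => ‖(schrodingerSymbol L t n - schrodingerSymbol L s n)
            * coeff u n‖ ^ 2 := by
          have := continuous_schrodingerSymbol L n
          fun_prop
        simpa using h1.tendsto s
      · have h2 : ‖schrodingerSymbol L t n - schrodingerSymbol L s n‖ ≤ 2 := by
          refine (norm_sub_le _ _).trans ?_
          rw [norm_schrodingerSymbol, norm_schrodingerSymbol]
          norm_num
        rw [Real.norm_of_nonneg (by positivity), norm_mul, mul_pow]
        have := pow_le_pow_left₀ (norm_nonneg _) h2 2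
        norm_num at this
        gcongr
    simpa using h0.const_mul L
  have h3 := (Real.continuous_sqrt.tendsto _).comp hlim
  simpa [Function.comp_def, Real.sqrt_sq] using h3

lemma ae_eq_sum_fourier {u : PerL2 L} {S : Finset ℤ} (hS : ∀ n ∉ S, coeff u n = 0) :
    ∀ᵐ x : AddCircle L, u x = ∑ n ∈ S, coeff u n * fourier n x := by
  have h1 : toHaar u = ∑ n ∈ S, coeff u n • fourierLp (T := L) 2 n := by
    have h := (fourierBasis (T := L)).hasSum_repr (toHaar u)
    rw [← coeff_def, coe_fourierBasis] at h
    refine h.unique (hasSum_sum_of_ne_finset_zero fun n hn => ?_)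
    rw [hS n hn, zero_smul]
  have h2 : toHaar u =ᵐ[AddCircle.haarAddCircle]
      fun x => ∑ n ∈ S, coeff u n * fourier n x := by
    rw [h1]
    refine (Lp.coeFn_finsetSum _ _).trans ?_
    have h3 : ∀ n ∈ S, (coeff u n • fourierLp (T := L) 2 n : Lp ℂ 2 _)
        =ᵐ[AddCircle.haarAddCircle] fun x => coeff u n * fourier n x := fun n _ => by
      filter_upwards [Lp.coeFn_smul (coeff u n) (fourierLp (T := L) 2 n),
        coeFn_fourierLp (T := L) 2 n] with x hx1 hx2
      rw [hx1, Pi.smul_apply, hx2, smul_eq_mul]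
    filter_upwards [(Filter.eventually_all_finset S).2 h3] with x hx
    rw [Finset.sum_apply]
    exact Finset.sum_congr rfl fun n hn => hx n hn
  filter_upwards [coeFn_toHaar u, volume_absolutelyContinuous_haar h2] with x hx1 hx2
  rw [← hx1, hx2]

end Coefficients

end DMNLS

namespace DMNLS

/-! ### The space-time integral for trigonometric polynomials -/

section TrigonometricPolynomials

/-- The four wave sum of a sequence over a finite set of frequencies. -/
noncomputable def fourWaveSum (S : Finset ℤ) (z : ℤ → ℂ) : ℂ :=
  ∑ n ∈ S, ∑ p ∈ S, ∑ q ∈ S, z p * z q * conj (z n) * conj (z (p + q - n))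

lemma quartic_eq_sum {S : Finset ℤ} {a : SeqL2} (hS : ∀ n ∉ S, a n = 0) (w : ℤ → ℤ → ℂ) :
    quartic w a = ∑ n ∈ S, ∑ p ∈ S, ∑ q ∈ S,
      w (p - n) (q - n) * (a p * a q * conj (a n) * conj (a (p + q - n))) := by
  let e : ℤ × ℤ × ℤ ≃ ℤ × ℤ × ℤ :=
    { toFun := fun x => (x.1, x.2.1 - x.1, x.2.2 - x.1)
      invFun := fun x => (x.1, x.1 + x.2.1, x.1 + x.2.2)
      left_inv := fun x => by simp
      right_inv := fun x => by simp }
  unfold quartic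
  rw [← e.tsum_eq, tsum_eq_sum (s := S ×ˢ S ×ˢ S)]
  · rw [Finset.sum_product]
    refine Finset.sum_congr rfl fun n _ => ?_
    rw [Finset.sum_product]
    refine Finset.sum_congr rfl fun p _ => Finset.sum_congr rfl fun q _ => ?_
    simp only [quadTerm, e, Equiv.coe_fn_mk]
    rw [show n + (p - n) = p by ring, show n + (q - n) = q by ring,
      show p + (q - n) = p + q - n by ring]
  · rintro ⟨n, p, q⟩ h
    simp only [Finset.mem_product, not_and_or] at h
    simp only [quadTerm, e, Equiv.coe_fn_mk, add_sub_cancel]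
    rcases h with h | h | h <;> simp [hS _ h]

/-- `p² + q² - n² - (p + q - n)² = -2(p - n)(q - n)`. -/
lemma schrodingerSymbol_four (L t : ℝ) (n p q : ℤ) :
    schrodingerSymbol L t p * schrodingerSymbol L t q * conj (schrodingerSymbol L t n)
      * conj (schrodingerSymbol L t (p + q - n))
    = Complex.exp (((2 * (2 * Real.pi / L) ^ 2 * ((p - n) * (q - n) : ℤ) * t : ℝ) : ℂ)
        * Complex.I) := by
  unfold schrodingerSymbol
  rw [← Complex.exp_conj, ← Complex.exp_conj, ← Complex.exp_add, ← Complex.exp_add,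
    ← Complex.exp_add]
  congr 1
  simp only [map_mul, Complex.conj_ofReal, Complex.conj_I]
  push_cast
  ring

variable {L : ℝ} [Fact (0 < L)]

lemma integral_fourier (m : ℤ) :
    ∫ x : AddCircle L, fourier m x = if m = 0 then (L : ℂ) else 0 := by
  have hL : 0 < L := length_pos
  have h : fourierCoeff (fourier (T := L) m) 0 = (Pi.single m (1 : ℂ) : ℤ → ℂ) 0 := by
    rw [fourierCoeff_fourier]
  unfold fourierCoeff at h
  rw [AddCircle.integral_haarAddCircle] at h
  simp only [neg_zero, fourier_zero, one_smul] at h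
  have h2 : ∫ x : AddCircle L, fourier m x = L • (L⁻¹ • ∫ x : AddCircle L, fourier m x) := by
    rw [smul_smul, mul_inv_cancel₀ hL.ne', one_smul]
  rw [h2, h]
  by_cases hm : m = 0
  · subst hm; simp
  · rw [Pi.single_eq_of_ne (Ne.symm hm)]; simp [hm]

lemma integral_norm_pow_four_sum_fourier {S : Finset ℤ} {z : ℤ → ℂ} (hS : ∀ n ∉ S, z n = 0) :
    ((∫ x : AddCircle L, ‖∑ n ∈ S, z n * fourier n x‖ ^ 4 : ℝ) : ℂ) = L * fourWaveSum S z := by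
  have hpt : ∀ x : AddCircle L, ((‖∑ n ∈ S, z n * fourier n x‖ ^ 4 : ℝ) : ℂ)
      = ∑ n ∈ S, ∑ p ∈ S, ∑ q ∈ S, ∑ r ∈ S,
        z p * z q * conj (z n) * conj (z r) * fourier (p + q - n - r) x := fun x => by
    have h1 : ∀ s : ℂ, ((‖s‖ ^ 4 : ℝ) : ℂ) = conj s * (s * (s * conj s)) := fun s => by
      rw [Complex.mul_conj, Complex.normSq_eq_norm_sq, ← mul_assoc, mul_comm (conj s),
        Complex.mul_conj, Complex.normSq_eq_norm_sq]
      push_cast; ring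
    rw [h1, map_sum, Finset.sum_mul]
    simp_rw [Finset.sum_mul, Finset.mul_sum]
    refine Finset.sum_congr rfl fun n _ => Finset.sum_congr rfl fun p _ =>
      Finset.sum_congr rfl fun q _ => Finset.sum_congr rfl fun r _ => ?_
    rw [show p + q - n - r = p + q + -n + -r by ring, fourier_add, fourier_add, fourier_add,
      fourier_neg, fourier_neg, map_mul, map_mul]
    ring
  have hint : ∀ (c : ℂ) (m : ℤ), Integrable (fun x : AddCircle L => c * fourier m x) volume :=
    fun c m => (continuous_const.mul (map_continuous (fourier m))).integrable_of_hasCompactSupport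
      (HasCompactSupport.of_compactSpace _)
  rw [← integral_complex_ofReal]
  simp_rw [hpt]
  rw [integral_finsetSum _ fun n _ => integrable_finsetSum _ fun p _ =>
    integrable_finsetSum _ fun q _ => integrable_finsetSum _ fun r _ => hint _ _,
    fourWaveSum, Finset.mul_sum]
  refine Finset.sum_congr rfl fun n _ => ?_
  rw [integral_finsetSum _ fun p _ =>
    integrable_finsetSum _ fun q _ => integrable_finsetSum _ fun r _ => hint _ _, Finset.mul_sum]
  refine Finset.sum_congr rfl fun p _ => ?_
  rw [integral_finsetSum _ fun q _ => integrable_finsetSum _ fun r _ => hint _ _, Finset.mul_sum]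
  refine Finset.sum_congr rfl fun q _ => ?_
  rw [integral_finsetSum _ fun r _ => hint _ _]
  simp_rw [integral_const_mul, integral_fourier]
  have hr : ∀ r, (p + q - n - r = 0) ↔ (r = p + q - n) := fun r => by
    constructor <;> intro h <;> linarith
  simp_rw [hr, mul_ite, mul_zero, Finset.sum_ite_eq']
  -- Orthogonality forces `r = p + q - n`; if this frequency is outside `S`, the corresponding term
  -- of `fourWaveSum` vanishes as well.
  split_ifs with h
  · ring
  · rw [hS _ h]; simp

lemma lintegral_schrodinger_of_support {S : Finset ℤ} {u : PerL2 L}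
    (hS : ∀ n ∉ S, coeff u n = 0) (t : ℝ) :
    ∫⁻ x : AddCircle L, ‖schrodinger L t u x‖ₑ ^ 4
      = ENNReal.ofReal (L * (fourWaveSum S fun n => schrodingerSymbol L t n * coeff u n).re) := by
  have hS' : ∀ n ∉ S, coeff (schrodinger L t u) n = 0 := fun n hn => by
    rw [coeff_schrodinger, hS n hn, mul_zero]
  have h := integral_norm_pow_four_sum_fourier (L := L)
    (z := fun n => schrodingerSymbol L t n * coeff u n)
    (fun n hn => by rw [hS n hn, mul_zero])
  have hre := congrArg Complex.re h
  rw [Complex.ofReal_re, Complex.re_ofReal_mul] at hre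
  rw [← hre, ofReal_integral_eq_lintegral_ofReal]
  · refine lintegral_congr_ae ?_
    filter_upwards [ae_eq_sum_fourier hS'] with x hx
    rw [hx, ENNReal.ofReal_pow (norm_nonneg _), ofReal_norm]
    simp_rw [coeff_schrodinger]
  · refine Continuous.integrable_of_hasCompactSupport ?_ (HasCompactSupport.of_compactSpace _)
    have : ∀ n : ℤ, Continuous fun x : AddCircle L => fourier n x := fun n => map_continuous _
    fun_prop
  · exact Eventually.of_forall fun x => by positivity

lemma integral_fourWaveSum {S : Finset ℤ} {u : PerL2 L} (hS : ∀ n ∉ S, coeff u n = 0) :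
    ∫ t in (0 : ℝ)..1, fourWaveSum S (fun n => schrodingerSymbol L t n * coeff u n)
      = quartic (waveWeight ((2 * Real.pi / L) ^ 2)) (coeff u) := by
  have hpt : ∀ t : ℝ, fourWaveSum S (fun n => schrodingerSymbol L t n * coeff u n)
      = ∑ n ∈ S, ∑ p ∈ S, ∑ q ∈ S,
        Complex.exp (((2 * (2 * Real.pi / L) ^ 2 * ((p - n) * (q - n) : ℤ) * t : ℝ) : ℂ)
          * Complex.I)
        * (coeff u p * coeff u q * conj (coeff u n) * conj (coeff u (p + q - n))) := fun t => by
    refine Finset.sum_congr rfl fun n _ => Finset.sum_congr rfl fun p _ =>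
      Finset.sum_congr rfl fun q _ => ?_
    rw [← schrodingerSymbol_four]
    simp only [map_mul]
    ring
  have hint : ∀ (m : ℤ) (c : ℂ), IntervalIntegrable (fun t : ℝ =>
      Complex.exp (((2 * (2 * Real.pi / L) ^ 2 * m * t : ℝ) : ℂ) * Complex.I) * c)
      volume 0 1 := fun m c => by
    refine Continuous.intervalIntegrable ?_ _ _
    fun_prop
  have hsum : ∀ {T : Finset ℤ} {f : ℤ → ℝ → ℂ},
      (∀ i ∈ T, IntervalIntegrable (f i) volume 0 1) →
      IntervalIntegrable (fun t => ∑ i ∈ T, f i t) volume 0 1 := fun {T f} h => by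
    have h' := IntervalIntegrable.sum T h
    rwa [show ∑ i ∈ T, f i = fun t => ∑ i ∈ T, f i t from funext fun t => Finset.sum_apply t T f]
      at h'
  simp_rw [hpt]
  rw [quartic_eq_sum hS, intervalIntegral.integral_finsetSum fun n _ => hsum fun p _ =>
    hsum fun q _ => hint _ _]
  refine Finset.sum_congr rfl fun n _ => ?_
  rw [intervalIntegral.integral_finsetSum fun p _ => hsum fun q _ => hint _ _]
  refine Finset.sum_congr rfl fun p _ => ?_
  rw [intervalIntegral.integral_finsetSum fun q _ => hint _ _]
  refine Finset.sum_congr rfl fun q _ => ?_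
  rw [intervalIntegral.integral_mul_const, waveWeight, phaseAverage]

/-- The space-time `L⁴` integral of the free evolution. -/
noncomputable def strichartz (L : ℝ) [Fact (0 < L)] (u : PerL2 L) : ℝ≥0∞ :=
  ∫⁻ t in Set.Icc (0 : ℝ) 1, ∫⁻ x : AddCircle L, ‖schrodinger L t u x‖ₑ ^ 4

/-- The four wave form of `u`. -/
noncomputable def waveForm (L : ℝ) [Fact (0 < L)] (u : PerL2 L) : ℝ :=
  (quartic (waveWeight ((2 * Real.pi / L) ^ 2)) (coeff u)).re

lemma continuous_fourWaveSum {u : PerL2 L} (S : Finset ℤ) : Continuous fun t : ℝ =>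
    fourWaveSum S (fun n => schrodingerSymbol L t n * coeff u n) := by
  have := fun n => continuous_schrodingerSymbol L n
  unfold fourWaveSum
  fun_prop

lemma fourWaveSum_schrodinger_nonneg {S : Finset ℤ} {u : PerL2 L}
    (hS : ∀ n ∉ S, coeff u n = 0) (t : ℝ) :
    0 ≤ L * (fourWaveSum S fun n => schrodingerSymbol L t n * coeff u n).re := by
  have h := integral_norm_pow_four_sum_fourier (L := L)
    (z := fun n => schrodingerSymbol L t n * coeff u n)
    (fun n hn => by rw [hS n hn, mul_zero])
  have hre := congrArg Complex.re h
  rw [Complex.ofReal_re, Complex.re_ofReal_mul] at hre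
  rw [← hre]
  exact integral_nonneg fun x => by positivity

lemma waveForm_eq_integral {S : Finset ℤ} {u : PerL2 L} (hS : ∀ n ∉ S, coeff u n = 0) :
    waveForm L u = ∫ t in Set.Icc (0 : ℝ) 1,
      (fourWaveSum S fun n => schrodingerSymbol L t n * coeff u n).re := by
  rw [waveForm, ← integral_fourWaveSum hS, intervalIntegral.integral_of_le zero_le_one,
    ← integral_Icc_eq_integral_Ioc]
  exact (integral_re (continuous_fourWaveSum S).integrableOn_Icc).symm

lemma waveForm_nonneg_of_support {S : Finset ℤ} {u : PerL2 L} (hS : ∀ n ∉ S, coeff u n = 0) :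
    0 ≤ waveForm L u := by
  have hL : 0 < L := length_pos
  rw [waveForm_eq_integral hS]
  exact integral_nonneg fun t =>
    nonneg_of_mul_nonneg_right (fourWaveSum_schrodinger_nonneg hS t) hL

lemma strichartz_of_support {S : Finset ℤ} {u : PerL2 L} (hS : ∀ n ∉ S, coeff u n = 0) :
    strichartz L u = ENNReal.ofReal (L * waveForm L u) := by
  have hcont := continuous_fourWaveSum (u := u) S
  unfold strichartz
  simp_rw [lintegral_schrodinger_of_support hS]
  rw [← ofReal_integral_eq_lintegral_ofReal]
  · rw [integral_const_mul, waveForm_eq_integral hS]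
  · exact (by fun_prop : Continuous fun t =>
      L * (fourWaveSum S fun n => schrodingerSymbol L t n * coeff u n).re).integrableOn_Icc
  · exact Eventually.of_forall (fourWaveSum_schrodinger_nonneg hS)

end TrigonometricPolynomials

end DMNLS

namespace DMNLS

/-! ### Extension of the identity to all of L² -/

section Density

variable {L : ℝ} [Fact (0 < L)]

lemma eLpNorm_four_pow {α : Type*} [MeasurableSpace α] (μ : Measure α) (f : α → ℂ) :
    eLpNorm f 4 μ ^ (4 : ℝ) = ∫⁻ x, ‖f x‖ₑ ^ 4 ∂μ := by
  have h := eLpNorm_nnreal_pow_eq_lintegral (μ := μ) (f := f) (p := 4) (by norm_num)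
  norm_num at h
  have e : ((4 : ℝ)) = ((4 : ℕ) : ℝ) := by norm_num
  rw [e, ENNReal.rpow_natCast]
  exact h

/-- The `L⁴` norm is lower semicontinuous on `L²`. -/
lemma lowerSemicontinuous_eLpNorm_four :
    LowerSemicontinuous fun v : PerL2 L => eLpNorm v 4 (volume : Measure (AddCircle L)) := by
  rw [lowerSemicontinuous_iff_isClosed_preimage]
  intro y
  refine IsSeqClosed.isClosed fun v w hv hw => ?_
  have hm : TendstoInMeasure volume (fun n => (v n : AddCircle L → ℂ)) atTop w :=
    tendstoInMeasure_of_tendsto_Lp hw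
  obtain ⟨ns, hns, hae⟩ := hm.exists_seq_tendsto_ae
  refine (Lp.eLpNorm_lim_le_liminf_eLpNorm (fun n => Lp.aestronglyMeasurable (v (ns n))) _
    hae).trans ?_
  refine liminf_le_of_frequently_le' (Frequently.of_forall fun n => ?_)
  exact hv (ns n)

lemma measurable_eLpNorm_schrodinger (u : PerL2 L) :
    Measurable fun t => eLpNorm (schrodinger L t u) 4 (volume : Measure (AddCircle L)) :=
  (lowerSemicontinuous_eLpNorm_four.comp (continuous_schrodinger u)).measurable

lemma strichartz_eq (u : PerL2 L) : strichartz L u = ∫⁻ t in Set.Icc (0 : ℝ) 1,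
    eLpNorm (schrodinger L t u) 4 (volume : Measure (AddCircle L)) ^ (4 : ℝ) := by
  simp_rw [eLpNorm_four_pow]
  rfl

lemma strichartz_add_le (u v : PerL2 L) :
    strichartz L u ^ (1 / 4 : ℝ) ≤ strichartz L (u - v) ^ (1 / 4 : ℝ)
      + strichartz L v ^ (1 / 4 : ℝ) := by
  simp only [strichartz_eq]
  refine le_trans ?_ (ENNReal.lintegral_Lp_add_le (μ := volume.restrict (Set.Icc (0 : ℝ) 1))
    (measurable_eLpNorm_schrodinger (u - v)).aemeasurable
    (measurable_eLpNorm_schrodinger v).aemeasurable (p := 4) (by norm_num))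
  refine ENNReal.rpow_le_rpow (lintegral_mono fun t => ENNReal.rpow_le_rpow ?_ (by norm_num))
    (by norm_num)
  have h : schrodinger L t u = schrodinger L t (u - v) + schrodinger L t v := by
    rw [schrodinger_sub, sub_add_cancel]
  rw [Pi.add_apply]
  conv_lhs => rw [h]
  rw [eLpNorm_congr_ae (Lp.coeFn_add _ _)]
  exact eLpNorm_add_le (Lp.aestronglyMeasurable _) (Lp.aestronglyMeasurable _) (by norm_num)

lemma strichartz_le_liminf {u : PerL2 L} {v : ℕ → PerL2 L} (hv : Tendsto v atTop (𝓝 u)) :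
    strichartz L u ≤ liminf (fun n => strichartz L (v n)) atTop := by
  simp only [strichartz_eq]
  refine le_trans (lintegral_mono fun t => ?_) (lintegral_liminf_le fun n =>
    (measurable_eLpNorm_schrodinger (v n)).pow_const 4)
  have hvt : Tendsto (fun n => schrodinger L t (v n)) atTop (𝓝 (schrodinger L t u)) := by
    rw [tendsto_iff_norm_sub_tendsto_zero] at hv ⊢
    simpa only [← schrodinger_sub, norm_schrodinger] using hv
  have h1 : LowerSemicontinuous fun w : PerL2 L =>
      eLpNorm w 4 (volume : Measure (AddCircle L)) ^ (4 : ℝ) := by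
    intro w y hy
    have hy' : y ^ (1 / 4 : ℝ) < eLpNorm w 4 (volume : Measure (AddCircle L)) := by
      have := ENNReal.rpow_lt_rpow hy (by norm_num : (0 : ℝ) < 1 / 4)
      rwa [← ENNReal.rpow_mul, show (4 : ℝ) * (1 / 4) = 1 by norm_num, ENNReal.rpow_one] at this
    filter_upwards [lowerSemicontinuous_eLpNorm_four w _ hy'] with w' hw'
    have := ENNReal.rpow_lt_rpow hw' (by norm_num : (0 : ℝ) < 4)
    rwa [← ENNReal.rpow_mul, show (1 / 4 : ℝ) * 4 = 1 by norm_num, ENNReal.rpow_one] at this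
  exact (LowerSemicontinuous.le_liminf h1 _).trans (liminf_le_liminf_of_le hvt)

lemma waveFrequency_pos : 0 < (2 * Real.pi / L) ^ 2 := by
  have hL : 0 < L := length_pos
  have := Real.pi_pos
  positivity

lemma continuous_waveForm : Continuous (waveForm L) :=
  Complex.continuous_re.comp ((continuous_quartic
    (by have := waveFrequency_pos (L := L); positivity)
    (weightBound_waveWeight waveFrequency_pos)).comp coeff.continuous)

lemma exists_support_tendsto (u : PerL2 L) :
    ∃ v : ℕ → PerL2 L, Tendsto v atTop (𝓝 u) ∧
      ∀ n, ∃ S : Finset ℤ, ∀ i ∉ S, coeff (v n) i = 0 := by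
  have hL : 0 < L := length_pos
  have h : ∀ n : ℕ, ∃ v : PerL2 L, ‖v - u‖ < 1 / ((n : ℝ) + 1) ∧
      ∃ S : Finset ℤ, ∀ i ∉ S, coeff v i = 0 := fun n => by
    have hs := lp.hasSum_single (p := 2) (by norm_num) (coeff u)
    have hε : 0 < 1 / ((n : ℝ) + 1) / Real.sqrt L := by positivity
    obtain ⟨S, hS⟩ := (Metric.tendsto_nhds.1 hs _ hε).exists
    obtain ⟨v, hv⟩ := coeff_surjective (L := L) (∑ i ∈ S, lp.single 2 i (coeff u i))
    refine ⟨v, ?_, S, fun i hi => ?_⟩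
    · rw [← hv, dist_eq_norm, ← map_sub, norm_coeff] at hS
      exact (div_lt_div_iff_of_pos_right (by positivity)).1 hS
    · rw [hv, lp.coeFn_sum, Finset.sum_apply]
      refine Finset.sum_eq_zero fun j hj => ?_
      rw [lp.single_apply_ne]
      rintro rfl
      exact hi hj
  choose v hv hS using h
  refine ⟨v, ?_, hS⟩
  rw [tendsto_iff_norm_sub_tendsto_zero]
  exact squeeze_zero (fun n => norm_nonneg _) (fun n => (hv n).le)
    tendsto_one_div_add_atTop_nhds_zero_nat

/-- Fatou along trigonometric polynomials gives one inequality, and with it finiteness of the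
space-time norm. -/
lemma strichartz_le (u : PerL2 L) : strichartz L u ≤ ENNReal.ofReal (L * waveForm L u) := by
  obtain ⟨v, hv, hS⟩ := exists_support_tendsto u
  refine (strichartz_le_liminf hv).trans ?_
  have h : ∀ n, strichartz L (v n) = ENNReal.ofReal (L * waveForm L (v n)) := fun n => by
    obtain ⟨S, hS⟩ := hS n
    exact strichartz_of_support hS
  simp_rw [h]
  exact (((ENNReal.continuous_ofReal.comp (continuous_const.mul continuous_waveForm)).tendsto
    u).comp hv).liminf_eq.le

theorem strichartz_eq_waveForm (u : PerL2 L) :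
    strichartz L u = ENNReal.ofReal (L * waveForm L u) := by
  refine le_antisymm (strichartz_le u) ?_
  obtain ⟨v, hv, hS⟩ := exists_support_tendsto u
  have hcont : Continuous fun w : PerL2 L => ENNReal.ofReal (L * waveForm L w) ^ (1 / 4 : ℝ) :=
    (ENNReal.continuous_rpow_const).comp
      (ENNReal.continuous_ofReal.comp (continuous_const.mul continuous_waveForm))
  -- The reverse inequality: Minkowski in space-time `L⁴`, where the error `v n - u` is controlled
  -- by the inequality already proved and the continuity of `waveForm` at `0`.
  have h : ∀ n, ENNReal.ofReal (L * waveForm L (v n)) ^ (1 / 4 : ℝ) ≤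
      ENNReal.ofReal (L * waveForm L (v n - u)) ^ (1 / 4 : ℝ) + strichartz L u ^ (1 / 4 : ℝ) :=
    fun n => by
      obtain ⟨S, hS⟩ := hS n
      rw [← strichartz_of_support hS]
      exact (strichartz_add_le (v n) u).trans (add_le_add_left
        (ENNReal.rpow_le_rpow (strichartz_le _) (by norm_num)) _)
  have hsub : Tendsto (fun n => v n - u) atTop (𝓝 0) := by simpa using hv.sub_const u
  have h0 : ENNReal.ofReal (L * waveForm L 0) ^ (1 / 4 : ℝ) = 0 := by
    have : waveForm L 0 = 0 := by simp [waveForm, quartic, quadTerm]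
    rw [this, mul_zero, ENNReal.ofReal_zero, ENNReal.zero_rpow_of_pos (by norm_num)]
  have hlim := le_of_tendsto_of_tendsto' ((hcont.tendsto u).comp hv)
    (((hcont.tendsto 0).comp hsub).add_const (strichartz L u ^ (1 / 4 : ℝ))) h
  rw [h0, zero_add] at hlim
  exact (ENNReal.rpow_le_rpow_iff (by norm_num)).1 hlim

lemma waveForm_nonneg (u : PerL2 L) : 0 ≤ waveForm L u := by
  obtain ⟨v, hv, hS⟩ := exists_support_tendsto u
  refine ge_of_tendsto' ((continuous_waveForm.tendsto u).comp hv) fun n => ?_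
  obtain ⟨S, hS⟩ := hS n
  exact waveForm_nonneg_of_support hS

theorem hamiltonian_eq (u : PerL2 L) : hamiltonian L u = -(2 * Real.pi) * waveForm L u := by
  have hL : 0 < L := length_pos
  rw [hamiltonian, ← strichartz, strichartz_eq_waveForm,
    ENNReal.toReal_ofReal (mul_nonneg hL.le (waveForm_nonneg u))]
  field_simp

end Density

end DMNLS

namespace DMNLS

/-! ### A trial sequence with quadratic phases -/

/-- The integral of `cos (m s)` over `[0, θ]`. -/
noncomputable def cosIntegral (m : ℤ) (θ : ℝ) : ℝ :=
  if m = 0 then θ else Real.sin (m * θ) / m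

lemma hasDerivAt_cosIntegral (m : ℤ) (θ : ℝ) :
    HasDerivAt (cosIntegral m) (Real.cos (m * θ)) θ := by
  unfold cosIntegral
  split_ifs with h
  · simpa [h] using hasDerivAt_id' θ
  · have hm : (m : ℝ) ≠ 0 := Int.cast_ne_zero.2 h
    have := (((hasDerivAt_id θ).const_mul (m : ℝ)).sin).div_const (m : ℝ)
    refine this.congr_deriv ?_
    simp only [id]
    field_simp

/-- The integral over `[0, θ]` of the fourth moment of a real sequence with quadratic phases. -/
noncomputable def chirpedForm (N : ℕ) (α : ℤ → ℝ) (θ : ℝ) : ℝ :=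
  ∑ n ∈ Finset.Ico (0 : ℤ) N, ∑ q ∈ Finset.Ico (0 : ℤ) N, ∑ p ∈ Finset.Ico (0 : ℤ) N,
    α n * α q * (α p * α (p + q - n)) * cosIntegral ((p - n) * (q - n)) θ

lemma sum_Ico_eq_sum_shift {N : ℕ} {f : ℤ → ℝ} (hf : ∀ p ∉ Finset.Ico (0 : ℤ) N, f p = 0)
    {n : ℤ} (hn : n ∈ Finset.Ico (0 : ℤ) N) :
    ∑ p ∈ Finset.Ico (0 : ℤ) N, f p = ∑ j ∈ Finset.Icc (-N : ℤ) N, f (n + j) := by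
  rw [show ∑ j ∈ Finset.Icc (-N : ℤ) N, f (n + j) =
      ∑ p ∈ (Finset.Icc (-N : ℤ) N).map (addLeftEmbedding n), f p by simp only [Finset.sum_map, addLeftEmbedding_apply]]
  refine Finset.sum_subset (fun p hp => ?_) fun p _ hp => hf p hp
  simp only [Finset.mem_Ico, Finset.map_add_left_Icc, Finset.mem_Icc] at *
  omega

/-- With `p = n + j` the right side is `Σ_j |Σ_n αₙα_{n+j} e^{ijns}|²`; keep only `j = 0`. -/
lemma sq_sum_sq_le_sum_cos {N : ℕ} {α : ℤ → ℝ} (hα : ∀ n ∉ Finset.Ico (0 : ℤ) N, α n = 0)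
    (s : ℝ) :
    (∑ n ∈ Finset.Ico (0 : ℤ) N, α n ^ 2) ^ 2 ≤
      ∑ n ∈ Finset.Ico (0 : ℤ) N, ∑ q ∈ Finset.Ico (0 : ℤ) N, ∑ p ∈ Finset.Ico (0 : ℤ) N,
        α n * α q * (α p * α (p + q - n)) * Real.cos (((p - n) * (q - n) : ℤ) * s) := by
  set S := Finset.Ico (0 : ℤ) N
  set D := Finset.Icc (-N : ℤ) N
  have key : ∑ n ∈ S, ∑ q ∈ S, ∑ p ∈ S,
        α n * α q * (α p * α (p + q - n)) * Real.cos (((p - n) * (q - n) : ℤ) * s) =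
      ∑ j ∈ D, ((∑ n ∈ S, α n * α (n + j) * Real.cos (j * n * s)) ^ 2 +
        (∑ n ∈ S, α n * α (n + j) * Real.sin (j * n * s)) ^ 2) := by
    have h1 : ∀ n ∈ S, ∀ q ∈ S, ∑ p ∈ S,
        α n * α q * (α p * α (p + q - n)) * Real.cos (((p - n) * (q - n) : ℤ) * s) =
        ∑ j ∈ D, ((α n * α (n + j) * Real.cos (j * n * s)) *
          (α q * α (q + j) * Real.cos (j * q * s)) +
          (α n * α (n + j) * Real.sin (j * n * s)) *
          (α q * α (q + j) * Real.sin (j * q * s))) := by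
      intro n hn q _
      rw [sum_Ico_eq_sum_shift (fun p hp => by simp [hα p hp]) hn]
      refine Finset.sum_congr rfl fun j _ => ?_
      rw [show n + j + q - n = q + j by ring,
        show (((n + j - n) * (q - n) : ℤ) : ℝ) * s = j * q * s - j * n * s by push_cast; ring,
        Real.cos_sub]
      ring
    rw [Finset.sum_congr rfl fun n hn => Finset.sum_congr rfl fun q hq => h1 n hn q hq]
    simp_rw [sq, Finset.sum_mul_sum]
    rw [Finset.sum_congr rfl fun n _ => Finset.sum_comm, Finset.sum_comm]
    simp_rw [Finset.sum_add_distrib]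
  rw [key]
  have h0 : (0 : ℤ) ∈ D := by simp [D]
  refine le_trans (le_of_eq ?_) (Finset.single_le_sum (f := fun j : ℤ =>
    (∑ n ∈ S, α n * α (n + j) * Real.cos (j * n * s)) ^ 2 +
        (∑ n ∈ S, α n * α (n + j) * Real.sin (j * n * s)) ^ 2) (fun j _ => by positivity) h0)
  simp [sq]

lemma chirpedForm_add_le {N : ℕ} {α : ℤ → ℝ} (hα : ∀ n ∉ Finset.Ico (0 : ℤ) N, α n = 0)
    {θ ω : ℝ} (h : θ ≤ ω) :
    chirpedForm N α θ + (∑ n ∈ Finset.Ico (0 : ℤ) N, α n ^ 2) ^ 2 * (ω - θ) ≤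
      chirpedForm N α ω := by
  have hd : ∀ s, HasDerivAt (chirpedForm N α) (∑ n ∈ Finset.Ico (0 : ℤ) N,
      ∑ q ∈ Finset.Ico (0 : ℤ) N, ∑ p ∈ Finset.Ico (0 : ℤ) N,
        α n * α q * (α p * α (p + q - n)) * Real.cos (((p - n) * (q - n) : ℤ) * s)) s := by
    intro s
    unfold chirpedForm
    exact HasDerivAt.fun_sum fun n _ => HasDerivAt.fun_sum fun q _ => HasDerivAt.fun_sum fun p _ =>
      (hasDerivAt_cosIntegral _ s).const_mul _
  have := (convex_univ (𝕜 := ℝ) (E := ℝ)).mul_sub_le_image_sub_of_le_deriv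
    (f := chirpedForm N α) (C := (∑ n ∈ Finset.Ico (0 : ℤ) N, α n ^ 2) ^ 2)
    (fun x _ => (hd x).continuousAt.continuousWithinAt)
    (fun x _ => (hd x).differentiableAt.differentiableWithinAt)
    (fun x _ => by rw [(hd x).deriv]; exact sq_sum_sq_le_sum_cos hα x)
    θ trivial ω trivial h
  linarith

/-- The factor `e^{-iωm}` moves the time interval to `[-1/2, 1/2]`, where the average is the real
number `sin(ωm)/(ωm)`, or `1` when `m = 0`. -/
lemma exp_mul_phaseAverage {ω : ℝ} (hω : 0 < ω) (m : ℤ) :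
    ω * (phaseAverage ω m * Complex.exp ((-(ω * m) : ℝ) * Complex.I)).re = cosIntegral m ω := by
  unfold cosIntegral
  split_ifs with h
  · simp [h, phaseAverage_zero]
  · have hm : (m : ℝ) ≠ 0 := Int.cast_ne_zero.2 h
    have hc : (2 * ω * m : ℂ) * Complex.I ≠ 0 := by
      simp [hω.ne', h]
    have e : phaseAverage ω m = (Complex.exp ((2 * ω * m : ℂ) * Complex.I) - 1) /
        ((2 * ω * m : ℂ) * Complex.I) := by
      have := integral_exp_mul_complex (a := 0) (b := 1) hc
      rw [phaseAverage]
      simp only [Complex.ofReal_zero, Complex.ofReal_one, mul_zero, Complex.exp_zero,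
        mul_one] at this
      rw [← this]
      refine intervalIntegral.integral_congr fun t _ => ?_
      congr 1; push_cast; ring
    have e2 : phaseAverage ω m * Complex.exp ((-(ω * m) : ℝ) * Complex.I) =
        ((Real.sin (m * ω) / (m * ω) : ℝ) : ℂ) := by
      rw [e, div_mul_eq_mul_div, sub_mul, ← Complex.exp_add, one_mul]
      push_cast
      rw [show 2 * (ω : ℂ) * m * Complex.I + -(ω * m) * Complex.I = (m * ω) * Complex.I by ring,
        show -((ω : ℂ) * m) * Complex.I = -(m * ω) * Complex.I by ring, Complex.sin]
      have : (m : ℂ) ≠ 0 := by exact_mod_cast h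
      have : (ω : ℂ) ≠ 0 := by exact_mod_cast hω.ne'
      field_simp
      rw [Complex.I_sq]
      ring
    rw [e2, Complex.ofReal_re]
    field_simp

/-- A real sequence with compact support, multiplied by quadratic phases. -/
noncomputable def chirped (N : ℕ) (α : ℤ → ℝ) (hα : ∀ n ∉ Finset.Ico (0 : ℤ) N, α n = 0)
    (ω : ℝ) : SeqL2 :=
  ⟨fun n => α n * Complex.exp ((ω * n ^ 2 / 2 : ℝ) * Complex.I),
    memℓp_gen (summable_of_ne_finset_zero (s := Finset.Ico (0 : ℤ) N) fun n hn => by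
      simp [hα n hn])⟩

lemma chirped_apply {N : ℕ} {α : ℤ → ℝ} (hα : ∀ n ∉ Finset.Ico (0 : ℤ) N, α n = 0)
    (ω : ℝ) (n : ℤ) :
    chirped N α hα ω n = α n * Complex.exp ((ω * n ^ 2 / 2 : ℝ) * Complex.I) := rfl

lemma norm_chirped_sq {N : ℕ} {α : ℤ → ℝ} (hα : ∀ n ∉ Finset.Ico (0 : ℤ) N, α n = 0)
    (ω : ℝ) : ‖chirped N α hα ω‖ ^ 2 = ∑ n ∈ Finset.Ico (0 : ℤ) N, α n ^ 2 := by
  rw [← tsum_norm_sq, tsum_eq_sum (s := Finset.Ico (0 : ℤ) N)]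
  · exact Finset.sum_congr rfl fun n _ => by
      rw [chirped_apply, norm_mul, Complex.norm_exp_ofReal_mul_I]; simp
  · intro n hn; simp [chirped_apply, hα n hn]

lemma mul_quartic_chirped {N : ℕ} {α : ℤ → ℝ} (hα : ∀ n ∉ Finset.Ico (0 : ℤ) N, α n = 0)
    {ω : ℝ} (hω : 0 < ω) :
    ω * (quartic (waveWeight ω) (chirped N α hα ω)).re = chirpedForm N α ω := by
  rw [quartic_eq_sum (S := Finset.Ico (0 : ℤ) N) (fun n hn => by simp [chirped_apply, hα n hn]),
    chirpedForm]
  simp only [Complex.re_sum, Finset.mul_sum]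
  refine Finset.sum_congr rfl fun n _ => ?_
  rw [Finset.sum_comm]
  refine Finset.sum_congr rfl fun q _ => Finset.sum_congr rfl fun p _ => ?_
  have e : chirped N α hα ω p * chirped N α hα ω q * conj (chirped N α hα ω n) *
      conj (chirped N α hα ω (p + q - n)) = ((α n * α q * (α p * α (p + q - n)) : ℝ) : ℂ) *
        Complex.exp ((-(ω * ((p - n) * (q - n) : ℤ)) : ℝ) * Complex.I) := by
    simp only [chirped_apply, map_mul, Complex.conj_ofReal, ← Complex.exp_conj, Complex.conj_I]
    rw [show ∀ a b c d e f g h : ℂ, a * b * (c * d) * (e * f) * (g * h) =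
      (a * c * e * g) * (b * d * f * h) by intros; ring, ← Complex.exp_add, ← Complex.exp_add,
      ← Complex.exp_add]
    congr 1
    · push_cast; ring
    · congr 1; push_cast; ring
  rw [e, waveWeight, mul_left_comm, Complex.re_ofReal_mul, mul_left_comm,
    exp_mul_phaseAverage hω]

/-- With `M = Σαₙ²`: `ω(2M² + Q) = F(ω) ≥ F(θ) + M²(ω - θ) > 2M²ω`. -/
lemma reducedWeight_chirped_pos {N : ℕ} {α : ℤ → ℝ}
    (hα : ∀ n ∉ Finset.Ico (0 : ℤ) N, α n = 0) {θ ω : ℝ} (hω : 0 < ω) (hθ : θ ≤ ω)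
    (h : (∑ n ∈ Finset.Ico (0 : ℤ) N, α n ^ 2) ^ 2 * (ω + θ) < chirpedForm N α θ) :
    0 < (quartic (reducedWeight ω) (chirped N α hα ω)).re := by
  have h1 := mul_quartic_chirped hα hω
  have h2 := chirpedForm_add_le hα hθ
  have h3 : (quartic (waveWeight ω) (chirped N α hα ω)).re =
      2 * (∑ n ∈ Finset.Ico (0 : ℤ) N, α n ^ 2) ^ 2 +
        (quartic (reducedWeight ω) (chirped N α hα ω)).re := by
    rw [quartic_waveWeight hω, ← norm_chirped_sq hα ω, Complex.add_re, ← pow_mul]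
    congr 1
    norm_cast
  rw [h3] at h1
  refine pos_of_mul_pos_right (a := ω) ?_ hω.le
  linarith


/-! ### Evaluation at angles with rational sine and cosine -/

/-- The four point correlation `∑ αₙ αₙ₊ⱼ αₙ₊ₖ αₙ₊ⱼ₊ₖ`. -/
noncomputable def fourCorr (α : ℤ → ℝ) (j k : ℤ) : ℝ :=
  ∑' n, α n * α (n + j) * (α (n + k) * α (n + j + k))

lemma fourCorr_comm (α : ℤ → ℝ) (j k : ℤ) : fourCorr α j k = fourCorr α k j := by
  refine tsum_congr fun n => ?_
  rw [add_right_comm]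
  ring

lemma fourCorr_neg_left (α : ℤ → ℝ) (j k : ℤ) : fourCorr α (-j) k = fourCorr α j k := by
  rw [fourCorr, fourCorr, ← (Equiv.addRight j).tsum_eq]
  refine tsum_congr fun n => ?_
  simp only [Equiv.coe_addRight, add_neg_cancel_right]
  ring

lemma fourCorr_neg_right (α : ℤ → ℝ) (j k : ℤ) : fourCorr α j (-k) = fourCorr α j k := by
  rw [fourCorr_comm, fourCorr_neg_left, fourCorr_comm]

lemma fourCorr_eq_sum {N : ℕ} {α : ℤ → ℝ} (hα : ∀ n ∉ Finset.Ico (0 : ℤ) N, α n = 0) (j k : ℤ) :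
    fourCorr α j k =
      ∑ n ∈ Finset.Ico (0 : ℤ) N, α n * α (n + j) * (α (n + k) * α (n + j + k)) :=
  tsum_eq_sum fun n hn => by simp [hα n hn]

lemma chirpedForm_eq_sum_fourCorr {N : ℕ} {α : ℤ → ℝ}
    (hα : ∀ n ∉ Finset.Ico (0 : ℤ) N, α n = 0) (θ : ℝ) :
    chirpedForm N α θ = ∑ j ∈ Finset.Icc (-N : ℤ) N, ∑ k ∈ Finset.Icc (-N : ℤ) N,
      fourCorr α j k * cosIntegral (j * k) θ := by
  have h1 : ∀ n ∈ Finset.Ico (0 : ℤ) N, ∑ q ∈ Finset.Ico (0 : ℤ) N, ∑ p ∈ Finset.Ico (0 : ℤ) N,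
      α n * α q * (α p * α (p + q - n)) * cosIntegral ((p - n) * (q - n)) θ =
      ∑ j ∈ Finset.Icc (-N : ℤ) N, ∑ k ∈ Finset.Icc (-N : ℤ) N,
        α n * α (n + j) * (α (n + k) * α (n + j + k)) * cosIntegral (j * k) θ := by
    intro n hn
    rw [Finset.sum_comm, sum_Ico_eq_sum_shift (fun p hp => by simp [hα p hp]) hn]
    refine Finset.sum_congr rfl fun j _ => ?_
    rw [sum_Ico_eq_sum_shift (fun p hp => by simp [hα p hp]) hn]
    refine Finset.sum_congr rfl fun k _ => ?_
    rw [show n + j + (n + k) - n = n + j + k by ring, add_sub_cancel_left, add_sub_cancel_left]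
    ring
  rw [chirpedForm, Finset.sum_congr rfl h1, Finset.sum_comm]
  refine Finset.sum_congr rfl fun j _ => ?_
  rw [Finset.sum_comm]
  refine Finset.sum_congr rfl fun k _ => ?_
  rw [fourCorr_eq_sum hα, Finset.sum_mul]

lemma chirpedForm_eq_sum_range {N : ℕ} {α : ℤ → ℝ}
    (hα : ∀ n ∉ Finset.Ico (0 : ℤ) N, α n = 0) (θ : ℝ) :
    chirpedForm N α θ =
      4 * ∑ j ∈ Finset.range (N + 1), ∑ k ∈ Finset.range (N + 1),
        fourCorr α j k * (Real.sin ((j * k : ℕ) * θ) / (j * k : ℕ)) +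
      (2 * (∑ n ∈ Finset.Ico (0 : ℤ) N, α n ^ 2) ^ 2 -
        ∑ n ∈ Finset.Ico (0 : ℤ) N, α n ^ 4) * θ := by
  set D := Finset.Icc (-N : ℤ) N
  -- Division by zero gives `0` on the axes, so the value `θ` there is added separately, by
  -- inclusion-exclusion at the origin.
  have hc (j k : ℤ) : cosIntegral (j * k) θ = Real.sin ((j * k : ℤ) * θ) / (j * k : ℤ) +
      ((if j = 0 then θ else 0) + (if k = 0 then θ else 0) -
        if j = 0 then (if k = 0 then θ else 0) else 0) := by
    unfold cosIntegral
    by_cases hj : j = 0 <;> by_cases hk : k = 0 <;> simp [hj, hk]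
  have h0 : (0 : ℤ) ∈ D := by simp [D]
  have hM : ∑ k ∈ D, fourCorr α 0 k = (∑ n ∈ Finset.Ico (0 : ℤ) N, α n ^ 2) ^ 2 := by
    simp_rw [fourCorr_eq_sum hα]
    rw [Finset.sum_comm, sq, Finset.sum_mul]
    refine Finset.sum_congr rfl fun n hn => ?_
    rw [sum_Ico_eq_sum_shift (fun p hp => by simp [hα p hp]) hn, Finset.mul_sum]
    refine Finset.sum_congr rfl fun k _ => ?_
    rw [add_zero]; ring
  have hA : fourCorr α 0 0 = ∑ n ∈ Finset.Ico (0 : ℤ) N, α n ^ 4 := by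
    rw [fourCorr_eq_sum hα]
    refine Finset.sum_congr rfl fun n _ => ?_
    simp only [add_zero]; ring
  have hS : ∑ j ∈ D, ∑ k ∈ D, fourCorr α j k * (Real.sin ((j * k : ℤ) * θ) / (j * k : ℤ)) =
      4 * ∑ j ∈ Finset.range (N + 1), ∑ k ∈ Finset.range (N + 1),
        fourCorr α j k * (Real.sin ((j * k : ℕ) * θ) / (j * k : ℕ)) := by
    have hk (j : ℤ) : ∑ k ∈ D, fourCorr α j k * (Real.sin ((j * k : ℤ) * θ) / (j * k : ℤ)) =
        2 * ∑ k ∈ Finset.range (N + 1),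
          fourCorr α j k * (Real.sin ((j * k : ℤ) * θ) / (j * k : ℤ)) := by
      have := Finset.sum_Icc_of_even_eq_range
        (f := fun k : ℤ => fourCorr α j k * (Real.sin ((j * k : ℤ) * θ) / (j * k : ℤ)))
        (fun k => by simp [fourCorr_neg_right, neg_div_neg_eq]) N
      simpa using this
    have := Finset.sum_Icc_of_even_eq_range
        (f := fun j : ℤ => ∑ k ∈ Finset.range (N + 1),
          fourCorr α j k * (Real.sin ((j * k : ℤ) * θ) / (j * k : ℤ)))
        (fun k => by simp [fourCorr_neg_left, neg_div_neg_eq]) N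
    rw [Finset.sum_congr rfl fun j _ => hk j, ← Finset.mul_sum, this]
    simp only [Int.cast_mul, Int.cast_natCast, Nat.cast_mul, Int.cast_zero, zero_mul,
      Real.sin_zero, zero_div, mul_zero, Finset.sum_const_zero, sub_zero]
    ring
  rw [chirpedForm_eq_sum_fourCorr hα]
  simp_rw [hc, mul_add, mul_sub, mul_add, Finset.sum_add_distrib, Finset.sum_sub_distrib,
    Finset.sum_add_distrib]
  rw [hS]
  have e1 : ∑ j ∈ D, ∑ k ∈ D, fourCorr α j k * (if j = 0 then θ else 0) =
      (∑ n ∈ Finset.Ico (0 : ℤ) N, α n ^ 2) ^ 2 * θ := by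
    rw [Finset.sum_eq_single_of_mem 0 h0 fun j _ hj => by simp [hj], ← hM, Finset.sum_mul]
    simp
  have e2 : ∑ j ∈ D, ∑ k ∈ D, fourCorr α j k * (if k = 0 then θ else 0) =
      (∑ n ∈ Finset.Ico (0 : ℤ) N, α n ^ 2) ^ 2 * θ := by
    rw [Finset.sum_comm, ← e1]
    simp_rw [fourCorr_comm α]
  have e3 : ∑ j ∈ D, ∑ k ∈ D, fourCorr α j k *
      (if j = 0 then (if k = 0 then θ else 0) else 0) =
      (∑ n ∈ Finset.Ico (0 : ℤ) N, α n ^ 4) * θ := by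
    rw [Finset.sum_eq_single_of_mem 0 h0 fun j _ hj => by simp [hj],
      Finset.sum_eq_single_of_mem 0 h0 fun j _ hj => by simp [hj], ← hA]
    simp
  rw [e1, e2, e3]
  ring

/-- The sequence on `ℤ` whose values from `0` on are the entries of a list. -/
def listSeq (l : List ℤ) (n : ℤ) : ℝ := if n < 0 then 0 else (l.getD n.toNat 0 : ℤ)

lemma listSeq_eq_zero (l : List ℤ) : ∀ n ∉ Finset.Ico (0 : ℤ) l.length, listSeq l n = 0 := by
  intro n hn
  unfold listSeq
  split_ifs with h
  · rfl
  · rw [List.getD_eq_default _ _ (by simp at hn; omega)]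
    simp

lemma listSeq_natCast (l : List ℤ) (n : ℕ) : listSeq l n = (l.getD n 0 : ℤ) := by
  simp [listSeq]

lemma sum_Ico_natCast (N : ℕ) (f : ℤ → ℝ) :
    ∑ n ∈ Finset.Ico (0 : ℤ) N, f n = ∑ n ∈ Finset.range N, f n := by
  refine Eq.trans ?_ (Finset.sum_map (Finset.range N) Nat.castEmbedding f)
  congr 1
  ext n
  simp only [Finset.mem_Ico, Finset.mem_map, Finset.mem_range, Nat.castEmbedding_apply]
  exact ⟨fun h => ⟨n.toNat, by omega, by omega⟩, by rintro ⟨m, h, rfl⟩; omega⟩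

/-- The power sum `∑ lₙᵏ`. -/
def powSum (l : List ℤ) (k : ℕ) : ℤ := ∑ n ∈ Finset.range l.length, l.getD n 0 ^ k

/-- The four point correlation of a list. -/
def listCorr (l : List ℤ) (j k : ℕ) : ℤ :=
  ∑ n ∈ Finset.range l.length,
    l.getD n 0 * l.getD (n + j) 0 * (l.getD (n + k) 0 * l.getD (n + j + k) 0)

/-- The pair `(cos mθ, sin mθ)`, computed from `c = cos θ` and `s = sin θ`. -/
def rotPow (c s : ℚ) : ℕ → ℚ × ℚ
  | 0 => (1, 0)
  | m + 1 => ((rotPow c s m).1 * c - (rotPow c s m).2 * s,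
      (rotPow c s m).1 * s + (rotPow c s m).2 * c)

/-- The oscillating part of `chirpedForm`, at an angle with cosine `c` and sine `s`. -/
def oscPart (l : List ℤ) (c s : ℚ) : ℚ :=
  4 * ∑ j ∈ Finset.range (l.length + 1), ∑ k ∈ Finset.range (l.length + 1),
    if listCorr l j k = 0 then 0 else listCorr l j k * ((rotPow c s (j * k)).2 / (j * k : ℕ))

lemma sum_listSeq_pow (l : List ℤ) (k : ℕ) :
    ∑ n ∈ Finset.Ico (0 : ℤ) l.length, listSeq l n ^ k = powSum l k := by
  simp [sum_Ico_natCast, listSeq_natCast, powSum]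

lemma fourCorr_listSeq (l : List ℤ) (j k : ℕ) : fourCorr (listSeq l) j k = listCorr l j k := by
  rw [fourCorr_eq_sum (listSeq_eq_zero l), sum_Ico_natCast, listCorr]
  push_cast
  refine Finset.sum_congr rfl fun n _ => ?_
  norm_cast
  simp only [listSeq_natCast]
  norm_cast

lemma rotPow_eq {c s : ℚ} {θ : ℝ} (hc : Real.cos θ = c) (hs : Real.sin θ = s) (m : ℕ) :
    ((rotPow c s m).1 : ℝ) = Real.cos (m * θ) ∧ ((rotPow c s m).2 : ℝ) = Real.sin (m * θ) := by
  induction m with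
  | zero => simp [rotPow]
  | succ m ih =>
    simp only [rotPow]
    push_cast
    rw [add_one_mul, Real.cos_add, Real.sin_add, ih.1, ih.2, hc, hs]
    exact ⟨rfl, by ring⟩

lemma chirpedForm_listSeq (l : List ℤ) {c s : ℚ} {θ : ℝ} (hc : Real.cos θ = c)
    (hs : Real.sin θ = s) : chirpedForm l.length (listSeq l) θ =
      oscPart l c s + (2 * powSum l 2 ^ 2 - powSum l 4) * θ := by
  rw [chirpedForm_eq_sum_range (listSeq_eq_zero l), sum_listSeq_pow, sum_listSeq_pow, oscPart]
  push_cast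
  congr 2
  refine Finset.sum_congr rfl fun j _ => Finset.sum_congr rfl fun k _ => ?_
  rw [fourCorr_listSeq, ← Nat.cast_mul, ← (rotPow_eq hc hs (j * k)).2]
  split_ifs with h
  · simp [h]
  · push_cast; rfl

/-- Half-angle parametrization of the circle: rational `u` makes cosine and sine rational. The base
point `π/2` keeps `|u|` small for the angles needed, so short Taylor polynomials locate them. -/
lemma cos_pi_div_two_add_two_arctan (u : ℝ) :
    Real.cos (Real.pi / 2 + 2 * Real.arctan u) = -2 * u / (1 + u ^ 2) := by
  rw [add_comm, Real.cos_add_pi_div_two, Real.sin_two_mul, Real.sin_arctan, Real.cos_arctan]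
  have : 0 ≤ 1 + u ^ 2 := by positivity
  field_simp
  rw [Real.sq_sqrt this]

lemma sin_pi_div_two_add_two_arctan (u : ℝ) :
    Real.sin (Real.pi / 2 + 2 * Real.arctan u) = (1 - u ^ 2) / (1 + u ^ 2) := by
  rw [add_comm, Real.sin_add_pi_div_two, Real.cos_two_mul, Real.cos_sq_arctan]
  have : 0 < 1 + u ^ 2 := by positivity
  field_simp
  ring

lemma arctan_taylor_lower {x : ℝ} (hx : 0 ≤ x) :
    x - x ^ 3 / 3 + x ^ 5 / 5 - x ^ 7 / 7 ≤ Real.arctan x := by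
  have hd (y : ℝ) : HasDerivAt (fun x : ℝ => Real.arctan x -
      (x - x ^ 3 / 3 + x ^ 5 / 5 - x ^ 7 / 7)) (y ^ 8 / (1 + y ^ 2)) y := by
    have := (Real.hasDerivAt_arctan y).sub (((hasDerivAt_id y).sub
      ((hasDerivAt_pow 3 y).div_const 3)).add ((hasDerivAt_pow 5 y).div_const 5) |>.sub
      ((hasDerivAt_pow 7 y).div_const 7))
    refine this.congr_deriv ?_
    have : 0 < 1 + y ^ 2 := by positivity
    field_simp
    ring
  have := monotone_of_deriv_nonneg (fun y => (hd y).differentiableAt)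
    (fun y => by rw [(hd y).deriv]; positivity) hx
  simp at this
  linarith

lemma arctan_taylor_upper {x : ℝ} (hx : 0 ≤ x) :
    Real.arctan x ≤ x - x ^ 3 / 3 + x ^ 5 / 5 - x ^ 7 / 7 + x ^ 9 / 9 := by
  have hd (y : ℝ) : HasDerivAt (fun x : ℝ =>
      (x - x ^ 3 / 3 + x ^ 5 / 5 - x ^ 7 / 7 + x ^ 9 / 9) - Real.arctan x)
      (y ^ 10 / (1 + y ^ 2)) y := by
    have := (((((hasDerivAt_id y).sub
      ((hasDerivAt_pow 3 y).div_const 3)).add ((hasDerivAt_pow 5 y).div_const 5)).sub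
      ((hasDerivAt_pow 7 y).div_const 7)).add ((hasDerivAt_pow 9 y).div_const 9)).sub
      (Real.hasDerivAt_arctan y)
    refine this.congr_deriv ?_
    have : 0 < 1 + y ^ 2 := by positivity
    field_simp
    ring
  have := monotone_of_deriv_nonneg (fun y => (hd y).differentiableAt)
    (fun y => by rw [(hd y).deriv]; positivity) hx
  simp at this
  linarith

/-- A trial list that is good at the angle `π / 2 + 2 arctan u` is good up to `hi`. -/
lemma exists_reducedWeight_pos_of_list (l : List ℤ) (u lo hi : ℚ)
    (h : powSum l 2 ^ 2 * hi < oscPart l (-2 * u / (1 + u ^ 2)) ((1 - u ^ 2) / (1 + u ^ 2)) +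
        (powSum l 2 ^ 2 - powSum l 4) * lo ∧ powSum l 4 ≤ powSum l 2 ^ 2)
    (hlo : (lo : ℝ) ≤ Real.pi / 2 + 2 * Real.arctan u)
    {ω : ℝ} (hω : 0 < ω) (h1 : Real.pi / 2 + 2 * Real.arctan u ≤ ω) (h2 : ω ≤ hi) :
    ∃ a : SeqL2, 0 < (quartic (reducedWeight ω) a).re := by
  refine ⟨_, reducedWeight_chirped_pos (listSeq_eq_zero l) hω h1 ?_⟩
  rw [chirpedForm_listSeq l (c := -2 * u / (1 + u ^ 2)) (s := (1 - u ^ 2) / (1 + u ^ 2))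
    (by rw [cos_pi_div_two_add_two_arctan]; push_cast; rfl)
    (by rw [sin_pi_div_two_add_two_arctan]; push_cast; rfl), sum_listSeq_pow]
  set θ := Real.pi / 2 + 2 * Real.arctan u
  -- With `A = Σαₙ⁴` the goal reads `M²ω < osc + (M² - A)θ`; as `A ≤ M²`, it suffices to test it at
  -- `lo ≤ θ` and `hi ≥ ω`.
  obtain ⟨h3, h4⟩ := h
  have h3' : (powSum l 2 ^ 2 * hi : ℝ) < oscPart l (-2 * u / (1 + u ^ 2))
      ((1 - u ^ 2) / (1 + u ^ 2)) + (powSum l 2 ^ 2 - powSum l 4) * lo := by exact_mod_cast h3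
  have h4' : (powSum l 4 : ℝ) ≤ powSum l 2 ^ 2 := by exact_mod_cast h4
  have h5 := mul_le_mul_of_nonneg_left hlo (sub_nonneg.2 h4')
  have h6 := mul_le_mul_of_nonneg_left h2 (sq_nonneg (powSum l 2 : ℝ))
  linarith

/-- A trial list that is good at the angle `π / 2 + 2 arctan u` is good on `[lo', hi]`. -/
lemma exists_reducedWeight_pos_of_list_of_nonneg (l : List ℤ) (u lo lo' hi : ℚ)
    (h : powSum l 2 ^ 2 * hi < oscPart l (-2 * u / (1 + u ^ 2)) ((1 - u ^ 2) / (1 + u ^ 2)) +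
        (powSum l 2 ^ 2 - powSum l 4) * lo ∧ powSum l 4 ≤ powSum l 2 ^ 2)
    (hu : 0 ≤ u ∧ lo ≤ 1.570796 + 2 * (u - u ^ 3 / 3 + u ^ 5 / 5 - u ^ 7 / 7) ∧
      1.570797 + 2 * (u - u ^ 3 / 3 + u ^ 5 / 5 - u ^ 7 / 7 + u ^ 9 / 9) ≤ lo' ∧ 0 < lo')
    {ω : ℝ} (h1 : lo' ≤ ω) (h2 : ω ≤ hi) :
    ∃ a : SeqL2, 0 < (quartic (reducedWeight ω) a).re := by
  obtain ⟨hu0, hl, hl', hp⟩ := hu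
  have hu0' : (0 : ℝ) ≤ u := by exact_mod_cast hu0
  have hp' : (0 : ℝ) < lo' := by exact_mod_cast hp
  rw [← Rat.cast_le (K := ℝ)] at hl hl'
  push_cast at hl hl'
  have := arctan_taylor_lower hu0'
  have := arctan_taylor_upper hu0'
  have := Real.pi_gt_d6
  have := Real.pi_lt_d6
  exact exists_reducedWeight_pos_of_list l u lo hi h (by linarith) (by linarith) (by linarith) h2

/-- Here `θ = ω`. For `5, 6, 5` the only correlation with `jk ≠ 0`, up to signs, is `5·6·6·5 = 900`,
and the criterion becomes `2546 ω < 3600 sin ω`. -/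
lemma exists_reducedWeight_pos_of_small {ω : ℝ} (hω : 0 < ω) (hω' : ω ≤ 1.323) :
    ∃ a : SeqL2, 0 < (quartic (reducedWeight ω) a).re := by
  refine ⟨_, reducedWeight_chirped_pos (listSeq_eq_zero [5, 6, 5]) hω le_rfl ?_⟩
  rw [chirpedForm_eq_sum_range (listSeq_eq_zero _), sum_listSeq_pow, sum_listSeq_pow]
  have h1 : powSum [5, 6, 5] 2 = 86 := by decide +kernel
  have h2 : powSum [5, 6, 5] 4 = 2546 := by decide +kernel
  have hc (j k : ℕ) (hj : j ≤ 3) (hk : k ≤ 3) (h : 0 < j * k) :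
      listCorr [5, 6, 5] j k = if j = 1 ∧ k = 1 then 900 else 0 := by
    interval_cases j <;> interval_cases k <;> first | omega | decide +kernel
  have h3 : ∑ j ∈ Finset.range (3 + 1), ∑ k ∈ Finset.range (3 + 1),
      fourCorr (listSeq [5, 6, 5]) j k * (Real.sin ((j * k : ℕ) * ω) / (j * k : ℕ)) =
      900 * Real.sin ω := by
    simp_rw [fourCorr_listSeq]
    simp [Finset.sum_range_succ, hc]
  have h4 := Real.sin_ge_sub_cube hω.le
  rw [show ([5, 6, 5] : List ℤ).length = 3 from rfl, h3, h1, h2]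
  have h5 : ω ^ 3 ≤ 1.323 ^ 2 * ω := by
    rw [pow_succ]
    gcongr
  push_cast
  linarith

/-- Each list covers an interval from just above its angle `θ` to at most `F(θ)/M² - θ`; the
intervals are chained so that they exhaust `(0, 2.61)`. -/
theorem exists_reducedWeight_pos {ω : ℝ} (hω : 0 < ω) (hω' : ω < 2.61) :
    ∃ a : SeqL2, 0 < (quartic (reducedWeight ω) a).re := by
  rcases le_or_gt ω 1.323 with h0 | h0
  · exact exists_reducedWeight_pos_of_small hω h0
  rcases le_or_gt ω 1.732 with h1 | h1
  · have := arctan_taylor_lower (x := 1 / 8) (by norm_num)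
    have := arctan_taylor_upper (x := 1 / 8) (by norm_num)
    have := Real.pi_gt_d6
    have := Real.pi_lt_d6
    have e : Real.arctan ((-1 / 8 : ℚ) : ℝ) = -Real.arctan (1 / 8) := by
      rw [← Real.arctan_neg]; norm_num
    exact exists_reducedWeight_pos_of_list [1, 3, 4, 4, 3, 1] (-1 / 8) 1.322 1.732
      (by decide +kernel) (by rw [e]; push_cast; linarith) hω (by rw [e]; linarith)
      (by push_cast; linarith)
  rcases le_or_gt ω 2.03 with h2 | h2
  · exact exists_reducedWeight_pos_of_list_of_nonneg
      [1, 3, -3, 3, 3, 3, -3, 3, 3, 3, -3, 3]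
      (2 / 25) 1.7304 1.732 2.03 (by decide +kernel) (by norm_num)
      (by push_cast; linarith) (by push_cast; linarith)
  rcases le_or_gt ω 2.242 with h3 | h3
  · exact exists_reducedWeight_pos_of_list_of_nonneg
      [3, -3, 4, 4, 4, -4, 4, 3, 3, -1]
      (3 / 13) 2.0243 2.03 2.242 (by decide +kernel) (by norm_num)
      (by push_cast; linarith) (by push_cast; linarith)
  rcases le_or_gt ω 2.4 with h4 | h4
  · exact exists_reducedWeight_pos_of_list_of_nonneg
      [2, -3, -3, -3, 4, 4, 4, -4, -4, -4, 3, 3, 3, -2]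
      (8 / 23) 2.2402 2.242 2.4 (by decide +kernel) (by norm_num)
      (by push_cast; linarith) (by push_cast; linarith)
  rcases le_or_gt ω 2.5 with h5 | h5
  · exact exists_reducedWeight_pos_of_list_of_nonneg
      [2, -3, -3, -3, 4, 4, 4, -4, -4, -4, 3, 3, 3, -2]
      (11 / 25) 2.3996 2.4 2.5 (by decide +kernel) (by norm_num)
      (by push_cast; linarith) (by push_cast; linarith)
  rcases le_or_gt ω 2.56 with h6 | h6
  · exact exists_reducedWeight_pos_of_list_of_nonneg
      [-2, 3, 2, 2, -3, -3, 2, -3, -3, 3, 3, 4, -3, -3, -3, 2]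
      (1 / 2) 2.4977 2.5 2.56 (by decide +kernel) (by norm_num)
      (by push_cast; linarith) (by push_cast; linarith)
  rcases le_or_gt ω 2.605 with h7 | h7
  · exact exists_reducedWeight_pos_of_list_of_nonneg
      [-2, 3, 2, 3, -3, -3, 3, -4, -4, 3, -3, -3, 3, 2, 3, -2]
      (7 / 13) 2.5579 2.56 2.605 (by decide +kernel) (by norm_num)
      (by push_cast; linarith) (by push_cast; linarith)
  exact exists_reducedWeight_pos_of_list_of_nonneg
    [-2, 3, 2, 3, -3, -3, 3, -4, -4, 3, -3, -3, 3, 2, 3, -2]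
    (13 / 23) 2.5986 2.605 2.61 (by decide +kernel) (by norm_num)
    (by push_cast; linarith) (by push_cast; linarith)

end DMNLS

namespace DMNLS

/-! ### The Hamiltonian as a phase-invariant quartic form -/

section Hamiltonian

variable {L : ℝ} [Fact (0 < L)]

/-- The Hamiltonian as a real quadrilinear form. -/
noncomputable def hamiltonianForm (L : ℝ) [Fact (0 < L)] :
    ContinuousMultilinearMap ℝ (fun _ : Fin 4 => PerL2 L) ℝ :=
  (-(2 * Real.pi) • Complex.reCLM).compContinuousMultilinearMap
    ((quadForm (by have := waveFrequency_pos (L := L); positivity)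
      (weightBound_waveWeight (waveFrequency_pos (L := L)))).compContinuousLinearMap
        fun _ => (coeff (L := L)).restrictScalars ℝ)

lemma hamiltonianForm_diag (u : PerL2 L) : (hamiltonianForm L fun _ => u) = hamiltonian L u := by
  rw [hamiltonian_eq]
  rfl

lemma inner_real_eq_re (u v : PerL2 L) : inner ℝ u v = (inner ℂ u v : ℂ).re := by
  rw [L2.inner_def, L2.inner_def]
  exact integral_re (L2.integrable_inner (𝕜 := ℂ) u v)

lemma realInner_eq_inner (u v : PerL2 L) : realInner L u v = inner ℝ u v := by
  rw [real_inner_comm, inner_real_eq_re, L2.inner_def, realInner]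
  rfl

/-- Multiplication by the imaginary unit. -/
noncomputable def mulI (L : ℝ) [Fact (0 < L)] : PerL2 L →L[ℝ] PerL2 L :=
  (Complex.I • ContinuousLinearMap.id ℂ (PerL2 L)).restrictScalars ℝ

lemma mulI_apply (u : PerL2 L) : mulI L u = Complex.I • u := rfl

lemma inner_mulI (u v : PerL2 L) : inner ℝ u (mulI L v) = -inner ℝ (mulI L u) v := by
  rw [inner_real_eq_re, inner_real_eq_re, mulI_apply, mulI_apply, inner_smul_left,
    inner_smul_right, Complex.conj_I, neg_mul, Complex.neg_re, neg_neg]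

lemma quartic_smul_of_norm_eq_one (w : ℤ → ℤ → ℂ) {z : ℂ} (hz : ‖z‖ = 1) (a : SeqL2) :
    quartic w (z • a) = quartic w a := by
  refine tsum_congr fun p => ?_
  have h : z * conj z = 1 := by
    rw [Complex.mul_conj, Complex.normSq_eq_norm_sq, hz]; norm_num
  simp only [quadTerm, lp.coeFn_smul, Pi.smul_apply, smul_eq_mul, map_mul]
  linear_combination (w p.2.1 p.2.2 * (a (p.1 + p.2.1) * a (p.1 + p.2.2) * conj (a p.1)
    * conj (a (p.1 + p.2.1 + p.2.2)))) * (z * conj z + 1) * h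

lemma hamiltonianForm_rotation (θ : ℝ) (u : PerL2 L) :
    (hamiltonianForm L fun _ => Real.cos θ • u + Real.sin θ • mulI L u)
      = hamiltonianForm L fun _ => u := by
  have h : Real.cos θ • u + Real.sin θ • mulI L u = Complex.exp (θ * Complex.I) • u := by
    rw [mulI_apply, Complex.exp_mul_I, add_smul, ← Complex.ofReal_cos, ← Complex.ofReal_sin,
      mul_smul]
    exact congrArg₂ (· + ·) (algebraMap_smul ℂ _ _).symm (algebraMap_smul ℂ _ _).symm
  rw [h, hamiltonianForm_diag, hamiltonianForm_diag, hamiltonian_eq, hamiltonian_eq, waveForm,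
    waveForm, map_smul, quartic_smul_of_norm_eq_one _ (Complex.norm_exp_ofReal_mul_I θ)]

lemma isGradient_iff (u g : PerL2 L) :
    IsGradient L u g ↔ g = quarticGradient (hamiltonianForm L) u := by
  have h : ∀ v : PerL2 L, Tendsto (fun ε : ℝ => (hamiltonian L (u + ε • v) - hamiltonian L u) / ε)
      (𝓝[≠] 0) (𝓝 (inner ℝ (quarticGradient (hamiltonianForm L) u) v)) := fun v => by
    have h1 := ((hasFDerivAt_quartic (hamiltonianForm L) u).hasLineDerivAt v).tendsto_slope_zero
    rw [inner_quarticGradient]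
    simpa only [hamiltonianForm_diag, smul_eq_mul, div_eq_inv_mul] using h1
  constructor
  · intro hg
    refine ext_inner_right ℝ fun v => ?_
    rw [← realInner_eq_inner]
    exact tendsto_nhds_unique (hg v) (h v)
  · rintro rfl v
    rw [realInner_eq_inner]
    exact h v

lemma isSolution_iff (u₀ : PerL2 L) (u : ℝ → PerL2 L) :
    IsSolution L u₀ u ↔ u 0 = u₀ ∧ ∀ t, 0 ≤ t →
      HasDerivWithinAt u (-mulI L (quarticGradient (hamiltonianForm L) (u t))) (Set.Ici 0) t := by
  simp only [IsSolution, isGradient_iff, exists_eq_left, mulI_apply]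

lemma power_eq_iff {lam : ℝ} (hlam : 0 < lam) (u : PerL2 L) :
    power L u = lam ↔ ‖u‖ = Real.sqrt (2 * lam) := by
  rw [power, ← norm_sq_eq_integral, eq_comm (a := ‖u‖), Real.sqrt_eq_iff_eq_sq (by positivity)
    (norm_nonneg _)]
  constructor <;> intro h <;> linarith

end Hamiltonian

/-! ### Ground states from maximizers of the coefficient problem -/

section GroundStates

variable {L lam : ℝ} [Fact (0 < L)]

/-- Existence of ground states, and almost minimizers are close to ground states. -/
theorem groundStates_compactness (hlam : 0 < lam)
    (hpos : ∃ a : SeqL2, 0 < (quartic (reducedWeight ((2 * Real.pi / L) ^ 2)) a).re) :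
    (groundStates L lam).Nonempty ∧ ∃ E : ℝ,
      (∀ φ ∈ groundStates L lam, ‖φ‖ = Real.sqrt (2 * lam) ∧ hamiltonian L φ = E) ∧
      ∀ ε : ℝ, 0 < ε → ∃ η : ℝ, 0 < η ∧ ∀ u : PerL2 L, ‖u‖ = Real.sqrt (2 * lam) →
        hamiltonian L u < E + η → Metric.infDist u (groundStates L lam) < ε := by
  have hL : 0 < L := length_pos
  have hω := waveFrequency_pos (L := L)
  set ω := (2 * Real.pi / L) ^ 2 with hωdef
  set r := Real.sqrt (2 * lam) with hr
  have hr0 : 0 < r := Real.sqrt_pos.2 (by positivity)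
  set ρ := r / Real.sqrt L with hρ
  have hsL : 0 < Real.sqrt L := Real.sqrt_pos.2 hL
  have hρ0 : 0 < ρ := by positivity
  obtain ⟨K, hK, ⟨φ₀, hφ₀, hφ₀K⟩, hcomp⟩ := exists_maximizers (w := reducedWeight ω)
    (by positivity) (weightBound_reducedWeight hω) (weightDecay_reducedWeight hω) hpos
  have hwave : ∀ u : PerL2 L, waveForm L u
      = 2 * ‖coeff u‖ ^ 4 + (quartic (reducedWeight ω) (coeff u)).re := fun u => by
    rw [waveForm, quartic_waveWeight hω, Complex.add_re]
    norm_cast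
  have hpi := Real.pi_pos
  -- The minimal energy: `ρ` is the common norm of the coefficient sequences at power `lam`, and the
  -- form is homogeneous of degree four.
  set E := -(2 * Real.pi) * (K * ρ ^ 4) with hE
  have hnorm : ∀ u : PerL2 L, ‖u‖ = r → ‖coeff u‖ = ρ := fun u hu => by rw [norm_coeff, hu]
  have hlow : ∀ u : PerL2 L, ‖u‖ = r → E ≤ hamiltonian L u := fun u hu => by
    rw [hamiltonian_eq, hwave, hE]
    have h := hK (coeff u)
    rw [hnorm u hu] at h ⊢
    nlinarith
  have hlift : ∀ φ : SeqL2, ‖φ‖ = 1 → 2 + (quartic (reducedWeight ω) φ).re = K →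
      ∃ ψ : PerL2 L, coeff ψ = ρ • φ ∧ ‖ψ‖ = r ∧ hamiltonian L ψ = E := fun φ hφ hφK => by
    obtain ⟨ψ, hψ⟩ := coeff_surjective (L := L) (ρ • φ)
    have hn : ‖coeff ψ‖ = ρ := by rw [hψ, norm_smul, hφ, mul_one, Real.norm_of_nonneg hρ0.le]
    refine ⟨ψ, hψ, ?_, ?_⟩
    · rwa [norm_coeff, hρ, div_left_inj' hsL.ne'] at hn
    · rw [hamiltonian_eq, hwave, hn, hψ, quartic_smul, ← Complex.ofReal_pow,
        Complex.re_ofReal_mul, hE, ← hφK]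
      ring
  have hmem : ∀ ψ : PerL2 L, ‖ψ‖ = r → hamiltonian L ψ = E → ψ ∈ groundStates L lam :=
    fun ψ h1 h2 => ⟨(power_eq_iff hlam ψ).2 h1, fun χ hχ => by
      rw [h2]; exact hlow χ ((power_eq_iff hlam χ).1 hχ)⟩
  obtain ⟨ψ₀, -, hψ₀, hψ₀E⟩ := hlift φ₀ hφ₀ hφ₀K
  refine ⟨⟨ψ₀, hmem ψ₀ hψ₀ hψ₀E⟩, E, fun φ hφ => ?_, fun ε hε => ?_⟩
  · have h1 := (power_eq_iff hlam φ).1 hφ.1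
    refine ⟨h1, le_antisymm ?_ (hlow φ h1)⟩
    rw [← hψ₀E]
    exact hφ.2 ψ₀ ((power_eq_iff hlam ψ₀).2 hψ₀)
  -- Normalized coefficient sequences at distance `d` correspond to functions at distance `ρ√L d = r
  -- d`.
  · obtain ⟨η, hη, hclose⟩ := hcomp (ε / r) (by positivity)
    refine ⟨2 * Real.pi * ρ ^ 4 * η, by positivity, fun u hu hHu => ?_⟩
    set a : SeqL2 := ρ⁻¹ • coeff u with ha
    have hua : coeff u = ρ • a := by rw [ha, smul_smul, mul_inv_cancel₀ hρ0.ne', one_smul]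
    have ha1 : ‖a‖ = 1 := by
      rw [ha, norm_smul, hnorm u hu, norm_inv, Real.norm_of_nonneg hρ0.le, inv_mul_cancel₀ hρ0.ne']
    have haK : K - η < 2 + (quartic (reducedWeight ω) a).re := by
      rw [hamiltonian_eq, hwave, hnorm u hu, hua, quartic_smul, ← Complex.ofReal_pow,
        Complex.re_ofReal_mul, hE] at hHu
      have hp : 0 < 2 * Real.pi * ρ ^ 4 := by positivity
      have : 2 * Real.pi * ρ ^ 4 * (K - η)
          < 2 * Real.pi * ρ ^ 4 * (2 + (quartic (reducedWeight ω) a).re) := by linarith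
      exact lt_of_mul_lt_mul_left this hp.le
    obtain ⟨φ, hφ, hφK, hd⟩ := hclose a ha1 haK
    obtain ⟨ψ, hψ, hψr, hψE⟩ := hlift φ hφ hφK
    refine (Metric.infDist_le_dist_of_mem (hmem ψ hψr hψE)).trans_lt ?_
    have h1 : ‖coeff (u - ψ)‖ = ρ * ‖a - φ‖ := by
      rw [map_sub, hψ, hua, ← smul_sub, norm_smul, Real.norm_of_nonneg hρ0.le]
    rw [norm_coeff, div_eq_iff hsL.ne', hρ] at h1
    rw [dist_eq_norm, h1]
    rw [lt_div_iff₀ hr0] at hd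
    calc r / Real.sqrt L * ‖a - φ‖ * Real.sqrt L = ‖a - φ‖ * r := by field_simp
      _ < ε := hd

end GroundStates

end DMNLS

/-! ### Orbital stability of the set of ground states -/

theorem mainTheorem5 (B₄ : ℝ) (hB₄ : |B₄ - 2.60| ≤ 0.01) (L : ℝ) [Fact (0 < L)]
    (hL : 2 * Real.pi / Real.sqrt B₄ < L) (lam : ℝ) (hlam : 0 < lam) :
    (DMNLS.groundStates L lam).Nonempty ∧
    ∀ ε : ℝ, 0 < ε → ∃ δ : ℝ, 0 < δ ∧
      ∀ u₀ : DMNLS.PerL2 L, Metric.infDist u₀ (DMNLS.groundStates L lam) < δ →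
        ∃ u : ℝ → DMNLS.PerL2 L, DMNLS.IsSolution L u₀ u ∧
          (∀ v : ℝ → DMNLS.PerL2 L, DMNLS.IsSolution L u₀ v → ∀ t : ℝ, 0 ≤ t → v t = u t) ∧
          ∀ t : ℝ, 0 ≤ t → Metric.infDist (u t) (DMNLS.groundStates L lam) < ε := by
  have hLpos : 0 < L := Fact.out
  obtain ⟨hB1, hB2⟩ := abs_le.1 hB₄
  have hB : 0 < B₄ := by linarith
  -- The bounds on `B₄` and `L` enter only through this inequality, the range in which a positive
  -- trial value is available.
  have hω : (2 * Real.pi / L) ^ 2 < 2.61 := by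
    have hs : 0 < Real.sqrt B₄ := Real.sqrt_pos.2 hB
    have h1 : 2 * Real.pi / L < Real.sqrt B₄ := by
      rw [div_lt_iff₀ hs] at hL
      rw [div_lt_iff₀ hLpos]
      linarith
    have h2 : 0 ≤ 2 * Real.pi / L := by have := Real.pi_pos; positivity
    calc (2 * Real.pi / L) ^ 2 < Real.sqrt B₄ ^ 2 := pow_lt_pow_left₀ h1 h2 two_ne_zero
      _ = B₄ := Real.sq_sqrt hB.le
      _ ≤ 2.61 := by linarith
  obtain ⟨hne, E, hSE, hcomp⟩ := DMNLS.groundStates_compactness (L := L) hlam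
    (DMNLS.exists_reducedWeight_pos DMNLS.waveFrequency_pos hω)
  refine ⟨hne, fun ε hε => ?_⟩
  have hF : ∀ R : ℝ, ∃ K : NNReal,
      LipschitzOnWith K (DMNLS.hamiltonian L) (Metric.closedBall 0 R) := fun R => by
    simpa only [DMNLS.hamiltonianForm_diag] using
      DMNLS.quartic_lipschitzOn (DMNLS.hamiltonianForm L) R
  obtain ⟨δ, hδ, hstable⟩ := DMNLS.exists_delta_of_almost_minimizers hF
    (Real.sqrt_pos.2 (by positivity : 0 < 2 * lam)) hne hSE hcomp hε
  refine ⟨δ, hδ, fun u₀ hu₀ => ?_⟩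
  obtain ⟨u, ⟨hu0, hu⟩, huniq, hcons⟩ := DMNLS.exists_hamiltonian_flow
    (DMNLS.inner_mulI (L := L)) DMNLS.hamiltonianForm_rotation u₀
  refine ⟨u, (DMNLS.isSolution_iff u₀ u).2 ⟨hu0, hu⟩, fun v hv => ?_, fun t ht => ?_⟩
  · obtain ⟨hv0, hv⟩ := (DMNLS.isSolution_iff u₀ v).1 hv
    exact huniq v hv0 hv
  · obtain ⟨h1, h2⟩ := hcons t ht
    rw [DMNLS.hamiltonianForm_diag, DMNLS.hamiltonianForm_diag] at h2
    exact hstable u₀ hu₀ (u t) h1 h2
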